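/- Let $V$ be a complex vector space of dimension $m$ with a non-degenerate bilinear form $\langle\,,\rangle$ that is symmetric ($\epsilon=1$) or alternating ($\epsilon=-1$), let $G=SO(V)$ if $\epsilon=1$ and $G=Sp(V)$ if $\epsilon=-1$, and let $\mathfrak g\subset\mathrm{End}(V)$ be its Lie algebra. Let $\mathcal O_{\mathbf d}\subset\mathfrak g$ be a nilpotent $G$-orbit of Jordan type $\mathbf d=[d_1^{s_1},\dots,d_k^{s_k}]$, $d_1>\dots>d_k>0$, a partition of $m$ (if $\epsilon=1$ and $\mathbf d$ is very even, any one of the two $G$-orbits of that type). Assume that $\mathbf d$ does not have full members, i.e. some integer $j$ with $1\le j\le d_1$ is not among $d_1,\dots,d_k$. Then there is an index $p$ such that either $p<k$ and $d_p\ge d_{p+1}+2$, or $p=k$ and $d_k\ge 2$. For every such $p$ put $r=\sum_{j\le p}s_j$ and let $\mathbf d'$ be the partition of $m-2r$ obtained from $[(d_1-2)^{s_1},\dots,(d_p-2)^{s_p},d_{p+1}^{s_{p+1}},\dots,d_k^{s_k}]$ by removing zeros. Consider parabolic subgroups $Q\subset G$ with isotropic flag type $(r,m-2r,r)$, i.e.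 $Q$ is the stabilizer in $G$ of an isotropic subspace $F_0\subset V$ of dimension $r$, with a Levi decomposition $\mathfrak q=\mathfrak l\oplus\mathfrak n$, $\mathfrak l\cong\mathfrak{gl}(r)\oplus\mathfrak g'$, where $\mathfrak g'=\mathfrak{so}(m-2r)$ or $\mathfrak{sp}(m-2r)$ respectively. (1) There are such a $Q$ and a nilpotent orbit $\mathcal O'\subset\mathfrak g'\subset\mathfrak l$ of Jordan type $\mathbf d'$ such that $\mathcal O_{\mathbf d}=\mathrm{Ind}_{\mathfrak l}^{\mathfrak g}(\mathcal O')$, i.e. $\mathcal O_{\mathbf d}$ meets $\mathfrak n+\mathcal O'$ in an open dense subset of it. (2) For all such $Q$ and $\mathcal O'$ with $\mathcal O_{\mathbf d}=\mathrm{Ind}_{\mathfrak l}^{\mathfrak g}(\mathcal O')$, the generalized Springer map $$\nu\colon G\times^Q(\mathfrak n+\overline{\mathcal O'})\to\overline{\mathcal O_{\mathbf d}},\qquad [g,z]\mapsto \mathrm{Ad}_g(z),$$ is birational (a morphism that restricts to an isomorphism between dense open subsets), i.e. $\deg(\nu)=1$. Moreover, $\nu^{-1}(z)$ is a single point for every $z\in\mathcal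 O_{\mathbf d}$, and if this point is $[g,z']$, then $F=gF_0$ is the subspace described in (3). (3) For every $z\in\mathcal O_{\mathbf d}$ there is exactly one isotropic subspace $F\subset V$ of dimension $r$ such that $z(F)=0$ and the endomorphism of $F^\perp/F$ induced by $z$ has Jordan type $\mathbf d'$. -/

import Mathlib

/-! ### Zariski topology and regular functions -/

namespace ClassicalVariety

open scoped Topology

/-- The algebra of polynomial functions on a complex vector space: the functions generated by the
linear forms. -/
def polyFun (W : Type*) [AddCommGroup W] [Module ℂ W] : Subalgebra ℂ (W → ℂ) :=
  Algebra.adjoin ℂ (Set.range fun l : Module.Dual ℂ W => (l : W → ℂ))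

/-- The principal open sets `{f ≠ 0}`, for `f` a polynomial function. -/
def principalOpens (W : Type*) [AddCommGroup W] [Module ℂ W] : Set (Set W) :=
  {D | ∃ f ∈ polyFun W, D = {w | f w ≠ 0}}

/-- The Zariski topology on a complex vector space. -/
@[reducible] def zariski (W : Type*) [AddCommGroup W] [Module ℂ W] : TopologicalSpace W :=
  TopologicalSpace.generateFrom (principalOpens W)

theorem zariski_basis (W : Type*) [AddCommGroup W] [Module ℂ W] :
    @TopologicalSpace.IsTopologicalBasis W (zariski W) (principalOpens W) := by
  let _ := zariski W
  refine ⟨?_, ?_, rfl⟩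
  · rintro _ ⟨f, hf, rfl⟩ _ ⟨g, hg, rfl⟩ x ⟨hx, hx'⟩
    refine ⟨_, ⟨f * g, mul_mem hf hg, rfl⟩, mul_ne_zero hx hx', ?_⟩
    intro y hy
    exact ⟨left_ne_zero_of_mul hy, right_ne_zero_of_mul hy⟩
  · refine Set.eq_univ_of_forall fun x => ⟨_, ⟨1, one_mem _, rfl⟩, ?_⟩
    simp

/-- The Zariski closure of a subset of a complex vector space. -/
def zariskiClosure {W : Type*} [AddCommGroup W] [Module ℂ W] (S : Set W) : Set W :=
  @closure W (zariski W) S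

/-- `A ∩ S` is open and dense in `S`, for the Zariski topology of the subset `S`. -/
def MeetsInOpenDense {W : Type*} [AddCommGroup W] [Module ℂ W] (A S : Set W) : Prop :=
  (∃ U : Set W, IsOpen[zariski W] U ∧ A ∩ S = U ∩ S) ∧ S ⊆ zariskiClosure (A ∩ S)

theorem continuous_zariski {W W' : Type*} [AddCommGroup W] [Module ℂ W] [AddCommGroup W']
    [Module ℂ W'] (l : W →ₗ[ℂ] W') (c : W') :
    @Continuous W W' (zariski W) (zariski W') (fun w => l w + c) := by
  let _ := zariski W
  refine continuous_generateFrom_iff.2 ?_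
  rintro _ ⟨f, hf, rfl⟩
  refine TopologicalSpace.isOpen_generateFrom_of_mem ⟨fun w => f (l w + c), ?_, rfl⟩
  induction hf using Algebra.adjoin_induction with
  | mem f hf =>
    obtain ⟨k, rfl⟩ := hf
    have : (fun w => k (l w + c)) = ((k.comp l : Module.Dual ℂ W) : W → ℂ) +
        algebraMap ℂ (W → ℂ) (k c) := by
      funext w
      simp
    rw [this]
    exact add_mem (Algebra.subset_adjoin ⟨_, rfl⟩) (Subalgebra.algebraMap_mem _ _)
  | algebraMap r => exact Subalgebra.algebraMap_mem (polyFun W) r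
  | add f g _ _ hf hg => exact add_mem hf hg
  | mul f g _ _ hf hg => exact mul_mem hf hg

/-- A space with functions over `ℂ`: a topological space with a sheaf of algebras of complex valued
functions. Functions on an open set `U` are represented by functions on the whole space, of which
only the values on `U` matter. -/
structure SpaceWithFunctions (X : Type*) where
  top : TopologicalSpace X
  IsRegularOn : Set X → (X → ℂ) → Prop
  congr : ∀ {U φ ψ}, Set.EqOn φ ψ U → IsRegularOn U φ → IsRegularOn U ψ
  const : ∀ U c, IsRegularOn U fun _ => c
  add : ∀ {U φ ψ}, IsRegularOn U φ → IsRegularOn U ψ → IsRegularOn U (φ + ψ)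
  mul : ∀ {U φ ψ}, IsRegularOn U φ → IsRegularOn U ψ → IsRegularOn U (φ * ψ)
  mono : ∀ {U V φ}, U ⊆ V → IsRegularOn V φ → IsRegularOn U φ
  glue : ∀ {U φ}, (∀ x ∈ U, ∃ V ⊆ U, x ∈ V ∧ IsOpen[top] V ∧ IsRegularOn V φ) → IsRegularOn U φ

/-- The structure of a (reduced) variety on a subset of a complex vector space `W`, given as the
image of an (injective) map `ι : X → W`: the Zariski topology, and the functions that are
locally quotients of polynomials. -/
def embedded {X W : Type*} [AddCommGroup W] [Module ℂ W] (ι : X → W) : SpaceWithFunctions X where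
  top := (zariski W).induced ι
  IsRegularOn U φ := ∀ x ∈ U, ∃ p ∈ polyFun W, ∃ q ∈ polyFun W, q (ι x) ≠ 0 ∧
    ∀ y ∈ U, q (ι y) ≠ 0 → φ y = p (ι y) / q (ι y)
  congr := by
    intro U φ ψ h hφ x hx
    obtain ⟨p, hp, q, hq, h0, h1⟩ := hφ x hx
    exact ⟨p, hp, q, hq, h0, fun y hy hy' => by rw [← h hy, h1 y hy hy']⟩
  const U c x _ := ⟨algebraMap ℂ _ c, Subalgebra.algebraMap_mem _ _, 1, one_mem _, by simp,
    by simp⟩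
  add := by
    intro U φ ψ hφ hψ x hx
    obtain ⟨p, hp, q, hq, h0, h1⟩ := hφ x hx
    obtain ⟨p', hp', q', hq', h0', h1'⟩ := hψ x hx
    refine ⟨p * q' + q * p', add_mem (mul_mem hp hq') (mul_mem hq hp'), q * q', mul_mem hq hq',
      mul_ne_zero h0 h0', fun y hy hy' => ?_⟩
    have a := left_ne_zero_of_mul hy'
    have b := right_ne_zero_of_mul hy'
    simp only [Pi.add_apply, Pi.mul_apply, h1 y hy a, h1' y hy b]
    exact div_add_div _ _ a b
  mul := by
    intro U φ ψ hφ hψ x hx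
    obtain ⟨p, hp, q, hq, h0, h1⟩ := hφ x hx
    obtain ⟨p', hp', q', hq', h0', h1'⟩ := hψ x hx
    refine ⟨p * p', mul_mem hp hp', q * q', mul_mem hq hq',
      mul_ne_zero h0 h0', fun y hy hy' => ?_⟩
    have a := left_ne_zero_of_mul hy'
    have b := right_ne_zero_of_mul hy'
    simp only [Pi.mul_apply, h1 y hy a, h1' y hy b]
    exact div_mul_div_comm _ _ _ _
  mono := by
    intro U V φ h hφ x hx
    obtain ⟨p, hp, q, hq, h0, h1⟩ := hφ x (h hx)
    exact ⟨p, hp, q, hq, h0, fun y hy => h1 y (h hy)⟩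
  glue := by
    intro U φ h x hx
    obtain ⟨V, _, hxV, hV, hφ⟩ := h x hx
    obtain ⟨p, hp, q, hq, h0, h1⟩ := hφ x hxV
    let _ := zariski W
    obtain ⟨T, hT, rfl⟩ := isOpen_induced_iff.1 hV
    obtain ⟨_, ⟨f, hf, rfl⟩, hfx, hfT⟩ :=
      (zariski_basis W).exists_subset_of_mem_open (a := ι x) hxV hT
    refine ⟨p * f, mul_mem hp hf, q * f, mul_mem hq hf, mul_ne_zero h0 hfx, fun y _ hy' => ?_⟩
    have a := left_ne_zero_of_mul hy'
    have b := right_ne_zero_of_mul hy'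
    rw [h1 y (hfT b) a]
    exact (mul_div_mul_right _ _ b).symm

/-- The quotient of a space with functions by an equivalence relation: the quotient topology,
and the functions whose pull-back is regular. -/
def SpaceWithFunctions.quotient {X : Type*} (S : SpaceWithFunctions X) (s : Setoid X) :
    SpaceWithFunctions (Quotient s) where
  top := S.top.coinduced (Quotient.mk s)
  IsRegularOn U φ := S.IsRegularOn (Quotient.mk s ⁻¹' U) (φ ∘ Quotient.mk s)
  congr h hφ := S.congr (fun _ hx => h hx) hφ
  const _ c := S.const _ c
  add hφ hψ := S.add hφ hψ
  mul hφ hψ := S.mul hφ hψ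
  mono h hφ := S.mono (Set.preimage_mono h) hφ
  glue := by
    intro U φ h
    refine S.glue fun x hx => ?_
    obtain ⟨V, hVU, hxV, hV, hφ⟩ := h _ hx
    exact ⟨_, Set.preimage_mono hVU, hxV, isOpen_coinduced.1 hV, hφ⟩

/-- Morphisms: continuous maps that pull back regular functions to regular functions. -/
def IsMorphism {X Y : Type*} (SX : SpaceWithFunctions X) (SY : SpaceWithFunctions Y)
    (f : X → Y) : Prop :=
  (∀ T, IsOpen[SY.top] T → IsOpen[SX.top] (f ⁻¹' T)) ∧
  ∀ T, IsOpen[SY.top] T → ∀ φ, SY.IsRegularOn T φ → SX.IsRegularOn (f ⁻¹' T) (φ ∘ f)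

/-- `f` restricts to an isomorphism from the open subset `U` of `X` onto the open subset `V`
of `Y`: a bijection that identifies the open sets and the regular functions. -/
def RestrictsToIso {X Y : Type*} (SX : SpaceWithFunctions X) (SY : SpaceWithFunctions Y)
    (f : X → Y) (U : Set X) (V : Set Y) : Prop :=
  Set.BijOn f U V ∧
  (∀ T ⊆ V, IsOpen[SY.top] T ↔ IsOpen[SX.top] (U ∩ f ⁻¹' T)) ∧
  ∀ T ⊆ V, IsOpen[SY.top] T → ∀ φ : Y → ℂ,
    SY.IsRegularOn T φ ↔ SX.IsRegularOn (U ∩ f ⁻¹' T) (φ ∘ f)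

/-- Birational morphisms: morphisms that restrict to an isomorphism between dense open subsets. -/
def IsBirational {X Y : Type*} (SX : SpaceWithFunctions X) (SY : SpaceWithFunctions Y)
    (f : X → Y) : Prop :=
  IsMorphism SX SY f ∧ ∃ (U : Set X) (V : Set Y),
    IsOpen[SX.top] U ∧ @Dense X SX.top U ∧ IsOpen[SY.top] V ∧ @Dense Y SY.top V ∧
    RestrictsToIso SX SY f U V

end ClassicalVariety

/-! ### Partitions and Jordan types -/

namespace InducedOrbit

open ClassicalVariety

/-- Every integer between `1` and the largest part is a part. -/
def HasFullMembers (d : Multiset ℕ) : Prop :=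
  ∀ j, 1 ≤ j → (∃ a ∈ d, j ≤ a) → j ∈ d

/-- `e` is a part of `d` such that either there is a next smaller part, which is at most `e - 2`,
or `e` is the smallest part and `e ≥ 2`. -/
def IsGap (d : Multiset ℕ) (e : ℕ) : Prop :=
  e ∈ d ∧ 2 ≤ e ∧ ∀ a ∈ d, a < e → a + 2 ≤ e

/-- The number of parts that are at least `e`. -/
def numLargeParts (d : Multiset ℕ) (e : ℕ) : ℕ :=
  (d.filter fun a => e ≤ a).card

/-- Subtract `2` from all parts that are at least `e`, and remove the zeros. -/
def shrink (d : Multiset ℕ) (e : ℕ) : Multiset ℕ :=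
  (d.map fun a => if e ≤ a then a - 2 else a).filter fun a => 0 < a

/-- `x` has Jordan blocks for the eigenvalue `0` of sizes given by `d`: there are vectors `v i`
such that `x ^ (a i)` kills `v i` and the `x ^ j (v i)`, `j < a i`, form a basis. -/
def HasJordanType {V : Type*} [AddCommGroup V] [Module ℂ V] (x : Module.End ℂ V)
    (d : Multiset ℕ) : Prop :=
  ∃ (n : ℕ) (a : Fin n → ℕ) (v : Fin n → V) (b : Module.Basis (Σ i, Fin (a i)) ℂ V),
    Finset.univ.val.map a = d ∧ (∀ i, 0 < a i) ∧
    (∀ i (j : Fin (a i)), b ⟨i, j⟩ = (x ^ (j : ℕ)) (v i)) ∧ ∀ i, (x ^ (a i)) (v i) = 0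

variable {V : Type*} [AddCommGroup V] [Module ℂ V]

/-! ### Classical groups, parabolic subgroups and Levi subgroups -/

/-- The group of isometries of `B` of determinant one: it is `SO(V)` if `B` is symmetric,
and `Sp(V)` if `B` is alternating (where the condition on the determinant is automatic). -/
def classicalGroup (B : LinearMap.BilinForm ℂ V) : Subgroup (Module.End ℂ V)ˣ where
  carrier := {g | (∀ u v, B (g.1 u) (g.1 v) = B u v) ∧ LinearMap.det g.1 = 1}
  one_mem' := by simp
  mul_mem' := by
    rintro g h ⟨hg, hg'⟩ ⟨hh, hh'⟩
    exact ⟨by simp [hg, hh], by rw [Units.val_mul, map_mul, hg', hh', one_mul]⟩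
  inv_mem' := by
    rintro g ⟨hg, hg'⟩
    have key : ∀ u, g.1 (g⁻¹.1 u) = u := fun u => by
      rw [← Module.End.mul_apply, Units.mul_inv, Module.End.one_apply]
    refine ⟨fun u v => by rw [← hg, key, key], ?_⟩
    have : LinearMap.det g.1 * LinearMap.det g⁻¹.1 = 1 := by
      rw [← map_mul, Units.mul_inv, map_one]
    rwa [hg', one_mul] at this

/-- The Lie algebra `so(V)` or `sp(V)`. -/
def classicalLie (B : LinearMap.BilinForm ℂ V) : Submodule ℂ (Module.End ℂ V) :=
  B.skewAdjointSubmodule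

/-- The adjoint action. -/
def Ad (g : (Module.End ℂ V)ˣ) (x : Module.End ℂ V) : Module.End ℂ V := g.1 * x * g⁻¹.1

/-- The orbit of `x` under the adjoint action of the group `H`. -/
def adOrbit (H : Subgroup (Module.End ℂ V)ˣ) (x : Module.End ℂ V) : Set (Module.End ℂ V) :=
  {y | ∃ h ∈ H, y = Ad h x}

/-- The nilpotent orbits in `so(V)` or `sp(V)`. -/
def IsNilpotentOrbit (B : LinearMap.BilinForm ℂ V) (O : Set (Module.End ℂ V)) : Prop :=
  ∃ x ∈ classicalLie B, IsNilpotent x ∧ O = adOrbit (classicalGroup B) x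

/-- The stabilizer of a subspace in `SO(V)` or `Sp(V)`. -/
def stab (B : LinearMap.BilinForm ℂ V) (F : Submodule ℂ V) : Subgroup (Module.End ℂ V)ˣ where
  carrier := {g | g ∈ classicalGroup B ∧ F.map g.1 = F}
  one_mem' := ⟨one_mem _, by simp [Module.End.one_eq_id]⟩
  mul_mem' := by
    rintro g h ⟨hg, hg'⟩ ⟨hh, hh'⟩
    refine ⟨mul_mem hg hh, ?_⟩
    rw [Units.val_mul, Module.End.mul_eq_comp, Submodule.map_comp, hh', hg']
  inv_mem' := by
    rintro g ⟨hg, hg'⟩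
    refine ⟨inv_mem hg, ?_⟩
    conv_lhs => rw [← hg']
    rw [← Submodule.map_comp, ← Module.End.mul_eq_comp, Units.inv_mul, Module.End.one_eq_id,
      Submodule.map_id]

/-- A parabolic subgroup with isotropic flag type `(r, m - 2r, r)`, i.e. the stabilizer of
a flag `0 ⊆ F ⊆ F^⊥ ⊆ V` with `F` isotropic of dimension `r`, and a Levi decomposition of it,
which is the choice of an isotropic complement `F'` of `F^⊥`. -/
structure ParabolicData (B : LinearMap.BilinForm ℂ V) (r : ℕ) where
  F : Submodule ℂ V
  F' : Submodule ℂ V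
  finrank_F : Module.finrank ℂ F = r
  isotropic_F : F ≤ B.orthogonal F
  isotropic_F' : F' ≤ B.orthogonal F'
  isCompl : IsCompl (B.orthogonal F) F'

namespace ParabolicData

variable {B : LinearMap.BilinForm ℂ V} {r : ℕ} (P : ParabolicData B r)

/-- The parabolic subgroup `Q`. -/
def Q : Subgroup (Module.End ℂ V)ˣ := stab B P.F

/-- The Levi subgroup `L` of `Q`, isomorphic to `GL(F) × SO(W)` or `GL(F) × Sp(W)`. -/
def L : Subgroup (Module.End ℂ V)ˣ := stab B P.F ⊓ stab B P.F'

/-- The Lie algebra of `L`. -/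
def levi : Set (Module.End ℂ V) :=
  {x | x ∈ classicalLie B ∧ (∀ v ∈ P.F, x v ∈ P.F) ∧ ∀ v ∈ P.F', x v ∈ P.F'}

/-- The nilradical of the Lie algebra of `Q`. -/
def nilradical : Set (Module.End ℂ V) :=
  {x | x ∈ classicalLie B ∧ (∀ v, x v ∈ B.orthogonal P.F) ∧ (∀ v ∈ B.orthogonal P.F, x v ∈ P.F) ∧
    ∀ v ∈ P.F, x v = 0}

/-- The space `W = F^⊥ ∩ F'^⊥`, of dimension `m - 2r`, on which the second factor `so(W)`, `sp(W)`
of the Levi algebra acts. -/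
def W : Submodule ℂ V := B.orthogonal P.F ⊓ B.orthogonal P.F'

/-- The nilpotent orbits in the Levi algebra. -/
def IsNilpotentLeviOrbit (O' : Set (Module.End ℂ V)) : Prop :=
  ∃ x ∈ P.levi, IsNilpotent x ∧ O' = adOrbit P.L x

/-- The set `O'` consists of elements of the second factor `so(W)`, `sp(W)` of the Levi algebra
(they vanish on `F` and on `F'`), with Jordan type `d` on `W`. -/
def HasTypeInSecondFactor (O' : Set (Module.End ℂ V)) (d : Multiset ℕ) : Prop :=
  ∀ x ∈ O', x ∈ P.levi ∧ (∀ v ∈ P.F, x v = 0) ∧ (∀ v ∈ P.F', x v = 0) ∧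
    ∃ y : Module.End ℂ P.W, (∀ w, (y w : V) = x w) ∧ HasJordanType y d

/-- The set `n + A`. -/
def nilradicalAdd (A : Set (Module.End ℂ V)) : Set (Module.End ℂ V) :=
  {z | ∃ y ∈ P.nilradical, ∃ x ∈ A, z = y + x}

/-- `O` is the nilpotent orbit induced from the nilpotent orbit `O'` of the Levi algebra. -/
def IsInduced (O' O : Set (Module.End ℂ V)) : Prop :=
  P.IsNilpotentLeviOrbit O' ∧ IsNilpotentOrbit B O ∧ MeetsInOpenDense O (P.nilradicalAdd O')

/-! ### The generalized Springer map -/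

/-- The product `G × (n + closure O')`. -/
abbrev Total (O' : Set (Module.End ℂ V)) : Type _ :=
  classicalGroup B × P.nilradicalAdd (zariskiClosure O')

/-- The equivalence relation `(g, z) ∼ (g q, Ad_{q⁻¹} z)`, `q ∈ Q`. -/
def setoid (O' : Set (Module.End ℂ V)) : Setoid (P.Total O') where
  r a b := ∃ q ∈ P.Q, b.1.1 = a.1.1 * q ∧ b.2.1 = Ad q⁻¹ a.2.1
  iseqv :=
    { refl := fun a => ⟨1, one_mem _, by simp, by simp [Ad]⟩
      symm := by
        rintro a b ⟨q, hq, h1, h2⟩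
        refine ⟨q⁻¹, inv_mem hq, by rw [h1]; group, ?_⟩
        rw [h2]
        simp only [Ad, inv_inv, ← mul_assoc, Units.mul_inv, one_mul]
        simp only [mul_assoc, Units.mul_inv, mul_one]
      trans := by
        rintro a b c ⟨q, hq, h1, h2⟩ ⟨q', hq', h1', h2'⟩
        refine ⟨q * q', mul_mem hq hq', by rw [h1', h1, mul_assoc], ?_⟩
        rw [h2', h2]
        simp only [Ad, mul_inv_rev, inv_inv, Units.val_mul, mul_assoc] }

/-- The space `G ×^Q (n + closure O')`. -/
abbrev Bundle (O' : Set (Module.End ℂ V)) : Type _ := Quotient (P.setoid O')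

/-- The structure of a variety on `G ×^Q (n + closure O')`, as the quotient of the closed
subvariety `G × (n + closure O')` of `End(V) × End(V)`. -/
def bundleVariety (O' : Set (Module.End ℂ V)) : SpaceWithFunctions (P.Bundle O') :=
  (embedded (fun a : P.Total O' => (a.1.1.1, a.2.1))).quotient (P.setoid O')

theorem Ad_mem_closure {O' O : Set (Module.End ℂ V)} (h : P.IsInduced O' O)
    {g z : _} (hg : g ∈ classicalGroup B) (hz : z ∈ P.nilradicalAdd (zariskiClosure O')) :
    Ad g z ∈ zariskiClosure O := by
  let _ := zariski (Module.End ℂ V)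
  obtain ⟨y, hy, x, hx, rfl⟩ := hz
  have h1 : y + x ∈ closure O := by
    have c := continuous_zariski (LinearMap.id (R := ℂ) (M := Module.End ℂ V)) y
    have := map_mem_closure c (t := P.nilradicalAdd O') hx
      (fun w hw => ⟨y, hy, w, hw, by simp [add_comm]⟩)
    have hsub : P.nilradicalAdd O' ⊆ closure O :=
      h.2.2.2.trans (closure_mono Set.inter_subset_left)
    have := closure_minimal hsub isClosed_closure this
    simpa [add_comm] using this
  have c := continuous_zariski
    ((LinearMap.mulLeft ℂ g.1).comp (LinearMap.mulRight ℂ (g⁻¹).1)) 0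
  have := map_mem_closure c (t := O) h1 (fun w hw => by
    obtain ⟨x0, _, _, rfl⟩ := h.2.1
    obtain ⟨k, hk, rfl⟩ := hw
    exact ⟨g * k, mul_mem hg hk, by simp [Ad, mul_assoc]⟩)
  simpa [Ad, mul_assoc, zariskiClosure] using this

/-- The generalized Springer map `G ×^Q (n + closure O') → closure O`, `[g, z] ↦ Ad_g z`. -/
def springerMap {O' O : Set (Module.End ℂ V)} (h : P.IsInduced O' O) :
    P.Bundle O' → zariskiClosure O :=
  Quotient.lift (fun a => ⟨Ad a.1.1 a.2.1, P.Ad_mem_closure h a.1.2 a.2.2⟩) <| by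
    rintro a b ⟨q, _, h1, h2⟩
    apply Subtype.ext
    simp only [Ad, h1, h2, mul_inv_rev, Units.val_mul, inv_inv, ← mul_assoc]
    simp only [mul_assoc, Units.mul_inv_cancel_left]

end ParabolicData

/-- `z` vanishes on `F`, maps `F^⊥` to itself, and has Jordan type `d` on `F^⊥ / F`. -/
def HasSubquotientType (B : LinearMap.BilinForm ℂ V) (z : Module.End ℂ V) (F : Submodule ℂ V)
    (d : Multiset ℕ) : Prop :=
  (∀ v ∈ F, z v = 0) ∧
  ∃ y : Module.End ℂ (B.orthogonal F ⧸ F.comap (B.orthogonal F).subtype),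
    (∀ v : B.orthogonal F, ∃ hv : z v ∈ B.orthogonal F,
      y (Submodule.Quotient.mk v) = Submodule.Quotient.mk ⟨z v, hv⟩) ∧
    HasJordanType y d

end InducedOrbit

/-!
Let `z` lie in the orbit `O` of Jordan type `d`, and let `c + 2` be a part of `d` such that no
part equals `c + 1`. The subspace `kernelRange z c = ker z ∩ im z ^ (c + 1)` is spanned by the
ends of the Jordan chains of length at least `c + 2`. It is isotropic of dimension `r`, the number
of such chains, and passing to its orthogonal and dividing by it shortens these chains by `2`.
Conversely, an isotropic subspace `F` of dimension `r` that is killed by `z` and for which `z ^ c`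
has the right rank on `F^⊥ / F` equals `kernelRange z c`: the range of `z ^ (c + 1)` is contained
in `z ^ c (F^⊥) + F`, both have the same dimension because `c + 1` is not a part, and so `F` lies
in that range (`eq_kernelRange`). Jordan types are handled throughout by the ranks of powers
(`hasJordanType_of_finrank`). This gives the unique isotropic subspace (`existsUnique_isotropic`).

For the induction statement, `F = kernelRange z c` and an isotropic complement of `F^⊥` define the
parabolic subgroup, and `O'` is the orbit of the compression of `z` to `W`. The ranks of powers of
elements of `n + O'` are at most those on `O` (`finrank_range_add_pow_le`), and ranks are lower
semicontinuous, so elements of `n + O'` near `O` have Jordan type `d`. Elements of the Lie algebra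
of the same Jordan type are conjugate by an isometry (`exists_isometry_conj`). Up to the two
orbits for very even `d` the isometry can be taken in the group, and those two orbits are
separated locally by families of Lagrangian subspaces (`exists_nhds_mem_adOrbit`). Hence
`O ∩ (n + O')` is open in `n + O'`. It is dense since `n` is a vector space and the intersection
of `O` with `n + x` is not empty for `x` in `O'` (`isInduced_of_mem`).

For the generalized Springer map, a point `[g, z']` over `z ∈ O` satisfies
`g F = kernelRange z c`, which determines the coset of `g` modulo the parabolic subgroup and so the
point. Near a point of `O`, the subspace `kernelRange z c` has a basis that depends rationally on
`z`, obtained by solving `z ^ (c + 2) v = 0` with Cramer's rule (`exists_kernel_section`). An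
explicit unipotent isometry (`unipotentMap`) moves a fixed subspace to it, and this is a rational
local section of the map (`exists_section`). Therefore the map restricts to an isomorphism over
`O`, which is open and dense in its closure.
-/

namespace InducedOrbit

open ClassicalVariety

/-! ### Jordan types and ranks of powers -/

/-- The sum of `a - k` over the parts `a` of `d`, with truncated subtraction: the rank of the `k`-th
power of a nilpotent endomorphism of Jordan type `d`. -/
def rankPow (d : Multiset ℕ) (k : ℕ) : ℕ := (d.map fun a => a - k).sum

theorem rankPow_cons (a : ℕ) (d : Multiset ℕ) (k : ℕ) :
    rankPow (a ::ₘ d) k = (a - k) + rankPow d k := by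
  simp [rankPow]

/-- The second differences of `rankPow d` count the parts, so that `rankPow d` determines `d`. -/
theorem rankPow_second_difference (d : Multiset ℕ) (j : ℕ) :
    rankPow d j + rankPow d (j + 2) = 2 * rankPow d (j + 1) + d.count (j + 1) := by
  induction d using Multiset.induction with
  | empty => simp [rankPow]
  | cons a d ih =>
    simp only [rankPow_cons, Multiset.count_cons]
    split_ifs <;> omega

theorem eq_of_rankPow_eq {d d' : Multiset ℕ} (hd : ∀ a ∈ d, 0 < a) (hd' : ∀ a ∈ d', 0 < a)
    (h : ∀ k, rankPow d k = rankPow d' k) : d = d' := by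
  refine Multiset.ext.2 fun j => ?_
  rcases j with _ | j
  · rw [Multiset.count_eq_zero_of_notMem fun h0 => (hd 0 h0).false,
      Multiset.count_eq_zero_of_notMem fun h0 => (hd' 0 h0).false]
  · have h1 := rankPow_second_difference d j
    have h2 := rankPow_second_difference d' j
    rw [h, h, h] at h1
    omega

theorem rankPow_eq_zero {d : Multiset ℕ} {k : ℕ} (h : ∀ a ∈ d, a ≤ k) : rankPow d k = 0 := by
  refine Multiset.sum_eq_zero fun x hx => ?_
  obtain ⟨a, ha, rfl⟩ := Multiset.mem_map.1 hx
  exact Nat.sub_eq_zero_of_le (h a ha)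

variable {V : Type*} [AddCommGroup V] [Module ℂ V]

theorem hasJordanType_of_basis {ι : Type*} [Fintype ι] {x : Module.End ℂ V} (a : ι → ℕ)
    (v : ι → V) (b : Module.Basis (Σ i, Fin (a i)) ℂ V)
    (hb : ∀ i (j : Fin (a i)), b ⟨i, j⟩ = (x ^ (j : ℕ)) (v i)) (hv : ∀ i, (x ^ (a i)) (v i) = 0) :
    ∃ d, HasJordanType x d := by
  classical
  let e := Fintype.equivFin {i : ι // 0 < a i}
  let f : (Σ i, Fin (a i)) ≃ Σ k, Fin (a (e.symm k).1) :=
    { toFun := fun p => ⟨e ⟨p.1, p.2.pos⟩, Fin.cast (by simp) p.2⟩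
      invFun := fun p => ⟨(e.symm p.1).1, p.2⟩
      left_inv := by
        rintro ⟨i, j⟩
        simp only [Sigma.mk.injEq, Equiv.symm_apply_apply, true_and]
        rw [Fin.heq_ext_iff (by simp)]
        simp
      right_inv := by
        rintro ⟨k, j⟩
        simp only [Sigma.mk.injEq, Subtype.coe_eta, Equiv.apply_symm_apply, true_and]
        rw [Fin.heq_ext_iff (by simp)]
        simp }
  refine ⟨_, _, fun k => a (e.symm k).1, fun k => v (e.symm k).1, b.reindex f, rfl,
    fun k => (e.symm k).2, fun k j => ?_, fun k => hv _⟩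
  rw [Module.Basis.reindex_apply]
  exact hb _ _

theorem dfinsupp_basis_apply {ι : Type*} [DecidableEq ι] {M : ι → Type*} [∀ i, AddCommGroup (M i)]
    [∀ i, Module ℂ (M i)] {η : ι → Type*} (c : ∀ i, Module.Basis (η i) ℂ (M i)) (i : ι) (j : η i) :
    DFinsupp.basis c ⟨i, j⟩ = DFinsupp.single i (c i j) := by
  change DFinsupp.mapRange (fun i => (c i).repr.symm) (fun i => map_zero _)
    (sigmaFinsuppEquivDFinsupp (Finsupp.single (⟨i, j⟩ : Σ i, η i) (1 : ℂ))) = _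
  rw [sigmaFinsuppEquivDFinsupp_single, DFinsupp.mapRange_single]
  rfl

open Polynomial in
theorem exists_basis_quotient_X_pow (k : ℕ) :
    ∃ c : Module.Basis (Fin k) ℂ (ℂ[X] ⧸ Submodule.span ℂ[X] {(X : ℂ[X]) ^ k}),
      ∀ j, c j = Submodule.Quotient.mk (X ^ (j : ℕ)) := by
  let c : Module.Basis (Fin k) ℂ (AdjoinRoot ((X : ℂ[X]) ^ k)) :=
    (AdjoinRoot.powerBasis' (monic_X_pow k)).basis.reindex (finCongr (by simp))
  have hc : ∀ j, c j = AdjoinRoot.mk _ (X ^ (j : ℕ)) := fun j => by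
    simp [c, AdjoinRoot.powerBasis'_gen]
  exact ⟨c, hc⟩

open Polynomial in
/-- The existence of the Jordan normal form of a nilpotent endomorphism, from the structure theorem
for the finitely generated torsion modules over `ℂ[X]`. -/
theorem exists_hasJordanType [FiniteDimensional ℂ V] {x : Module.End ℂ V} (hx : IsNilpotent x) :
    ∃ d, HasJordanType x d := by
  obtain ⟨N, hN⟩ := hx
  have htors : Module.IsTorsion' (Module.AEval' x) (Submonoid.powers (X : ℂ[X])) := by
    intro m
    refine ⟨⟨X ^ N, N, rfl⟩, ?_⟩
    obtain ⟨m, rfl⟩ := (Module.AEval'.of x).surjective m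
    change (X : ℂ[X]) ^ N • Module.AEval'.of x m = 0
    rw [Module.AEval'.X_pow_smul_of, hN]
    simp
  obtain ⟨n, k, ⟨φ⟩⟩ := Module.torsion_by_prime_power_decomposition
    (Polynomial.irreducible_X (R := ℂ)) htors
  choose c hc using fun i => exists_basis_quotient_X_pow (k i)
  let b : Module.Basis (Σ i, Fin (k i)) ℂ V := (DFinsupp.basis c).map
    ((φ.restrictScalars ℂ).symm.trans (Module.AEval'.of x).symm)
  let v : Fin n → V := fun i => (Module.AEval'.of x).symm
    (φ.symm (DirectSum.lof ℂ[X] _ _ i (Submodule.Quotient.mk 1)))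
  have key : ∀ i (j : ℕ), (x ^ j) (v i) = (Module.AEval'.of x).symm
      (φ.symm (DirectSum.lof ℂ[X] _ _ i (Submodule.Quotient.mk (X ^ j)))) := by
    intro i j
    have h1 : ∀ u, X ^ j • Module.AEval'.of x u = Module.AEval'.of x ((x ^ j) u) :=
      fun u => Module.AEval'.X_pow_smul_of x u j
    rw [LinearEquiv.eq_symm_apply, ← h1, LinearEquiv.apply_symm_apply,
      ← map_smul, ← map_smul, ← Submodule.Quotient.mk_smul, smul_eq_mul, mul_one]
  refine hasJordanType_of_basis k v b (fun i j => ?_) fun i => ?_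
  · rw [key, ← hc]
    have h1 := dfinsupp_basis_apply c i j
    simp only [b, Module.Basis.map_apply, h1]
    rfl
  · rw [key, (Submodule.Quotient.mk_eq_zero _).2 (Submodule.mem_span_singleton_self _)]
    simp

section

variable {ι : Type*} {x : Module.End ℂ V} {a : ι → ℕ}
  {v : ι → V} {b : Module.Basis (Σ i, Fin (a i)) ℂ V}

theorem pow_apply_eq_zero (hv : ∀ i, (x ^ (a i)) (v i) = 0) {i : ι} {k : ℕ} (h : a i ≤ k) :
    (x ^ k) (v i) = 0 := by
  rw [← Nat.sub_add_cancel h, pow_add, Module.End.mul_apply, hv, map_zero]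

theorem range_pow_eq_span (hb : ∀ i (j : Fin (a i)), b ⟨i, j⟩ = (x ^ (j : ℕ)) (v i))
    (hv : ∀ i, (x ^ (a i)) (v i) = 0) (k : ℕ) :
    LinearMap.range (x ^ k) = Submodule.span ℂ (b '' {p | k ≤ (p.2 : ℕ)}) := by
  apply le_antisymm
  · rw [LinearMap.range_eq_map, ← b.span_eq, Submodule.map_span, Submodule.span_le]
    rintro _ ⟨_, ⟨⟨i, j⟩, rfl⟩, rfl⟩
    rw [hb, ← Module.End.mul_apply, ← pow_add]
    by_cases h : k + j < a i
    · refine Submodule.subset_span ⟨⟨i, ⟨k + j, h⟩⟩, ?_, hb _ _⟩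
      simp
    · rw [pow_apply_eq_zero hv (not_lt.1 h)]
      exact zero_mem _
  · rw [Submodule.span_le]
    rintro _ ⟨⟨i, j⟩, hj, rfl⟩
    have hj : k ≤ (j : ℕ) := hj
    refine ⟨(x ^ ((j : ℕ) - k)) (v i), ?_⟩
    rw [hb, ← Module.End.mul_apply, ← pow_add, Nat.add_sub_cancel' hj]

theorem finrank_range_pow_of_basis [Fintype ι]
    (hb : ∀ i (j : Fin (a i)), b ⟨i, j⟩ = (x ^ (j : ℕ)) (v i))
    (hv : ∀ i, (x ^ (a i)) (v i) = 0) (k : ℕ) :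
    Module.finrank ℂ (LinearMap.range (x ^ k)) = ∑ i, (a i - k) := by
  classical
  rw [range_pow_eq_span hb hv, Set.image_eq_range]
  refine (finrank_span_eq_card (b.linearIndependent.comp _ Subtype.val_injective)).trans ?_
  let f : {p : Σ i, Fin (a i) // k ≤ (p.2 : ℕ)} ≃ Σ i, Fin (a i - k) :=
    { toFun := fun p => ⟨p.1.1, ⟨p.1.2 - k, by have := p.1.2.2; have := p.2; omega⟩⟩
      invFun := fun p => ⟨⟨p.1, ⟨p.2 + k, by have := p.2.2; omega⟩⟩, by simp⟩
      left_inv := by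
        rintro ⟨⟨i, j⟩, h⟩
        have h : k ≤ (j : ℕ) := h
        simp [Nat.sub_add_cancel h]
      right_inv := by
        rintro ⟨i, j⟩
        simp }
  exact (Fintype.card_congr f).trans (by simp)

end

theorem HasJordanType.pos {x : Module.End ℂ V} {d : Multiset ℕ} (h : HasJordanType x d) :
    ∀ a ∈ d, 0 < a := by
  obtain ⟨n, a, v, b, rfl, h0, -⟩ := h
  intro c hc
  obtain ⟨i, -, rfl⟩ := Multiset.mem_map.1 hc
  exact h0 i

theorem HasJordanType.finrank_range_pow {x : Module.End ℂ V} {d : Multiset ℕ}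
    (h : HasJordanType x d) (k : ℕ) :
    Module.finrank ℂ (LinearMap.range (x ^ k)) = rankPow d k := by
  obtain ⟨n, a, v, b, rfl, -, hb, hv⟩ := h
  rw [finrank_range_pow_of_basis hb hv]
  simp only [rankPow, Multiset.map_map]
  rfl

theorem pow_eq_zero_of_finrank_range [FiniteDimensional ℂ V] {x : Module.End ℂ V} {k : ℕ}
    (h : Module.finrank ℂ (LinearMap.range (x ^ k)) = 0) : x ^ k = 0 := by
  rwa [Submodule.finrank_eq_zero, LinearMap.range_eq_bot] at h

/-- The Jordan type of a nilpotent endomorphism is determined by the ranks of its powers. -/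
theorem hasJordanType_of_finrank [FiniteDimensional ℂ V] {x : Module.End ℂ V} {d : Multiset ℕ}
    (hd : ∀ a ∈ d, 0 < a)
    (h : ∀ k, Module.finrank ℂ (LinearMap.range (x ^ k)) = rankPow d k) : HasJordanType x d := by
  have hx : IsNilpotent x := by
    refine ⟨d.sum, pow_eq_zero_of_finrank_range ?_⟩
    rw [h]
    exact rankPow_eq_zero fun a ha => Multiset.single_le_sum (by simp) a ha
  obtain ⟨d', hd'⟩ := exists_hasJordanType hx
  rwa [eq_of_rankPow_eq hd hd'.pos fun k => by rw [← h, hd'.finrank_range_pow]]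

/-- Endomorphisms of the same Jordan type are conjugate, by a map that permutes Jordan chains. -/
theorem HasJordanType.exists_equiv {V' : Type*} [AddCommGroup V'] [Module ℂ V']
    {x : Module.End ℂ V} {y : Module.End ℂ V'} {d : Multiset ℕ}
    (hx : HasJordanType x d) (hy : HasJordanType y d) :
    ∃ e : V ≃ₗ[ℂ] V', ∀ u, e (x u) = y (e u) := by
  obtain ⟨n, a, v, b, rfl, -, hb, hv⟩ := hx
  obtain ⟨n', a', v', b', h, -, hb', hv'⟩ := hy
  obtain rfl : n' = n := by simpa using congrArg Multiset.card h
  obtain ⟨σ, rfl⟩ : ∃ σ : Equiv.Perm (Fin n'), a = a' ∘ σ := by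
    classical
    have hc : ∀ c, Nonempty ({i // a i = c} ≃ {i // a' i = c}) := fun c => by
      rw [← Fintype.card_eq]
      have := congrArg (Multiset.count c) h
      simp only [Multiset.count_map] at this
      simp only [Fintype.card_subtype, eq_comm (b := c)]
      exact this.symm
    refine ⟨(Equiv.sigmaFiberEquiv a).symm.trans ((Equiv.sigmaCongrRight fun c =>
      Classical.choice (hc c)).trans (Equiv.sigmaFiberEquiv a')), ?_⟩
    funext i
    exact ((Classical.choice (hc (a i))) ⟨i, rfl⟩).2.symm
  let f : (Σ i, Fin ((a' ∘ σ) i)) ≃ Σ i, Fin (a' i) :=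
    Equiv.sigmaCongrLeft (β := fun i => Fin (a' i)) σ
  let e := b.equiv b' f
  have he : ∀ i (j : ℕ), e ((x ^ j) (v i)) = (y ^ j) (v' (σ i)) := by
    intro i j
    by_cases hj : j < (a' ∘ σ) i
    · have h1 := hb i ⟨j, hj⟩
      have h2 := hb' (σ i) ⟨j, hj⟩
      simp only at h1 h2
      rw [← h1, ← h2, Module.Basis.equiv_apply]
      rfl
    · rw [pow_apply_eq_zero hv (not_lt.1 hj), pow_apply_eq_zero hv' (not_lt.1 hj), map_zero]
  refine ⟨e, fun u => ?_⟩
  have : e.toLinearMap ∘ₗ x = y ∘ₗ e.toLinearMap := by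
    refine b.ext ?_
    rintro ⟨i, j⟩
    simp only [LinearMap.comp_apply, LinearEquiv.coe_coe]
    rw [hb, ← Module.End.mul_apply, ← pow_succ', he, he, ← Module.End.mul_apply, ← pow_succ']
  exact LinearMap.congr_fun this u

end InducedOrbit

namespace InducedOrbit

open ClassicalVariety

/-! ### Partitions with a gap -/

theorem exists_isGap {d : Multiset ℕ} (hd : ¬ HasFullMembers d) : ∃ e, IsGap d e := by
  classical
  simp only [HasFullMembers, not_forall] at hd
  obtain ⟨j, hj, h, hjd⟩ := hd
  -- the smallest part above a missing integer `j`
  obtain ⟨e, hs, hmin⟩ : ∃ e, (e ∈ d ∧ j ≤ e) ∧ ∀ a < e, ¬ (a ∈ d ∧ j ≤ a) :=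
    ⟨Nat.find h, Nat.find_spec h, fun _ => Nat.find_min h⟩
  have hje : j ≠ e := fun h => hjd (h ▸ hs.1)
  have hle := hs.2
  refine ⟨e, hs.1, by omega, fun a ha hae => ?_⟩
  have h1 : ¬ j ≤ a := fun h2 => hmin a hae ⟨ha, h2⟩
  omega

theorem numLargeParts_add (d : Multiset ℕ) (c : ℕ) :
    rankPow d (c + 1) + numLargeParts d (c + 1) = rankPow d c := by
  induction d using Multiset.induction with
  | empty => simp [rankPow, numLargeParts]
  | cons a d ih =>
    simp only [rankPow_cons, numLargeParts, Multiset.filter_cons] at ih ⊢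
    split_ifs <;> simp only [Multiset.card_add, Multiset.card_singleton, Multiset.card_zero] <;>
      omega

theorem rankPow_shrink (d : Multiset ℕ) (e k : ℕ) :
    rankPow (shrink d e) k = (d.map fun a => (if e ≤ a then a - 2 else a) - k).sum := by
  have h : ∀ s : Multiset ℕ, rankPow (s.filter fun a => 0 < a) k = rankPow s k := by
    intro s
    induction s using Multiset.induction with
    | empty => simp
    | cons a s ih =>
      rw [Multiset.filter_cons]
      split_ifs with h
      · simpa [rankPow_cons] using ih
      · rw [zero_add, rankPow_cons, ih]
        omega
  rw [shrink, h, rankPow, Multiset.map_map]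
  rfl

theorem rankPow_shrink_of_le (d : Multiset ℕ) {c k : ℕ} (hk : k ≤ c) :
    rankPow (shrink d (c + 2)) k + 2 * numLargeParts d (c + 2) = rankPow d k := by
  rw [rankPow_shrink]
  induction d using Multiset.induction with
  | empty => simp [rankPow, numLargeParts]
  | cons a d ih =>
    simp only [rankPow_cons, numLargeParts, Multiset.filter_cons, Multiset.map_cons,
      Multiset.sum_cons] at ih ⊢
    split_ifs <;> simp <;> omega

theorem rankPow_shrink_of_ge {d : Multiset ℕ} {c k : ℕ} (hd : ∀ a ∈ d, a < c + 2 → a ≤ c)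
    (hk : c ≤ k) : rankPow (shrink d (c + 2)) k = rankPow d (k + 2) := by
  rw [rankPow_shrink]
  induction d using Multiset.induction with
  | empty => simp [rankPow]
  | cons a d ih =>
    have ih := ih fun b hb => hd b (Multiset.mem_cons_of_mem hb)
    have := hd a (Multiset.mem_cons_self a d)
    simp only [rankPow_cons, Multiset.map_cons, Multiset.sum_cons, ih]
    split_ifs <;> omega

theorem pos_of_mem_shrink {d : Multiset ℕ} {e : ℕ} : ∀ a ∈ shrink d e, 0 < a := fun _ ha =>
  (Multiset.mem_filter.1 ha).2

theorem IsGap.exists_eq {d : Multiset ℕ} {e : ℕ} (h : IsGap d e) :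
    ∃ c, e = c + 2 ∧ ∀ a ∈ d, a < c + 2 → a ≤ c := by
  obtain ⟨-, h2, h3⟩ := h
  obtain ⟨c, rfl⟩ := Nat.exists_eq_add_of_le' h2
  exact ⟨c, rfl, fun a ha hac => by have := h3 a ha hac; omega⟩

/-- If `c + 1` is not a part, the ranks of the powers `c`, `c + 1`, `c + 2` are in arithmetic
progression. -/
theorem rankPow_gap {d : Multiset ℕ} {c : ℕ} (hd : ∀ a ∈ d, a < c + 2 → a ≤ c) :
    rankPow d c + rankPow d (c + 2) = 2 * rankPow d (c + 1) := by
  rw [rankPow_second_difference, Multiset.count_eq_zero_of_notMem, add_zero]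
  intro h
  have := hd _ h
  omega

end InducedOrbit

namespace InducedOrbit

open ClassicalVariety

variable {V : Type*} [AddCommGroup V] [Module ℂ V]

/-! ### Forms that are symmetric or alternating up to a sign -/

/-- The bilinear form `B` satisfies `B u v = ε * B v u` with `ε = ±1`. -/
structure HasSign (B : LinearMap.BilinForm ℂ V) (ε : ℂ) : Prop where
  sq : ε * ε = 1
  swap : ∀ u v, B u v = ε * B v u

theorem exists_hasSign {B : LinearMap.BilinForm ℂ V} (h : B.IsSymm ∨ B.IsAlt) :
    ∃ ε, HasSign B ε := by
  rcases h with h | h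
  · exact ⟨1, by norm_num, fun u v => by rw [one_mul]; exact h.eq u v⟩
  · exact ⟨-1, by norm_num, fun u v => by rw [← LinearMap.IsAlt.neg h v u]; ring⟩

section

variable {B : LinearMap.BilinForm ℂ V} {ε : ℂ}

theorem HasSign.isRefl (h : HasSign B ε) : B.IsRefl := fun u v huv => by
  rw [h.swap, huv, mul_zero]

theorem eq_zero_of_forall_right (hB : B.Nondegenerate) {v : V} (h : ∀ u, B u v = 0) : v = 0 :=
  hB.2 v h

theorem eq_zero_of_forall_left (hB : B.Nondegenerate) {v : V} (h : ∀ u, B v u = 0) : v = 0 :=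
  hB.1 v h

theorem mem_orth {N : Submodule ℂ V} {v : V} : v ∈ B.orthogonal N ↔ ∀ n ∈ N, B n v = 0 :=
  LinearMap.BilinForm.mem_orthogonal_iff

theorem orth_anti {N N' : Submodule ℂ V} (h : N ≤ N') : B.orthogonal N' ≤ B.orthogonal N :=
  fun _ hv => mem_orth.2 fun n hn => mem_orth.1 hv n (h hn)

variable [FiniteDimensional ℂ V]

theorem finrank_orth (hB : B.Nondegenerate) (N : Submodule ℂ V) :
    Module.finrank ℂ (B.orthogonal N) + Module.finrank ℂ N = Module.finrank ℂ V := by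
  rw [LinearMap.BilinForm.finrank_orthogonal hB, Nat.sub_add_cancel (Submodule.finrank_le _)]

theorem orth_orth (hB : B.Nondegenerate) (hε : HasSign B ε) (N : Submodule ℂ V) :
    B.orthogonal (B.orthogonal N) = N :=
  LinearMap.BilinForm.orthogonal_orthogonal hB hε.isRefl N

end

section

variable {B : LinearMap.BilinForm ℂ V} {ε : ℂ}

theorem mem_classicalLie {x : Module.End ℂ V} :
    x ∈ classicalLie B ↔ ∀ u v, B (x u) v = - B u (x v) := by
  change x ∈ LinearMap.skewAdjointSubmodule B ↔ _
  rw [LinearMap.mem_skewAdjointSubmodule]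
  exact ⟨fun h u v => by simpa using h u v, fun h u v => by simpa using h u v⟩

theorem skew_pow {x : Module.End ℂ V} (hx : x ∈ classicalLie B) (k : ℕ) (u v : V) :
    B ((x ^ k) u) v = (-1) ^ k * B u ((x ^ k) v) := by
  induction k generalizing u v with
  | zero => simp
  | succ k ih =>
    rw [pow_succ, Module.End.mul_apply, ih, mem_classicalLie.1 hx, ← Module.End.mul_apply,
      ← pow_succ', ← pow_succ]
    ring

theorem ker_pow_eq_orth (hB : B.Nondegenerate) {x : Module.End ℂ V} (hx : x ∈ classicalLie B)
    (k : ℕ) : LinearMap.ker (x ^ k) = B.orthogonal (LinearMap.range (x ^ k)) := by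
  ext v
  rw [LinearMap.mem_ker, mem_orth]
  constructor
  · rintro h _ ⟨u, rfl⟩
    rw [skew_pow hx, h, map_zero, mul_zero]
  · intro h
    refine eq_zero_of_forall_right hB fun u => ?_
    have := h _ ⟨u, rfl⟩
    rw [skew_pow hx] at this
    exact (mul_eq_zero.1 this).resolve_left (pow_ne_zero _ (by norm_num))

theorem orth_ker_pow [FiniteDimensional ℂ V] (hB : B.Nondegenerate) (hε : HasSign B ε)
    {x : Module.End ℂ V} (hx : x ∈ classicalLie B) (k : ℕ) :
    B.orthogonal (LinearMap.ker (x ^ k)) = LinearMap.range (x ^ k) := by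
  rw [ker_pow_eq_orth hB hx, orth_orth hB hε]

end

/-! ### Adjoints and isometries -/

section

variable [FiniteDimensional ℂ V] (B : LinearMap.BilinForm ℂ V) (hB : B.Nondegenerate)

/-- The adjoint of an endomorphism with respect to a nondegenerate form, as a linear map in the
endomorphism. -/
noncomputable def adjointMap : Module.End ℂ V →ₗ[ℂ] Module.End ℂ V :=
  (B.toDual hB).symm.conj.toLinearMap ∘ₗ Module.Dual.transpose

variable {B} {hB} {ε : ℂ}

theorem adjointMap_left (g : Module.End ℂ V) (u v : V) :
    B (adjointMap B hB g u) v = B u (g v) := by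
  have h : adjointMap B hB g u = (B.toDual hB).symm ((B.toDual hB u).comp g) := rfl
  rw [h, LinearMap.BilinForm.apply_toDual_symm_apply]
  rfl

theorem adjointMap_right (hε : HasSign B ε) (g : Module.End ℂ V) (u v : V) :
    B u (adjointMap B hB g v) = B (g u) v := by
  rw [hε.swap, adjointMap_left, ← hε.swap]

theorem adjointMap_unique {g g' : Module.End ℂ V} (h : ∀ u v, B (g' u) v = B u (g v)) :
    adjointMap B hB g = g' := by
  refine LinearMap.ext fun u => sub_eq_zero.1 (eq_zero_of_forall_left hB fun v => ?_)
  rw [map_sub, LinearMap.sub_apply, adjointMap_left, h, sub_self]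

theorem adjointMap_mul (g h : Module.End ℂ V) :
    adjointMap B hB (g * h) = adjointMap B hB h * adjointMap B hB g :=
  adjointMap_unique fun u v => by
    simp only [Module.End.mul_apply, adjointMap_left]

theorem adjointMap_one : adjointMap B hB 1 = 1 := adjointMap_unique fun _ _ => rfl

theorem adjointMap_adjointMap (hε : HasSign B ε) (g : Module.End ℂ V) :
    adjointMap B hB (adjointMap B hB g) = g :=
  adjointMap_unique fun u v => (adjointMap_right hε g u v).symm

theorem adjointMap_pow (g : Module.End ℂ V) (k : ℕ) :
    adjointMap B hB (g ^ k) = (adjointMap B hB g) ^ k := by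
  induction k with
  | zero => exact adjointMap_one
  | succ k ih => rw [pow_succ, adjointMap_mul, ih, pow_succ']

theorem adjointMap_aeval (p : Polynomial ℂ) (g : Module.End ℂ V) :
    adjointMap B hB (Polynomial.aeval g p) = Polynomial.aeval (adjointMap B hB g) p := by
  induction p using Polynomial.induction_on' with
  | add p q hp hq => rw [map_add, map_add, map_add, hp, hq]
  | monomial n c =>
    rw [Polynomial.aeval_monomial, Polynomial.aeval_monomial, ← Algebra.smul_def,
      ← Algebra.smul_def, map_smul, adjointMap_pow]

theorem det_adjointMap (g : Module.End ℂ V) :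
    LinearMap.det (adjointMap B hB g) = LinearMap.det g := by
  rw [← LinearMap.det_dualMap g, ← LinearMap.det_conj g.dualMap (B.toDual hB).symm]
  rfl

theorem adjointMap_mul_self_of_isometry {g : Module.End ℂ V} (hg : ∀ u v, B (g u) (g v) = B u v) :
    adjointMap B hB g * g = 1 := by
  refine LinearMap.ext fun u => sub_eq_zero.1 (eq_zero_of_forall_left hB fun v => ?_)
  rw [map_sub, LinearMap.sub_apply, Module.End.mul_apply, adjointMap_left, hg,
    Module.End.one_apply, sub_self]

include hB in
theorem det_isometry_mul_self {g : Module.End ℂ V} (hg : ∀ u v, B (g u) (g v) = B u v) :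
    LinearMap.det g * LinearMap.det g = 1 := by
  have := congrArg LinearMap.det (adjointMap_mul_self_of_isometry (hB := hB) hg)
  rwa [map_mul, det_adjointMap, map_one] at this

end

/-- An isometry of a nondegenerate form is invertible. -/
theorem exists_unit_of_isometry [FiniteDimensional ℂ V] {B : LinearMap.BilinForm ℂ V}
    (hB : B.Nondegenerate) {g : Module.End ℂ V} (hg : ∀ u v, B (g u) (g v) = B u v) :
    ∃ u : (Module.End ℂ V)ˣ, u.1 = g :=
  ⟨⟨g, adjointMap B hB g, mul_eq_one_comm.1 (adjointMap_mul_self_of_isometry hg),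
    adjointMap_mul_self_of_isometry hg⟩, rfl⟩

theorem inv_eq_adjointMap [FiniteDimensional ℂ V] {B : LinearMap.BilinForm ℂ V}
    (hB : B.Nondegenerate) {g : (Module.End ℂ V)ˣ} (hg : ∀ u v, B (g.1 u) (g.1 v) = B u v) :
    (g⁻¹).1 = adjointMap B hB g.1 :=
  Units.inv_eq_of_mul_eq_one_left (adjointMap_mul_self_of_isometry hg)

/-! ### Square roots and conjugacy by isometries -/

open Polynomial in
/-- An invertible complex endomorphism has a square root that is a polynomial in it. A polynomial
that interpolates square roots of the eigenvalues is a square root up to a nilpotent error, which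
Newton iteration removes. -/
theorem exists_aeval_sq_eq [FiniteDimensional ℂ V] {A : Module.End ℂ V}
    (hA : Function.Injective A) : ∃ p : ℂ[X], aeval A p * aeval A p = A := by
  classical
  set μ := minpoly ℂ A with hμ
  have hμ0 : μ ≠ 0 := minpoly.ne_zero (Algebra.IsIntegral.isIntegral A)
  choose s hs using fun z : ℂ => IsAlgClosed.exists_pow_nat_eq z (n := 2) (by norm_num)
  set q : ℂ[X] := Lagrange.interpolate μ.roots.toFinset id s with hq
  have hq' : ∀ z ∈ μ.roots, q.eval z = s z := fun z hz =>
    Lagrange.eval_interpolate_at_node s (v := id) (fun _ _ _ _ h => h) (Multiset.mem_toFinset.2 hz)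
  have hdvd : ∀ t : Multiset ℂ, (∀ z ∈ t, z ∈ μ.roots) →
      (t.map fun z => X - C z).prod ∣ (q ^ 2 - X) ^ Multiset.card t := by
    intro t
    induction t using Multiset.induction with
    | empty => simp
    | cons z t ih =>
      intro ht
      rw [Multiset.map_cons, Multiset.prod_cons, Multiset.card_cons, pow_succ']
      refine mul_dvd_mul ?_ (ih fun w hw => ht w (Multiset.mem_cons_of_mem hw))
      rw [dvd_iff_isRoot]
      simp [hq' z (ht z (Multiset.mem_cons_self _ _)), hs]
  have hμdvd : μ ∣ (q ^ 2 - X) ^ Multiset.card μ.roots := by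
    conv_lhs => rw [(IsAlgClosed.splits μ).eq_prod_roots]
    rw [C_mul_dvd (leadingCoeff_ne_zero.2 hμ0)]
    exact hdvd _ fun _ h => h
  let π := Ideal.Quotient.mk (Ideal.span {μ})
  have hnil : IsNilpotent (π q ^ 2 - π X) := by
    refine ⟨Multiset.card μ.roots, ?_⟩
    rw [← map_pow, ← map_sub, ← map_pow, Ideal.Quotient.eq_zero_iff_mem,
      Ideal.mem_span_singleton]
    exact hμdvd
  have hX : IsUnit (π X) := by
    have : IsCoprime X μ := by
      rw [irreducible_X.coprime_iff_not_dvd, X_dvd_iff, coeff_zero_eq_eval_zero]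
      intro h
      obtain ⟨v, hv, hv0⟩ := (Module.End.hasEigenvalue_of_isRoot (f := A) h).exists_hasEigenvector
      rw [Module.End.mem_eigenspace_iff, zero_smul, ← map_zero A] at hv
      exact hv0 (hA hv)
    obtain ⟨a, b, hab⟩ := this
    refine IsUnit.of_mul_eq_one (π a) ?_
    have h0 : π μ = 0 := Ideal.Quotient.eq_zero_iff_mem.2 (Ideal.mem_span_singleton_self _)
    have := congrArg π hab
    rw [map_add, map_mul, map_mul, h0, mul_zero, add_zero, map_one] at this
    rw [mul_comm, this]
  have hqu : IsUnit (π q) := by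
    have h1 := hnil.isUnit_add_left_of_commute hX (Commute.all _ _)
    rw [add_sub_cancel] at h1
    exact (isUnit_pow_iff two_ne_zero).1 h1
  obtain ⟨r, ⟨-, hr⟩, -⟩ := existsUnique_nilpotent_sub_and_aeval_eq_zero
    (P := (X ^ 2 - C (π X) : (ℂ[X] ⧸ Ideal.span {μ})[X])) (x := π q) (by simpa using hnil) (by
      have h2 : IsUnit (2 : ℂ[X] ⧸ Ideal.span {μ}) := by
        have := (isUnit_iff_ne_zero.2 (two_ne_zero (α := ℂ))).map
          (algebraMap ℂ (ℂ[X] ⧸ Ideal.span {μ}))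
        rwa [map_ofNat] at this
      simpa [derivative_X_pow, one_add_one_eq_two] using h2.mul hqu)
  obtain ⟨p, rfl⟩ := Ideal.Quotient.mk_surjective r
  refine ⟨p, ?_⟩
  have h3 : μ ∣ p ^ 2 - X := by
    rw [← Ideal.mem_span_singleton, ← Ideal.Quotient.eq_zero_iff_mem]
    simpa [π] using hr
  have h4 := (minpoly.dvd_iff).1 h3
  rw [map_sub, map_pow, aeval_X, sub_eq_zero] at h4
  rw [← sq, h4]

/-- Two conjugate skew-adjoint endomorphisms are conjugate by an isometry: if `h` conjugates the
first to the second, then `h* h` commutes with the first, and `h (h* h) ^ (-1/2)` is an isometry. -/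
theorem exists_isometry_conj [FiniteDimensional ℂ V] {B : LinearMap.BilinForm ℂ V} {ε : ℂ}
    (hB : B.Nondegenerate) (hε : HasSign B ε) {x y : Module.End ℂ V} (hx : x ∈ classicalLie B)
    (hy : y ∈ classicalLie B) (h : V ≃ₗ[ℂ] V) (hxy : ∀ u, h (x u) = y (h u)) :
    ∃ g : (Module.End ℂ V)ˣ, (∀ u v, B (g.1 u) (g.1 v) = B u v) ∧ g.1 * x = y * g.1 := by
  set H : Module.End ℂ V := h.toLinearMap
  have hskew : ∀ {z : Module.End ℂ V}, z ∈ classicalLie B → adjointMap B hB z = -z :=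
    fun hz => adjointMap_unique fun u v => by simp [mem_classicalLie.1 hz]
  set H' := adjointMap B hB H with hH'
  have hHx : H * x = y * H := LinearMap.ext hxy
  have hxH : x * H' = H' * y := by
    have := congrArg (adjointMap B hB) hHx
    rw [adjointMap_mul, adjointMap_mul, hskew hx, hskew hy, neg_mul, mul_neg] at this
    exact neg_injective this
  set A := H' * H
  have hAx : Commute A x := by
    change H' * H * x = x * (H' * H)
    rw [mul_assoc, hHx, ← mul_assoc, ← mul_assoc, hxH]
  have hAadj : adjointMap B hB A = A := by
    rw [adjointMap_mul, hH', adjointMap_adjointMap hε]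
  have hAinj : Function.Injective A := by
    rw [injective_iff_map_eq_zero]
    intro u hu
    have h1 : ∀ v, B (H u) (H v) = 0 := fun v => by
      rw [← adjointMap_left (hB := hB)]
      change B (A u) v = 0
      rw [hu, map_zero, LinearMap.zero_apply]
    have h2 : H u = 0 := eq_zero_of_forall_left hB fun v => by
      obtain ⟨w, rfl⟩ := h.surjective v
      exact h1 w
    exact h.map_eq_zero_iff.1 h2
  obtain ⟨p, hp⟩ := exists_aeval_sq_eq hAinj
  set c := Polynomial.aeval A p
  have hcx : Commute c x := by
    have := Algebra.adjoin_le_centralizer_centralizer ℂ {A}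
      (Polynomial.aeval_mem_adjoin_singleton ℂ A (p := p)) x ?_
    · exact this.symm
    · rintro _ rfl
      exact hAx
  have hcadj : adjointMap B hB c = c := by rw [adjointMap_aeval, hAadj]
  have hcinj : Function.Injective c := fun u v huv => hAinj (by
    rw [← hp, Module.End.mul_apply, Module.End.mul_apply, huv])
  have hcu : IsUnit c := (Module.End.isUnit_iff c).2
    ⟨hcinj, LinearMap.injective_iff_surjective.1 hcinj⟩
  obtain ⟨c, hc⟩ := hcu
  rw [← hc] at hp hcx hcadj
  have hiso : ∀ u v, B ((H * c⁻¹.1) u) ((H * c⁻¹.1) v) = B u v := by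
    have key : ∀ u, c.1 (c⁻¹.1 u) = u := fun u => by
      rw [← Module.End.mul_apply, Units.mul_inv, Module.End.one_apply]
    have h1 : ∀ u v, B (H u) (H v) = B (c.1 u) (c.1 v) := fun u v => by
      rw [← adjointMap_left (hB := hB), ← adjointMap_left (hB := hB) c.1, hcadj]
      change B (A u) v = B ((c.1 * c.1) u) v
      rw [hp]
    intro u v
    rw [Module.End.mul_apply, Module.End.mul_apply, h1, key, key]
  obtain ⟨g, hg⟩ := exists_unit_of_isometry hB hiso
  refine ⟨g, fun u v => by rw [hg, hiso], ?_⟩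
  have h2 : Commute c⁻¹.1 x := Commute.units_inv_left hcx
  rw [hg, mul_assoc, h2.eq, ← mul_assoc, hHx, mul_assoc]

end InducedOrbit

namespace InducedOrbit

open ClassicalVariety

variable {V : Type*} [AddCommGroup V] [Module ℂ V]

/-! ### Hyperbolic frames and unipotent isometries -/

/-- Two families of vectors, each spanning an isotropic subspace, and dual to each other. -/
structure IsHyperbolic {r : ℕ} (B : LinearMap.BilinForm ℂ V) (f f' : Fin r → V) : Prop where
  left : ∀ i j, B (f i) (f j) = 0
  right : ∀ i j, B (f' i) (f' j) = 0
  dual : ∀ i j, B (f i) (f' j) = if i = j then 1 else 0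

variable {B : LinearMap.BilinForm ℂ V} {ε : ℂ} {r : ℕ}

namespace IsHyperbolic

variable {f f' : Fin r → V}

theorem swap (h : IsHyperbolic B f f') (hε : HasSign B ε) :
    IsHyperbolic B (fun i => ε • f' i) f where
  left i j := by simp [h.right]
  right := h.left
  dual i j := by
    rw [map_smul, LinearMap.smul_apply, hε.swap, h.dual, smul_eq_mul, ← mul_assoc, hε.sq, one_mul]
    simp only [eq_comm]

theorem dual' (h : IsHyperbolic B f f') (hε : HasSign B ε) (i j : Fin r) :
    B (f' i) (f j) = if i = j then ε else 0 := by
  rw [hε.swap, h.dual]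
  simp only [eq_comm, mul_ite, mul_one, mul_zero]

theorem eq_sum (h : IsHyperbolic B f f') {v : V} (hv : v ∈ Submodule.span ℂ (Set.range f)) :
    v = ∑ i, B v (f' i) • f i := by
  induction hv using Submodule.span_induction with
  | mem v hv =>
    obtain ⟨j, rfl⟩ := hv
    simp [h.dual]
  | zero => simp
  | add u v _ _ hu hv =>
    simp only [map_add, LinearMap.add_apply, add_smul, Finset.sum_add_distrib]
    rw [← hu, ← hv]
  | smul c v _ hv =>
    simp only [map_smul, LinearMap.smul_apply, smul_eq_mul, mul_smul, ← Finset.smul_sum]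
    rw [← hv]

theorem linearIndependent (h : IsHyperbolic B f f') : LinearIndependent ℂ f := by
  rw [Fintype.linearIndependent_iff]
  intro c hc j
  have := congrArg (fun v => B v (f' j)) hc
  simpa [h.dual, LinearMap.sum_apply] using this

theorem finrank_span (h : IsHyperbolic B f f') :
    Module.finrank ℂ (Submodule.span ℂ (Set.range f)) = r := by
  rw [finrank_span_eq_card h.linearIndependent, Fintype.card_fin]

end IsHyperbolic

theorem mem_orth_span {ι : Type*} {f : ι → V} {v : V} :
    v ∈ B.orthogonal (Submodule.span ℂ (Set.range f)) ↔ ∀ i, B (f i) v = 0 := by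
  rw [mem_orth]
  constructor
  · exact fun h i => h _ (Submodule.subset_span ⟨i, rfl⟩)
  · intro h n hn
    induction hn using Submodule.span_induction with
    | mem n hn => obtain ⟨i, rfl⟩ := hn; exact h i
    | zero => simp
    | add u v _ _ hu hv => simp [hu, hv]
    | smul c v _ hv => simp [hv]

theorem span_smul_of_sign (hε : HasSign B ε) (f : Fin r → V) :
    Submodule.span ℂ (Set.range fun i => ε • f i) = Submodule.span ℂ (Set.range f) := by
  apply le_antisymm <;> rw [Submodule.span_le] <;> rintro _ ⟨i, rfl⟩
  · exact Submodule.smul_mem _ _ (Submodule.subset_span ⟨i, rfl⟩)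
  · have : f i = ε • ε • f i := by rw [smul_smul, hε.sq, one_smul]
    rw [this]
    exact Submodule.smul_mem _ _ (Submodule.subset_span ⟨i, rfl⟩)

section

variable [FiniteDimensional ℂ V]

/-- An isotropic complement of the orthogonal of an isotropic subspace has a basis dual to any given
basis of that subspace. -/
theorem exists_isHyperbolic (hB : B.Nondegenerate) {f : Fin r → V} (hf : LinearIndependent ℂ f)
    {F F' : Submodule ℂ V} (hspan : Submodule.span ℂ (Set.range f) = F)
    (hF : F ≤ B.orthogonal F) (hF' : F' ≤ B.orthogonal F') (hc : IsCompl (B.orthogonal F) F') :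
    ∃ f', IsHyperbolic B f f' ∧ Submodule.span ℂ (Set.range f') = F' := by
  have hdim : Module.finrank ℂ F' = r := by
    have h1 := finrank_orth hB F
    have h2 := Submodule.finrank_add_eq_of_isCompl hc
    have h3 : Module.finrank ℂ F = r := by
      rw [← hspan, finrank_span_eq_card hf, Fintype.card_fin]
    omega
  let φ : F' →ₗ[ℂ] (Fin r → ℂ) := LinearMap.pi fun i => (B (f i)).comp F'.subtype
  have hφ : Function.Injective φ := by
    rw [injective_iff_map_eq_zero]
    intro v hv
    have h1 : (v : V) ∈ B.orthogonal F := by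
      rw [← hspan, mem_orth_span]
      exact fun i => congrFun hv i
    exact Subtype.ext ((Submodule.disjoint_def.1 hc.disjoint) v h1 v.2)
  let e := LinearMap.linearEquivOfInjective φ hφ (by simp [hdim])
  refine ⟨fun j => (e.symm (Pi.single j 1) : F'), ⟨fun i j => ?_, fun i j => ?_, fun i j => ?_⟩, ?_⟩
  · have hm : ∀ i, f i ∈ F := fun i => hspan ▸ Submodule.subset_span ⟨i, rfl⟩
    exact mem_orth.1 (hF (hm j)) _ (hm i)
  · exact mem_orth.1 (hF' (e.symm (Pi.single j 1)).2) _ (e.symm (Pi.single i 1)).2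
  · change φ (e.symm (Pi.single j 1)) i = _
    change e (e.symm (Pi.single j 1)) i = _
    rw [LinearEquiv.apply_symm_apply, Pi.single_apply]
  · have h1 := ((Pi.basisFun ℂ (Fin r)).map e.symm).span_eq
    have h2 := congrArg (Submodule.map F'.subtype) h1
    rw [Submodule.map_span, Submodule.map_top, Submodule.range_subtype, ← Set.range_comp] at h2
    refine Eq.trans ?_ h2
    congr 2
    funext j
    simp

theorem exists_basis_of_finrank {F : Submodule ℂ V} (h : Module.finrank ℂ F = r) :
    ∃ f : Fin r → V, LinearIndependent ℂ f ∧ Submodule.span ℂ (Set.range f) = F := by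
  let b := Module.finBasisOfFinrankEq ℂ F h
  refine ⟨fun i => b i, b.linearIndependent.map' F.subtype (Submodule.ker_subtype F), ?_⟩
  have h2 := congrArg (Submodule.map F.subtype) b.span_eq
  rw [Submodule.map_span, Submodule.map_top, Submodule.range_subtype, ← Set.range_comp] at h2
  exact h2

/-- The orthogonal of an isotropic subspace has an isotropic complement. Any complement `C` becomes
isotropic on replacing `c ∈ C` by `c + φ c`, where `φ : C → F` represents minus half of the form
on `C`. -/
theorem exists_isotropic_compl (hB : B.Nondegenerate) (hε : HasSign B ε) {F : Submodule ℂ V}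
    (hF : F ≤ B.orthogonal F) :
    ∃ F' : Submodule ℂ V, F' ≤ B.orthogonal F' ∧ IsCompl (B.orthogonal F) F' := by
  obtain ⟨C, hC⟩ := Submodule.exists_isCompl (B.orthogonal F)
  have hdim : Module.finrank ℂ F = Module.finrank ℂ C := by
    have h1 := finrank_orth hB F
    have h2 := Submodule.finrank_add_eq_of_isCompl hC
    omega
  let ψ : F →ₗ[ℂ] Module.Dual ℂ C :=
    LinearMap.domRestrict₁₂ B F C
  have hψ : ∀ f c, ψ f c = B f c := fun _ _ => rfl
  have hinj : Function.Injective ψ := by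
    rw [injective_iff_map_eq_zero]
    intro f hf
    refine Subtype.ext (eq_zero_of_forall_left hB fun v => ?_)
    obtain ⟨a, ha, c, hc, rfl⟩ := Submodule.mem_sup.1 (hC.sup_eq_top ▸ Submodule.mem_top :
      v ∈ B.orthogonal F ⊔ C)
    rw [map_add, mem_orth.1 ha f f.2, zero_add]
    exact LinearMap.congr_fun hf ⟨c, hc⟩
  let e := LinearMap.linearEquivOfInjective ψ hinj (by rw [Subspace.dual_finrank_eq, hdim])
  let β : C →ₗ[ℂ] Module.Dual ℂ C :=
    LinearMap.domRestrict₁₂ B C C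
  let φ : C →ₗ[ℂ] F := (-(1 / 2 : ℂ)) • e.symm.toLinearMap.comp β
  have hφ : ∀ c c' : C, B (φ c) c' = -(1 / 2) * B c c' := by
    intro c c'
    have h1 : ψ (e.symm (β c)) = β c := e.apply_symm_apply (β c)
    have h2 : B (e.symm (β c)) c' = B c c' := LinearMap.congr_fun h1 c'
    have h3 : (φ c : V) = (-(1 / 2 : ℂ)) • (e.symm (β c) : V) := rfl
    rw [h3, map_smul, LinearMap.smul_apply, h2, smul_eq_mul]
  have hφF : ∀ c, (φ c : V) ∈ B.orthogonal F := fun c => hF (φ c).2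
  refine ⟨LinearMap.range (C.subtype + F.subtype.comp φ), ?_, ?_, ?_⟩
  · rintro _ ⟨c, rfl⟩
    rw [mem_orth]
    rintro _ ⟨c', rfl⟩
    simp only [LinearMap.add_apply, LinearMap.comp_apply, Submodule.subtype_apply, map_add]
    rw [hφ, mem_orth.1 (hφF c) _ (φ c').2, hε.swap c' (φ c), hφ, mul_left_comm, ← hε.swap]
    ring
  · rw [Submodule.disjoint_def]
    rintro _ hv ⟨c, rfl⟩
    simp only [LinearMap.add_apply, LinearMap.comp_apply, Submodule.subtype_apply] at hv ⊢
    have h1 : (c : V) ∈ B.orthogonal F := by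
      simpa using Submodule.sub_mem _ hv (hφF c)
    have h2 : c = 0 := Subtype.ext ((Submodule.disjoint_def.1 hC.disjoint) _ h1 c.2)
    simp [h2]
  · rw [codisjoint_iff, eq_top_iff]
    rintro v -
    obtain ⟨a, ha, c, hc, rfl⟩ := Submodule.mem_sup.1 (hC.sup_eq_top ▸ Submodule.mem_top :
      v ∈ B.orthogonal F ⊔ C)
    refine Submodule.mem_sup.2 ⟨a - φ ⟨c, hc⟩, Submodule.sub_mem _ ha (hφF _),
      _, ⟨⟨c, hc⟩, rfl⟩, ?_⟩
    simp

end

/-- For a hyperbolic frame `f, f'` and vectors `g i` such that the `f i + g i` form a hyperbolic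
frame with the `f' i` too, `1 + unipotentMap B f f' g` is the isometry that maps `f i` to
`f i + g i`, fixes the `f' i`, and acts trivially on the subquotients of the flag defined by the
span of the `f' i`. It is linear in `g`. -/
noncomputable def unipotentMap (B : LinearMap.BilinForm ℂ V) (f f' : Fin r → V) :
    (Fin r → V) →ₗ[ℂ] Module.End ℂ V where
  toFun g :=
    { toFun := fun v => ∑ i, B v (f' i) • g i - ∑ i, B (g i) v • f' i +
        ∑ i, (∑ k, B v (f' k) * B (g i) (f k)) • f' i
      map_add' := fun u v => by
        simp only [map_add, LinearMap.add_apply, add_smul, add_mul, Finset.sum_add_distrib]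
        abel
      map_smul' := fun c v => by
        simp only [map_smul, LinearMap.smul_apply, smul_eq_mul, RingHom.id_apply, smul_add,
          smul_sub, Finset.smul_sum, smul_smul, Finset.mul_sum, mul_assoc] }
  map_add' g g' := by
    ext v
    simp only [LinearMap.coe_mk, AddHom.coe_mk, Pi.add_apply, map_add, LinearMap.add_apply,
      add_smul, smul_add, mul_add, Finset.sum_add_distrib]
    abel
  map_smul' c g := by
    ext v
    simp only [LinearMap.coe_mk, AddHom.coe_mk, Pi.smul_apply, map_smul, LinearMap.smul_apply,
      smul_eq_mul, RingHom.id_apply, smul_add, smul_sub, Finset.smul_sum, smul_smul,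
      Finset.mul_sum, mul_comm, mul_left_comm]

theorem unipotentMap_apply (f f' g : Fin r → V) (v : V) :
    unipotentMap B f f' g v = ∑ i, B v (f' i) • g i - ∑ i, B (g i) v • f' i +
      ∑ i, (∑ k, B v (f' k) * B (g i) (f k)) • f' i := rfl

section

variable {f f' g : Fin r → V}

theorem unipotentMap_left (h : IsHyperbolic B f f') (j : Fin r) :
    unipotentMap B f f' g (f j) = g j := by
  simp [unipotentMap_apply, h.dual]

theorem unipotentMap_right (h : IsHyperbolic B f f') (h0 : ∀ i j, B (g i) (f' j) = 0) (j : Fin r) :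
    unipotentMap B f f' g (f' j) = 0 := by
  simp [unipotentMap_apply, h.right, h0]

theorem unipotentMap_apply_right (h : IsHyperbolic B f f') (h0 : ∀ i j, B (g i) (f' j) = 0)
    (v : V) (j : Fin r) : B (unipotentMap B f f' g v) (f' j) = 0 := by
  simp [unipotentMap_apply, LinearMap.sum_apply, h0, h.right]

theorem unipotentMap_mem_span {v : V} (hv : ∀ i, B v (f' i) = 0) :
    unipotentMap B f f' g v ∈ Submodule.span ℂ (Set.range f') := by
  simp only [unipotentMap_apply, hv, zero_smul, zero_mul, Finset.sum_const_zero, zero_sub,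
    add_zero]
  exact neg_mem (sum_mem fun i _ => Submodule.smul_mem _ _ (Submodule.subset_span ⟨i, rfl⟩))

theorem unipotentMap_of_mem_span (h : IsHyperbolic B f f') (h0 : ∀ i j, B (g i) (f' j) = 0)
    {v : V} (hv : v ∈ Submodule.span ℂ (Set.range f')) : unipotentMap B f f' g v = 0 := by
  induction hv using Submodule.span_induction with
  | mem n hn => obtain ⟨i, rfl⟩ := hn; exact unipotentMap_right h h0 i
  | zero => simp
  | add u v _ _ hu hv => simp [hu, hv]
  | smul c v _ hv => simp [hv]

theorem unipotentMap_isNilpotent (h : IsHyperbolic B f f') (h0 : ∀ i j, B (g i) (f' j) = 0) :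
    IsNilpotent (unipotentMap B f f' g) :=
  ⟨3, LinearMap.ext fun v => unipotentMap_of_mem_span h h0
    (unipotentMap_mem_span (unipotentMap_apply_right h h0 v))⟩

theorem unipotentMap_isometry (hε : HasSign B ε) (h : IsHyperbolic B f f')
    (hg : IsHyperbolic B (f + g) f') (u v : V) :
    B (u + unipotentMap B f f' g u) (v + unipotentMap B f f' g v) = B u v := by
  have h0 : ∀ i j, B (g i) (f' j) = 0 := fun i j => by
    have := hg.dual i j
    rw [Pi.add_apply, map_add, LinearMap.add_apply, h.dual] at this
    simpa using this
  have h0' : ∀ i j, B (f' i) (g j) = 0 := fun i j => by rw [hε.swap, h0, mul_zero]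
  have hgg : ∀ i j, B (g i) (g j) = - B (g i) (f j) - B (f i) (g j) := fun i j => by
    have := hg.left i j
    simp only [Pi.add_apply, map_add, LinearMap.add_apply, h.left] at this
    linear_combination this
  have e1 : B (unipotentMap B f f' g u) v = ∑ i, B u (f' i) * B (g i) v -
      ∑ i, B (g i) u * B (f' i) v + ∑ i, (∑ k, B u (f' k) * B (g i) (f k)) * B (f' i) v := by
    simp [unipotentMap_apply, LinearMap.sum_apply]
  have e2 : B u (unipotentMap B f f' g v) = ∑ i, B v (f' i) * B u (g i) -
      ∑ i, B (g i) v * B u (f' i) + ∑ i, (∑ k, B v (f' k) * B (g i) (f k)) * B u (f' i) := by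
    simp [unipotentMap_apply]
  have e3 : B (unipotentMap B f f' g u) (unipotentMap B f f' g v) =
      ∑ i, ∑ j, B u (f' j) * (B v (f' i) * B (g j) (g i)) := by
    simp only [unipotentMap_apply, map_add, map_sub, map_sum, map_smul, LinearMap.add_apply,
      LinearMap.sub_apply, LinearMap.sum_apply, LinearMap.smul_apply, smul_eq_mul, h0, h0',
      h.right, mul_zero, Finset.sum_const_zero, sub_zero, add_zero, Finset.mul_sum]
    exact Finset.sum_congr rfl fun i _ => Finset.sum_congr rfl fun j _ => mul_left_comm _ _ _
  have e4 : ∀ i, B (g i) u * B (f' i) v = B v (f' i) * B u (g i) := fun i => by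
    rw [hε.swap (g i) u, hε.swap (f' i) v]
    linear_combination (B u (g i) * B v (f' i)) * hε.sq
  simp only [map_add, LinearMap.add_apply]
  rw [e1, e2, e3]
  simp only [e4]
  have e5 : ∑ i, ∑ j, B u (f' j) * (B v (f' i) * B (g j) (g i)) =
      - ∑ i, (∑ k, B u (f' k) * B (g i) (f k)) * B (f' i) v -
        ∑ i, (∑ k, B v (f' k) * B (g i) (f k)) * B u (f' i) := by
    simp only [hgg, Finset.sum_mul]
    rw [Finset.sum_comm (f := fun i k => B v (f' k) * B (g i) (f k) * B u (f' i)),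
      ← Finset.sum_neg_distrib, ← Finset.sum_sub_distrib]
    refine Finset.sum_congr rfl fun i _ => ?_
    rw [← Finset.sum_neg_distrib, ← Finset.sum_sub_distrib]
    refine Finset.sum_congr rfl fun j _ => ?_
    rw [hε.swap (f' i) v, hε.swap (f j) (g i)]
    ring
  rw [e5, Finset.sum_congr rfl fun i _ => mul_comm (B (g i) v) (B u (f' i))]
  ring

end

theorem det_one_add_of_isNilpotent [FiniteDimensional ℂ V] {N : Module.End ℂ V}
    (hN : IsNilpotent N) : LinearMap.det (1 + N) = 1 := by
  have h := LinearMap.eval_charpoly (-N) 1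
  rw [map_one, sub_neg_eq_add, (LinearMap.charpoly_eq_X_pow_iff (-N)).2] at h
  · simpa using h.symm
  · obtain ⟨k, hk⟩ := hN.neg
    exact fun v => ⟨k, by rw [hk, LinearMap.zero_apply]⟩

theorem one_add_unipotentMap_isometry (hε : HasSign B ε) {f f' f₂ : Fin r → V}
    (h : IsHyperbolic B f f') (h₂ : IsHyperbolic B f₂ f') (u v : V) :
    B ((1 + unipotentMap B f f' (f₂ - f)) u) ((1 + unipotentMap B f f' (f₂ - f)) v) = B u v :=
  unipotentMap_isometry hε h (by rwa [add_sub_cancel]) u v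

theorem sub_dual_eq_zero {f f' f₂ : Fin r → V} (h : IsHyperbolic B f f')
    (h₂ : IsHyperbolic B f₂ f') (i j : Fin r) : B ((f₂ - f) i) (f' j) = 0 := by
  rw [Pi.sub_apply, map_sub, LinearMap.sub_apply, h.dual, h₂.dual, sub_self]

theorem one_add_unipotentMap_map {f f' f₂ : Fin r → V} (h : IsHyperbolic B f f') :
    (Submodule.span ℂ (Set.range f)).map (1 + unipotentMap B f f' (f₂ - f)) =
      Submodule.span ℂ (Set.range f₂) := by
  rw [Submodule.map_span, ← Set.range_comp]
  congr 2
  funext i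
  simp [unipotentMap_left h]

variable [FiniteDimensional ℂ V]

/-- The unipotent isometry attached to two hyperbolic frames with the same second half. -/
theorem exists_unipotent_of_frames (hB : B.Nondegenerate) (hε : HasSign B ε) {f f' f₂ : Fin r → V}
    (h : IsHyperbolic B f f') (h₂ : IsHyperbolic B f₂ f') :
    ∃ u ∈ classicalGroup B, u.1 = 1 + unipotentMap B f f' (f₂ - f) := by
  obtain ⟨u, hu⟩ := exists_unit_of_isometry hB (one_add_unipotentMap_isometry hε h h₂)
  refine ⟨u, ⟨fun v w => ?_, ?_⟩, hu⟩
  · rw [hu, one_add_unipotentMap_isometry hε h h₂]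
  · rw [hu, det_one_add_of_isNilpotent (unipotentMap_isNilpotent h (sub_dual_eq_zero h h₂))]

/-- The group elements that act trivially on the subquotients of the flag of an isotropic subspace
`F` act transitively on the isotropic complements of its orthogonal. -/
theorem exists_unipotent (hB : B.Nondegenerate) (hε : HasSign B ε) {F F₁ F₂ : Submodule ℂ V}
    (hF : F ≤ B.orthogonal F) (hF₁ : F₁ ≤ B.orthogonal F₁) (hF₂ : F₂ ≤ B.orthogonal F₂)
    (hc₁ : IsCompl (B.orthogonal F) F₁) (hc₂ : IsCompl (B.orthogonal F) F₂) :
    ∃ u ∈ classicalGroup B, F₁.map u.1 = F₂ ∧ (∀ v ∈ F, u.1 v = v) ∧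
      (∀ v, u.1 v - v ∈ B.orthogonal F) ∧ ∀ v ∈ B.orthogonal F, u.1 v - v ∈ F := by
  obtain ⟨r, hr⟩ : ∃ r, Module.finrank ℂ F = r := ⟨_, rfl⟩
  obtain ⟨f, hf, hfF⟩ := exists_basis_of_finrank hr
  obtain ⟨f₁, h₁, hs₁⟩ := exists_isHyperbolic hB hf hfF hF hF₁ hc₁
  obtain ⟨f₂, h₂, hs₂⟩ := exists_isHyperbolic hB hf hfF hF hF₂ hc₂
  have k₁ := h₁.swap hε
  have k₂ := h₂.swap hε
  have h0 := sub_dual_eq_zero k₁ k₂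
  obtain ⟨u, hu, hu'⟩ := exists_unipotent_of_frames hB hε k₁ k₂
  refine ⟨u, hu, ?_, fun v hv => ?_, fun v => ?_, fun v hv => ?_⟩
  · rw [hu', ← hs₁, ← hs₂, ← span_smul_of_sign hε, one_add_unipotentMap_map k₁,
      span_smul_of_sign hε]
  · rw [← hfF] at hv
    rw [hu', LinearMap.add_apply, unipotentMap_of_mem_span k₁ h0 hv]
    simp
  · rw [hu', LinearMap.add_apply, Module.End.one_apply, add_sub_cancel_left, ← hfF, mem_orth_span]
    intro i
    rw [hε.swap, unipotentMap_apply_right k₁ h0, mul_zero]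
  · rw [← hfF, mem_orth_span] at hv
    rw [hu', LinearMap.add_apply, Module.End.one_apply, add_sub_cancel_left, ← hfF]
    exact unipotentMap_mem_span fun i => by rw [hε.swap, hv, mul_zero]

end InducedOrbit

namespace InducedOrbit

open ClassicalVariety

variable {V : Type*} [AddCommGroup V] [Module ℂ V] [FiniteDimensional ℂ V]
  {B : LinearMap.BilinForm ℂ V} {ε : ℂ}

/-! ### Determinants of isometries -/

/-- An isometry that preserves a Lagrangian subspace `L` has determinant one, as `V / L` is dual
to `L`. -/
theorem det_eq_one_of_lagrangian (hB : B.Nondegenerate) {g : Module.End ℂ V}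
    (hg : ∀ u v, B (g u) (g v) = B u v) {L : Submodule ℂ V} (hL : B.orthogonal L = L)
    (hgL : L ≤ L.comap g) : LinearMap.det g = 1 := by
  let β : V →ₗ[ℂ] Module.Dual ℂ L := LinearMap.lcomp ℂ ℂ L.subtype ∘ₗ LinearMap.flip B
  have hβ : ∀ v l, β v l = B l v := fun _ _ => rfl
  have hker : ∀ v, v ∈ L ↔ β v = 0 := by
    intro v
    conv_lhs => rw [← hL, mem_orth]
    exact ⟨fun h => LinearMap.ext fun l => h l l.2,
      fun h l hl => LinearMap.congr_fun h (⟨l, hl⟩ : L)⟩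
  let γ : (V ⧸ L) →ₗ[ℂ] Module.Dual ℂ L := L.liftQ β fun v hv => (hker v).1 hv
  have hγ : Function.Injective γ := by
    rw [injective_iff_map_eq_zero]
    intro v hv
    obtain ⟨v, rfl⟩ := L.mkQ_surjective v
    rw [Submodule.mkQ_apply, Submodule.Quotient.mk_eq_zero, hker]
    exact hv
  have hdim : Module.finrank ℂ (V ⧸ L) = Module.finrank ℂ (Module.Dual ℂ L) := by
    have h1 := finrank_orth hB L
    have h2 := L.finrank_quotient_add_finrank
    rw [Subspace.dual_finrank_eq]
    rw [hL] at h1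
    omega
  let e := LinearMap.linearEquivOfInjective γ hγ hdim
  have key : (g.restrict hgL).dualMap ∘ₗ (e.toLinearMap ∘ₗ L.mapQ L g hgL ∘ₗ e.symm.toLinearMap) =
      LinearMap.id := by
    refine LinearMap.ext fun φ => ?_
    obtain ⟨v, rfl⟩ := e.surjective φ
    obtain ⟨v, rfl⟩ := L.mkQ_surjective v
    refine LinearMap.ext fun l => ?_
    simp only [LinearMap.comp_apply, LinearEquiv.coe_coe, LinearEquiv.symm_apply_apply,
      Submodule.mkQ_apply, Submodule.mapQ_apply, LinearMap.id_apply, LinearMap.dualMap_apply]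
    exact hg l v
  have h := congrArg LinearMap.det key
  rw [LinearMap.det_comp, LinearMap.det_dualMap, LinearMap.det_conj, LinearMap.det_id] at h
  rw [LinearMap.det_eq_det_mul_det L g hgL, h]

/-- An isometry of an alternating form preserves a Lagrangian subspace: a maximal invariant
isotropic subspace `L` is Lagrangian, as otherwise it could be enlarged by an eigenvector in
`L^⊥ / L`. -/
theorem exists_invariant_lagrangian (hB : B.Nondegenerate) (hA : B.IsAlt) {g : Module.End ℂ V}
    (hg : ∀ u v, B (g u) (g v) = B u v) :
    ∃ L : Submodule ℂ V, B.orthogonal L = L ∧ L ≤ L.comap g := by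
  let S : Set (Submodule ℂ V) := {L | L ≤ B.orthogonal L ∧ L ≤ L.comap g}
  obtain ⟨L, ⟨hL, hgL⟩, hmax⟩ := WellFounded.has_min
    (wellFounded_gt (α := Submodule ℂ V)) S ⟨⊥, bot_le, bot_le⟩
  refine ⟨L, ?_, hgL⟩
  by_contra hne
  have hinj : Function.Injective g := by
    rw [injective_iff_map_eq_zero]
    intro u hu
    refine eq_zero_of_forall_left hB fun v => ?_
    rw [← hg, hu, map_zero, LinearMap.zero_apply]
  have hsurj : ∀ l ∈ L, ∃ l' ∈ L, g l' = l := by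
    have h1 : Function.Injective (g.restrict hgL) := fun a b hab =>
      Subtype.ext (hinj (congrArg Subtype.val hab))
    intro l hl
    obtain ⟨l', hl'⟩ := LinearMap.injective_iff_surjective.1 h1 ⟨l, hl⟩
    exact ⟨l', l'.2, congrArg Subtype.val hl'⟩
  set M := B.orthogonal L with hM
  have hgM : M ≤ M.comap g := by
    intro v hv
    rw [Submodule.mem_comap, hM, mem_orth]
    intro l hl
    obtain ⟨l', hl', rfl⟩ := hsurj l hl
    rw [hg]
    exact mem_orth.1 hv l' hl'
  let L' := L.comap M.subtype
  have hgL' : L' ≤ L'.comap (g.restrict hgM) := fun v hv => hgL hv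
  have hL'top : L' ≠ ⊤ := by
    intro h
    refine hne (le_antisymm (fun v hv => ?_) hL)
    have : (⟨v, hv⟩ : M) ∈ L' := h ▸ Submodule.mem_top
    exact this
  have := Submodule.Quotient.nontrivial_iff.2 hL'top
  obtain ⟨c, hc⟩ := Module.End.exists_eigenvalue (L'.mapQ L' (g.restrict hgM) hgL')
  obtain ⟨w, hw, hw0⟩ := hc.exists_hasEigenvector
  obtain ⟨v, rfl⟩ := L'.mkQ_surjective w
  rw [Module.End.mem_eigenspace_iff, Submodule.mkQ_apply, Submodule.mapQ_apply,
    ← Submodule.Quotient.mk_smul, Submodule.Quotient.eq] at hw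
  have hw : g v - c • (v : V) ∈ L := hw
  have hvL : (v : V) ∉ L := fun h => hw0 ((Submodule.Quotient.mk_eq_zero L').2 h)
  refine hmax (L ⊔ Submodule.span ℂ {(v : V)}) ⟨?_, ?_⟩ ?_
  · intro a ha
    rw [mem_orth]
    intro b hb
    obtain ⟨l, hl, _, hs, rfl⟩ := Submodule.mem_sup.1 ha
    obtain ⟨l', hl', _, hs', rfl⟩ := Submodule.mem_sup.1 hb
    obtain ⟨s, rfl⟩ := Submodule.mem_span_singleton.1 hs
    obtain ⟨s', rfl⟩ := Submodule.mem_span_singleton.1 hs'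
    have h1 : B l' l = 0 := mem_orth.1 (hL hl) l' hl'
    have h2 : B l' v = 0 := mem_orth.1 v.2 l' hl'
    have h3 : B v l = 0 := hA.isRefl _ _ (mem_orth.1 v.2 l hl)
    have h4 : B v v = 0 := hA v
    simp [h1, h2, h3, h4]
  · rw [sup_le_iff, Submodule.span_singleton_le_iff_mem]
    refine ⟨fun l hl => Submodule.mem_sup_left (hgL hl), ?_⟩
    rw [Submodule.mem_comap, ← sub_add_cancel (g v) (c • (v : V))]
    exact add_mem (Submodule.mem_sup_left hw)
      (Submodule.mem_sup_right (Submodule.smul_mem _ _ (Submodule.mem_span_singleton_self _)))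
  · refine lt_of_le_of_ne le_sup_left fun h => hvL ?_
    rw [h]
    exact Submodule.mem_sup_right (Submodule.mem_span_singleton_self _)

theorem det_eq_one_of_isAlt (hB : B.Nondegenerate) (hA : B.IsAlt) {g : Module.End ℂ V}
    (hg : ∀ u v, B (g u) (g v) = B u v) : LinearMap.det g = 1 := by
  obtain ⟨L, hL, hgL⟩ := exists_invariant_lagrangian hB hA hg
  exact det_eq_one_of_lagrangian hB hg hL hgL

/-- The isometry that is `-1` on a nondegenerate subspace and `1` on its orthogonal. -/
theorem exists_reflection (hB : B.Nondegenerate) (hε : HasSign B ε) {x : Module.End ℂ V}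
    (hx : x ∈ classicalLie B) {U : Submodule ℂ V} (hU : IsCompl U (B.orthogonal U))
    (hxU : U ≤ U.comap x) :
    ∃ g : (Module.End ℂ V)ˣ, (∀ u v, B (g.1 u) (g.1 v) = B u v) ∧ g.1 * x = x * g.1 ∧
      LinearMap.det g.1 = (-1) ^ Module.finrank ℂ U := by
  obtain ⟨g, hgU, hgU'⟩ : ∃ g : Module.End ℂ V, (∀ v ∈ U, g v = -v) ∧
      ∀ v ∈ B.orthogonal U, g v = v := by
    refine ⟨LinearMap.ofIsCompl hU (-U.subtype) (B.orthogonal U).subtype, fun v hv => ?_,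
      fun v hv => ?_⟩
    · exact LinearMap.ofIsCompl_apply_left hU ⟨v, hv⟩
    · exact LinearMap.ofIsCompl_apply_right hU ⟨v, hv⟩
  have hdec : ∀ v, ∃ a ∈ U, ∃ b ∈ B.orthogonal U, v = a + b := fun v => by
    obtain ⟨a, ha, b, hb, h⟩ := Submodule.mem_sup.1 (hU.sup_eq_top ▸ Submodule.mem_top :
      v ∈ U ⊔ B.orthogonal U)
    exact ⟨a, ha, b, hb, h.symm⟩
  have hiso : ∀ u v, B (g u) (g v) = B u v := by
    intro u v
    obtain ⟨a, ha, b, hb, rfl⟩ := hdec u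
    obtain ⟨a', ha', b', hb', rfl⟩ := hdec v
    have h1 : B a b' = 0 := mem_orth.1 hb' a ha
    have h2 : B b a' = 0 := hε.isRefl _ _ (mem_orth.1 hb a' ha')
    simp [hgU a ha, hgU a' ha', hgU' b hb, hgU' b' hb', h1, h2]
  obtain ⟨g', hg'⟩ := exists_unit_of_isometry hB hiso
  rw [← hg'] at hiso hgU hgU'
  have hxU' : ∀ v ∈ B.orthogonal U, x v ∈ B.orthogonal U := by
    intro v hv
    rw [mem_orth]
    intro n hn
    rw [← neg_eq_iff_eq_neg.2 (mem_classicalLie.1 hx n v), mem_orth.1 hv _ (hxU hn), neg_zero]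
  refine ⟨g', hiso, LinearMap.ext fun v => ?_, ?_⟩
  · obtain ⟨a, ha, b, hb, rfl⟩ := hdec v
    simp only [Module.End.mul_apply, map_add]
    rw [hgU a ha, hgU' b hb, hgU _ (hxU ha), hgU' _ (hxU' b hb), map_neg]
  · have hs : U ≤ U.comap g'.1 := fun v hv => by
      rw [Submodule.mem_comap, hgU v hv]
      exact neg_mem hv
    have h1 : g'.1.restrict hs = (-1 : ℂ) • LinearMap.id := by
      refine LinearMap.ext fun v => Subtype.ext ?_
      simpa using hgU v v.2
    have h2 : U.mapQ U g'.1 hs = LinearMap.id := by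
      refine LinearMap.ext fun v => ?_
      obtain ⟨v, rfl⟩ := U.mkQ_surjective v
      obtain ⟨a, ha, b, hb, rfl⟩ := hdec v
      rw [Submodule.mkQ_apply, Submodule.mapQ_apply, LinearMap.id_apply, Submodule.Quotient.eq,
        map_add, hgU a ha, hgU' b hb, add_sub_add_right_eq_sub]
      exact sub_mem (neg_mem ha) ha
    rw [LinearMap.det_eq_det_mul_det U g'.1 hs, h1, h2, LinearMap.det_smul, LinearMap.det_id,
      LinearMap.det_id, mul_one, mul_one]

/-- A vector `v` killed by `x ^ (n + 1)` with `B v (x ^ n v) ≠ 0` generates a nondegenerate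
`x`-invariant subspace of dimension `n + 1`, as the Gram matrix of its basis `x ^ j v` is
anti-triangular. -/
theorem exists_nondegenerate_cyclic (hε : HasSign B ε) {x : Module.End ℂ V}
    (hx : x ∈ classicalLie B) {n : ℕ} {v : V} (hv : (x ^ (n + 1)) v = 0)
    (hv' : B v ((x ^ n) v) ≠ 0) :
    ∃ U : Submodule ℂ V, IsCompl U (B.orthogonal U) ∧ U ≤ U.comap x ∧
      Module.finrank ℂ U = n + 1 := by
  let w : Fin (n + 1) → V := fun j => (x ^ (j : ℕ)) v
  have key : ∀ c : Fin (n + 1) → ℂ, (∀ i, B (w i) (∑ j, c j • w j) = 0) → c = 0 := by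
    intro c hc
    suffices ∀ (m : ℕ) (j : Fin (n + 1)), (j : ℕ) = m → c j = 0 from funext fun j => this _ j rfl
    intro m
    induction m using Nat.strong_induction_on with
    | _ m ih =>
      rintro j rfl
      have h1 := hc ⟨n - j, by omega⟩
      rw [map_sum, Finset.sum_eq_single j] at h1
      · have h2 : B (w ⟨n - j, by omega⟩) (w j) = (-1) ^ (n - (j : ℕ)) * B v ((x ^ n) v) := by
          simp only [w]
          rw [skew_pow hx, ← Module.End.mul_apply, ← pow_add,
            Nat.sub_add_cancel (Nat.lt_succ_iff.1 j.2)]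
        rw [map_smul, smul_eq_mul, h2] at h1
        exact (mul_eq_zero.1 h1).resolve_right
          (mul_ne_zero (pow_ne_zero _ (by norm_num)) hv')
      · intro k _ hk
        rcases lt_or_gt_of_ne (Fin.val_ne_of_ne hk) with hk | hk
        · rw [ih k hk k rfl, zero_smul, map_zero]
        · have h3 : (x ^ (n - (j : ℕ) + k)) v = 0 := by
            have : n - (j : ℕ) + k = (n - j + k - (n + 1)) + (n + 1) := by omega
            rw [this, pow_add, Module.End.mul_apply, hv, map_zero]
          simp only [w]
          rw [map_smul, skew_pow hx, ← Module.End.mul_apply, ← pow_add, h3]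
          simp
      · exact fun h => absurd (Finset.mem_univ _) h
  refine ⟨Submodule.span ℂ (Set.range w), ?_, ?_, ?_⟩
  · rw [LinearMap.BilinForm.isCompl_orthogonal_iff_disjoint hε.isRefl, Submodule.disjoint_def]
    intro u hu hu'
    obtain ⟨c, rfl⟩ := (Submodule.mem_span_range_iff_exists_fun ℂ).1 hu
    rw [key c (mem_orth_span.1 hu')]
    simp
  · rw [Submodule.span_le]
    rintro _ ⟨j, rfl⟩
    simp only [SetLike.mem_coe, Submodule.mem_comap, w]
    rw [← Module.End.mul_apply, ← pow_succ']
    by_cases hj : (j : ℕ) + 1 < n + 1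
    · exact Submodule.subset_span ⟨⟨j + 1, hj⟩, rfl⟩
    · have : (j : ℕ) + 1 = n + 1 := by omega
      rw [this, hv]
      exact zero_mem _
  · rw [finrank_span_eq_card, Fintype.card_fin]
    rw [Fintype.linearIndependent_iff]
    intro c hc
    refine congrFun (key c fun i => ?_)
    rw [hc, map_zero]

/-- In an orthogonal Lie algebra, a nilpotent element with a Jordan block of odd size is centralized
by an isometry of determinant `-1`. -/
theorem exists_det_neg_one (hB : B.Nondegenerate) (hS : B.IsSymm) {x : Module.End ℂ V}
    (hx : x ∈ classicalLie B) {d : Multiset ℕ} (hd : HasJordanType x d) {a : ℕ} (ha : a ∈ d)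
    (hodd : Odd a) :
    ∃ g : (Module.End ℂ V)ˣ, (∀ u v, B (g.1 u) (g.1 v) = B u v) ∧ g.1 * x = x * g.1 ∧
      LinearMap.det g.1 = -1 := by
  obtain ⟨ε, hε⟩ := exists_hasSign (Or.inl hS)
  obtain ⟨k, rfl⟩ := hodd
  suffices ∃ v, (x ^ (2 * k + 1)) v = 0 ∧ B v ((x ^ (2 * k)) v) ≠ 0 by
    obtain ⟨v, hv, hv'⟩ := this
    obtain ⟨U, h1, h2, h3⟩ := exists_nondegenerate_cyclic hε hx hv hv'
    obtain ⟨g, hg, hgx, hdet⟩ := exists_reflection hB hε hx h1 h2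
    refine ⟨g, hg, hgx, ?_⟩
    rw [hdet, h3]
    exact Odd.neg_one_pow ⟨k, rfl⟩
  by_contra! hcon
  have hpol : ∀ u w, (x ^ (2 * k + 1)) u = 0 → (x ^ (2 * k + 1)) w = 0 →
      B u ((x ^ (2 * k)) w) = 0 := by
    intro u w hu hw
    have h1 := hcon (u + w) (by rw [map_add, hu, hw, add_zero])
    have h2 : B w ((x ^ (2 * k)) u) = B u ((x ^ (2 * k)) w) := by
      have h3 := skew_pow hx (2 * k) u w
      rw [Even.neg_one_pow ⟨k, by ring⟩, one_mul] at h3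
      rw [← h3]
      exact (hS.eq _ _).symm
    simp only [map_add, LinearMap.add_apply, hcon u hu, hcon w hw, h2] at h1
    linear_combination h1 / 2
  obtain ⟨n, c, v, b, rfl, -, hb, hv⟩ := hd
  obtain ⟨i, -, hi⟩ := Multiset.mem_map.1 ha
  have h4 : b ⟨i, ⟨2 * k, by omega⟩⟩ ∈ LinearMap.range (x ^ (2 * k + 1)) := by
    rw [← orth_ker_pow hB hε hx, mem_orth, hb]
    exact fun u hu => hpol u _ hu (by rw [← hi, hv])
  rw [range_pow_eq_span hb hv] at h4
  exact b.linearIndependent.notMem_span_image (by simp) h4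

end InducedOrbit

namespace ClassicalVariety

open scoped Topology

/-! ### Polynomial maps -/

section

variable {W X Y Z : Type*} [AddCommGroup W] [Module ℂ W] [AddCommGroup X] [Module ℂ X]
  [AddCommGroup Y] [Module ℂ Y] [AddCommGroup Z] [Module ℂ Z]

/-- A map between complex vector spaces is polynomial if its composition with every linear form is a
polynomial function. -/
def IsPolyMap (Φ : W → X) : Prop := ∀ l : Module.Dual ℂ X, (fun w => l (Φ w)) ∈ polyFun W

theorem const_mem_polyFun (c : ℂ) : (fun _ : W => c) ∈ polyFun W :=
  Subalgebra.algebraMap_mem (polyFun W) c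

theorem dual_mem_polyFun (l : Module.Dual ℂ W) : (l : W → ℂ) ∈ polyFun W :=
  Algebra.subset_adjoin ⟨l, rfl⟩

theorem mul_mem_polyFun {f g : W → ℂ} (hf : f ∈ polyFun W) (hg : g ∈ polyFun W) :
    (fun w => f w * g w) ∈ polyFun W := mul_mem hf hg

theorem add_mem_polyFun {f g : W → ℂ} (hf : f ∈ polyFun W) (hg : g ∈ polyFun W) :
    (fun w => f w + g w) ∈ polyFun W := add_mem hf hg

theorem pow_mem_polyFun {f : W → ℂ} (hf : f ∈ polyFun W) (n : ℕ) :
    (fun w => f w ^ n) ∈ polyFun W := pow_mem hf n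

theorem sum_mem_polyFun {ι : Type*} {s : Finset ι} {f : ι → W → ℂ}
    (hf : ∀ i ∈ s, f i ∈ polyFun W) : (fun w => ∑ i ∈ s, f i w) ∈ polyFun W := by
  have := sum_mem hf
  convert this using 1
  funext w
  simp

theorem prod_mem_polyFun {ι : Type*} {s : Finset ι} {f : ι → W → ℂ}
    (hf : ∀ i ∈ s, f i ∈ polyFun W) : (fun w => ∏ i ∈ s, f i w) ∈ polyFun W := by
  have := prod_mem hf
  convert this using 1
  funext w
  simp

theorem IsPolyMap.comp_mem {Φ : W → X} (hΦ : IsPolyMap Φ) {f : X → ℂ} (hf : f ∈ polyFun X) :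
    (fun w => f (Φ w)) ∈ polyFun W := by
  induction hf using Algebra.adjoin_induction with
  | mem f hf => obtain ⟨l, rfl⟩ := hf; exact hΦ l
  | algebraMap r => exact const_mem_polyFun r
  | add f g _ _ hf hg => exact add_mem_polyFun hf hg
  | mul f g _ _ hf hg => exact mul_mem_polyFun hf hg

namespace IsPolyMap

theorem linear (L : W →ₗ[ℂ] X) : IsPolyMap (fun w => L w) := fun l => dual_mem_polyFun (l.comp L)

theorem const (c : X) : IsPolyMap (fun _ : W => c) := fun l => const_mem_polyFun (l c)

theorem add {Φ Ψ : W → X} (hΦ : IsPolyMap Φ) (hΨ : IsPolyMap Ψ) :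
    IsPolyMap (fun w => Φ w + Ψ w) := fun l => by
  simpa only [map_add] using add_mem_polyFun (hΦ l) (hΨ l)

theorem smul {f : W → ℂ} (hf : f ∈ polyFun W) {Φ : W → X} (hΦ : IsPolyMap Φ) :
    IsPolyMap (fun w => f w • Φ w) := fun l => by
  simpa only [map_smul, smul_eq_mul] using mul_mem_polyFun hf (hΦ l)

theorem sum {ι : Type*} {s : Finset ι} {Φ : ι → W → X} (hΦ : ∀ i ∈ s, IsPolyMap (Φ i)) :
    IsPolyMap (fun w => ∑ i ∈ s, Φ i w) := fun l => by
  simpa only [map_sum] using sum_mem_polyFun fun i hi => hΦ i hi l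

theorem comp_linear (L : X →ₗ[ℂ] Y) {Φ : W → X} (hΦ : IsPolyMap Φ) :
    IsPolyMap (fun w => L (Φ w)) := fun l => hΦ (l.comp L)

theorem bilinear [FiniteDimensional ℂ X] (β : X →ₗ[ℂ] Y →ₗ[ℂ] Z) {Φ : W → X} {Ψ : W → Y}
    (hΦ : IsPolyMap Φ) (hΨ : IsPolyMap Ψ) : IsPolyMap (fun w => β (Φ w) (Ψ w)) := by
  let b := Module.finBasis ℂ X
  have h : (fun w => β (Φ w) (Ψ w)) = fun w => ∑ i, (b.coord i) (Φ w) • β (b i) (Ψ w) := by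
    funext w
    conv_lhs => rw [← b.sum_repr (Φ w)]
    simp only [map_sum, map_smul, LinearMap.sum_apply, LinearMap.smul_apply,
      Module.Basis.coord_apply]
  rw [h]
  exact sum fun i _ => smul (hΦ _) (comp_linear _ hΨ)

theorem prodMk {Φ : W → X} {Ψ : W → Y} (hΦ : IsPolyMap Φ) (hΨ : IsPolyMap Ψ) :
    IsPolyMap (fun w => (Φ w, Ψ w)) := by
  have h : (fun w => (Φ w, Ψ w)) = fun w => LinearMap.inl ℂ X Y (Φ w) + LinearMap.inr ℂ X Y (Ψ w) :=
    by
      funext w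
      simp
  rw [h]
  exact add (comp_linear _ hΦ) (comp_linear _ hΨ)

theorem pi {n : ℕ} {Φ : Fin n → W → X} (hΦ : ∀ i, IsPolyMap (Φ i)) :
    IsPolyMap (fun w i => Φ i w) := by
  have h : (fun w i => Φ i w) =
      fun w => ∑ i, LinearMap.single ℂ (fun _ : Fin n => X) i (Φ i w) := by
    funext w i
    simp [Finset.sum_apply, Pi.single_apply]
  rw [h]
  exact sum fun i _ => comp_linear _ (hΦ i)

theorem mul [FiniteDimensional ℂ X] {Φ Ψ : W → Module.End ℂ X} (hΦ : IsPolyMap Φ)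
    (hΨ : IsPolyMap Ψ) : IsPolyMap (fun w => Φ w * Ψ w) :=
  bilinear (LinearMap.mul ℂ (Module.End ℂ X)) hΦ hΨ

theorem pow [FiniteDimensional ℂ X] {Φ : W → Module.End ℂ X} (hΦ : IsPolyMap Φ) (k : ℕ) :
    IsPolyMap (fun w => Φ w ^ k) := by
  induction k with
  | zero => simpa only [pow_zero] using const 1
  | succ k ih => simpa only [pow_succ] using mul ih hΦ

theorem apply [FiniteDimensional ℂ X] [FiniteDimensional ℂ Y] {Φ : W → X →ₗ[ℂ] Y} {s : W → X}
    (hΦ : IsPolyMap Φ) (hs : IsPolyMap s) : IsPolyMap (fun w => Φ w (s w)) :=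
  bilinear LinearMap.id hΦ hs

end IsPolyMap

theorem det_mem_polyFun {n : Type*} [Fintype n] [DecidableEq n] {M : W → Matrix n n ℂ}
    (hM : ∀ i j, (fun w => M w i j) ∈ polyFun W) : (fun w => (M w).det) ∈ polyFun W := by
  simp only [Matrix.det_apply']
  exact sum_mem_polyFun fun σ _ => mul_mem_polyFun (const_mem_polyFun _)
    (prod_mem_polyFun fun i _ => hM _ _)

theorem adjugate_mem_polyFun {n : Type*} [Fintype n] [DecidableEq n] {M : W → Matrix n n ℂ}
    (hM : ∀ i j, (fun w => M w i j) ∈ polyFun W) (i j : n) :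
    (fun w => (M w).adjugate i j) ∈ polyFun W := by
  simp only [Matrix.adjugate_apply]
  refine det_mem_polyFun fun k l => ?_
  simp only [Matrix.updateRow_apply]
  split_ifs
  · exact const_mem_polyFun _
  · exact hM k l

theorem toMatrix_mem_polyFun {n : Type*} [Fintype n] [DecidableEq n] (b : Module.Basis n ℂ X)
    {Φ : W → Module.End ℂ X} (hΦ : IsPolyMap Φ) (i j : n) :
    (fun w => LinearMap.toMatrix b b (Φ w) i j) ∈ polyFun W := by
  simp only [LinearMap.toMatrix_apply]
  exact hΦ ((b.coord i).comp (LinearMap.applyₗ (b j)))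

theorem IsPolyMap.det_mem [FiniteDimensional ℂ X] {Φ : W → Module.End ℂ X} (hΦ : IsPolyMap Φ) :
    (fun w => LinearMap.det (Φ w)) ∈ polyFun W := by
  simp only [← LinearMap.det_toMatrix (Module.finBasis ℂ X)]
  exact det_mem_polyFun (toMatrix_mem_polyFun _ hΦ)

/-- A polynomial function is a polynomial on every line. -/
theorem exists_polynomial_on_line {f : W → ℂ} (hf : f ∈ polyFun W) (a b : W) :
    ∃ p : Polynomial ℂ, ∀ t, f (a + t • b) = p.eval t := by
  induction hf using Algebra.adjoin_induction with
  | mem f hf =>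
    obtain ⟨l, rfl⟩ := hf
    exact ⟨Polynomial.C (l a) + Polynomial.C (l b) * Polynomial.X, fun t => by
      change l (a + t • b) = _
      rw [map_add, map_smul, smul_eq_mul, Polynomial.eval_add, Polynomial.eval_mul,
        Polynomial.eval_C, Polynomial.eval_C, Polynomial.eval_X, mul_comm]⟩
  | algebraMap r => exact ⟨Polynomial.C r, fun t => by simp⟩
  | add f g _ _ hf hg =>
    obtain ⟨p, hp⟩ := hf
    obtain ⟨q, hq⟩ := hg
    exact ⟨p + q, fun t => by simp [hp, hq]⟩
  | mul f g _ _ hf hg =>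
    obtain ⟨p, hp⟩ := hf
    obtain ⟨q, hq⟩ := hg
    exact ⟨p * q, fun t => by simp [hp, hq]⟩

/-- Two polynomial functions that do not vanish at two given points of a line have a common point of
the line where they do not vanish. -/
theorem exists_ne_zero_on_line {f g : W → ℂ} (hf : f ∈ polyFun W) (hg : g ∈ polyFun W) {a b : W}
    (ha : f a ≠ 0) (hb : g b ≠ 0) : ∃ t : ℂ, f (a + t • (b - a)) ≠ 0 ∧ g (a + t • (b - a)) ≠ 0 := by
  obtain ⟨p, hp⟩ := exists_polynomial_on_line hf a (b - a)
  obtain ⟨q, hq⟩ := exists_polynomial_on_line hg a (b - a)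
  have hp0 : p ≠ 0 := by
    rintro rfl
    have := hp 0
    simp [ha] at this
  have hq0 : q ≠ 0 := by
    rintro rfl
    have := hq 1
    simp [hb] at this
  obtain ⟨t, ht⟩ : ∃ t, (p * q).eval t ≠ 0 := by
    by_contra! h
    exact mul_ne_zero hp0 hq0 (Polynomial.funext fun t => by rw [h, Polynomial.eval_zero])
  rw [Polynomial.eval_mul] at ht
  exact ⟨t, by rw [hp]; exact left_ne_zero_of_mul ht, by rw [hq]; exact right_ne_zero_of_mul ht⟩

/-- Pulling back a polynomial function along a polynomial map divided by a polynomial function. -/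
theorem exists_pullback_div {p : X → ℂ} (hp : p ∈ polyFun X) {H : W → X} (hH : IsPolyMap H)
    {δ : W → ℂ} (hδ : δ ∈ polyFun W) :
    ∃ P ∈ polyFun W, ∃ N : ℕ, ∀ w, δ w ≠ 0 → p ((δ w)⁻¹ • H w) = P w / δ w ^ N := by
  induction hp using Algebra.adjoin_induction with
  | mem f hf =>
    obtain ⟨l, rfl⟩ := hf
    exact ⟨_, hH l, 1, fun w _ => by
      rw [pow_one, div_eq_inv_mul]
      exact map_smul l _ _⟩
  | algebraMap r => exact ⟨_, const_mem_polyFun r, 0, fun w _ => by simp⟩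
  | add f g _ _ hf hg =>
    obtain ⟨P, hP, N, h⟩ := hf
    obtain ⟨P', hP', N', h'⟩ := hg
    refine ⟨_, add_mem_polyFun (mul_mem_polyFun hP (pow_mem_polyFun hδ N'))
      (mul_mem_polyFun (pow_mem_polyFun hδ N) hP'), N + N', fun w hw => ?_⟩
    rw [Pi.add_apply, h w hw, h' w hw, div_add_div _ _ (pow_ne_zero _ hw) (pow_ne_zero _ hw),
      pow_add]
  | mul f g _ _ hf hg =>
    obtain ⟨P, hP, N, h⟩ := hf
    obtain ⟨P', hP', N', h'⟩ := hg
    refine ⟨_, mul_mem_polyFun hP hP', N + N', fun w hw => ?_⟩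
    rw [Pi.mul_apply, h w hw, h' w hw, div_mul_div_comm, pow_add]

/-! ### The Zariski topology -/

theorem isOpen_zariski_iff {T : Set W} : IsOpen[zariski W] T ↔
    ∀ w ∈ T, ∃ f ∈ polyFun W, f w ≠ 0 ∧ ∀ x, f x ≠ 0 → x ∈ T := by
  let _ := zariski W
  rw [(zariski_basis W).isOpen_iff]
  constructor
  · intro h w hw
    obtain ⟨_, ⟨f, hf, rfl⟩, h1, h2⟩ := h w hw
    exact ⟨f, hf, h1, fun x hx => h2 hx⟩
  · intro h w hw
    obtain ⟨f, hf, h1, h2⟩ := h w hw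
    exact ⟨_, ⟨f, hf, rfl⟩, h1, fun x hx => h2 x hx⟩

theorem mem_zariskiClosure {S : Set W} {w : W} : w ∈ zariskiClosure S ↔
    ∀ f ∈ polyFun W, f w ≠ 0 → ∃ s ∈ S, f s ≠ 0 := by
  let _ := zariski W
  change w ∈ closure S ↔ _
  rw [(zariski_basis W).mem_closure_iff]
  constructor
  · intro h f hf hw
    obtain ⟨s, hs, hsS⟩ := h _ ⟨f, hf, rfl⟩ hw
    exact ⟨s, hsS, hs⟩
  · rintro h _ ⟨f, hf, rfl⟩ hw
    obtain ⟨s, hsS, hs⟩ := h f hf hw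
    exact ⟨s, hs, hsS⟩

theorem subset_zariskiClosure (S : Set W) : S ⊆ zariskiClosure S :=
  let _ := zariski W
  subset_closure

theorem IsPolyMap.isOpen_preimage {Φ : W → X} (hΦ : IsPolyMap Φ) {T : Set X}
    (hT : IsOpen[zariski X] T) : IsOpen[zariski W] (Φ ⁻¹' T) := by
  rw [isOpen_zariski_iff] at hT ⊢
  intro w hw
  obtain ⟨f, hf, h1, h2⟩ := hT _ hw
  exact ⟨_, hΦ.comp_mem hf, h1, fun x hx => h2 _ hx⟩

/-- A linear equation that holds on a set holds on its Zariski closure. -/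
theorem linear_eq_zero_of_mem_zariskiClosure {S : Set W} (L : W →ₗ[ℂ] X) (h : ∀ s ∈ S, L s = 0)
    {w : W} (hw : w ∈ zariskiClosure S) : L w = 0 := by
  by_contra hne
  obtain ⟨l, hl⟩ : ∃ l : Module.Dual ℂ X, l (L w) ≠ 0 := by
    by_contra! hcon
    exact hne ((Module.forall_dual_apply_eq_zero_iff ℂ _).1 hcon)
  obtain ⟨s, hs, hs'⟩ := mem_zariskiClosure.1 hw _ (dual_mem_polyFun (l.comp L)) hl
  exact hs' (by rw [LinearMap.comp_apply, h s hs, map_zero])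

theorem mem_submodule_of_mem_zariskiClosure {S : Set W} (N : Submodule ℂ W) (h : S ⊆ N) {w : W}
    (hw : w ∈ zariskiClosure S) : w ∈ N :=
  (Submodule.Quotient.mk_eq_zero N).1 (linear_eq_zero_of_mem_zariskiClosure N.mkQ
    (fun _ hs => (Submodule.Quotient.mk_eq_zero N).2 (h hs)) hw)

/-! ### Semicontinuity of the rank and sections of kernels -/

theorem exists_rank_le [FiniteDimensional ℂ X] [FiniteDimensional ℂ Y] {A : W → X →ₗ[ℂ] Y}
    (hA : IsPolyMap A) (w₀ : W) : ∃ δ ∈ polyFun W, δ w₀ ≠ 0 ∧ ∀ w, δ w ≠ 0 →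
      Module.finrank ℂ (LinearMap.range (A w₀)) ≤ Module.finrank ℂ (LinearMap.range (A w)) := by
  let R := LinearMap.range (A w₀)
  obtain ⟨s, hs⟩ := (A w₀).rangeRestrict.exists_rightInverse_of_surjective
    (LinearMap.range_rangeRestrict _)
  obtain ⟨p, hp⟩ := (LinearMap.id : R →ₗ[ℂ] R).exists_extend
  have hAs : ∀ x, A w₀ (s x) = x := fun x => congrArg Subtype.val (LinearMap.congr_fun hs x)
  have hid : (p ∘ₗ A w₀ ∘ₗ s : Module.End ℂ R) = LinearMap.id := by
    refine LinearMap.ext fun x => ?_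
    rw [LinearMap.comp_apply, LinearMap.comp_apply, hAs]
    exact LinearMap.congr_fun hp x
  have hpoly : IsPolyMap (fun w => (p ∘ₗ A w ∘ₗ s : Module.End ℂ R)) :=
    IsPolyMap.comp_linear ((LinearMap.llcomp ℂ R Y R p) ∘ₗ (LinearMap.lcomp ℂ Y s)) hA
  refine ⟨_, hpoly.det_mem, by simp only [hid, LinearMap.det_id]; exact one_ne_zero,
    fun w hw => ?_⟩
  have hinj : Function.Injective (A w ∘ₗ s) := by
    have h1 : Function.Injective (p ∘ₗ A w ∘ₗ s : Module.End ℂ R) :=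
      (LinearMap.equivOfDetNeZero _ hw).injective
    exact fun a b hab => h1 (congrArg p hab)
  rw [← LinearMap.finrank_range_of_inj hinj]
  exact Submodule.finrank_mono (LinearMap.range_comp_le_range _ _)

theorem finrank_range_le_of_mem_zariskiClosure [FiniteDimensional ℂ X] [FiniteDimensional ℂ Y]
    {A : W → X →ₗ[ℂ] Y} (hA : IsPolyMap A) {S : Set W} {ρ : ℕ}
    (h : ∀ s ∈ S, Module.finrank ℂ (LinearMap.range (A s)) ≤ ρ) {w : W}
    (hw : w ∈ zariskiClosure S) : Module.finrank ℂ (LinearMap.range (A w)) ≤ ρ := by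
  obtain ⟨δ, hδ, h0, h1⟩ := exists_rank_le hA w
  obtain ⟨s, hs, hs'⟩ := mem_zariskiClosure.1 hw δ hδ h0
  exact (h1 s hs').trans (h s hs)

/-- In a polynomial family of endomorphisms, a vector in the kernel of one member extends to a
polynomial family of vectors in the kernels of the members nearby of the same rank, up to
a nonvanishing factor: it is `(A w + T)⁻¹ (T v)`, where `T` maps the kernel of `A w₀`
isomorphically onto a complement of the range. -/
theorem exists_kernel_section [FiniteDimensional ℂ X] {A : W → Module.End ℂ X}
    (hA : IsPolyMap A) (w₀ : W) {v : X} (hv : A w₀ v = 0) :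
    ∃ s : W → X, IsPolyMap s ∧ ∃ δ ∈ polyFun W, δ w₀ ≠ 0 ∧ s w₀ = δ w₀ • v ∧
      ∀ w, δ w ≠ 0 → Module.finrank ℂ (LinearMap.range (A w)) ≤
        Module.finrank ℂ (LinearMap.range (A w₀)) → A w (s w) = 0 := by
  classical
  let K := LinearMap.ker (A w₀)
  obtain ⟨K', hK'⟩ := K.exists_isCompl
  obtain ⟨C, hC⟩ := (LinearMap.range (A w₀)).exists_isCompl
  have hKC : Module.finrank ℂ K = Module.finrank ℂ C := by
    have h1 := (A w₀).finrank_range_add_finrank_ker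
    have h2 := Submodule.finrank_add_eq_of_isCompl hC
    change _ + Module.finrank ℂ K = _ at h1
    omega
  let e := LinearEquiv.ofFinrankEq K C hKC
  let T : Module.End ℂ X := LinearMap.ofIsCompl hK' (C.subtype ∘ₗ e.toLinearMap) 0
  have hTK : ∀ k : K, T k = e k := fun k => LinearMap.ofIsCompl_apply_left hK' k
  have hTC : ∀ x, T x ∈ C := by
    intro x
    obtain ⟨a, ha, b, hb, rfl⟩ := Submodule.mem_sup.1 (hK'.sup_eq_top ▸ Submodule.mem_top :
      x ∈ K ⊔ K')
    have h1 : T b = 0 := LinearMap.ofIsCompl_apply_right hK' ⟨b, hb⟩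
    rw [map_add, h1, add_zero, hTK ⟨a, ha⟩]
    exact (e ⟨a, ha⟩).2
  let S : W → Module.End ℂ X := fun w => A w + T
  have hS : IsPolyMap S := hA.add (IsPolyMap.const T)
  let b := Module.finBasis ℂ X
  let adj : W → Module.End ℂ X := fun w =>
    Matrix.toLin b b (LinearMap.toMatrix b b (S w)).adjugate
  have hadj : IsPolyMap adj := by
    have h1 : adj = fun w => ∑ i, ∑ j, (LinearMap.toMatrix b b (S w)).adjugate i j •
        Matrix.toLin b b (Matrix.single i j 1) := by
      funext w
      change Matrix.toLin b b _ = _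
      conv_lhs => rw [Matrix.matrix_eq_sum_single (LinearMap.toMatrix b b (S w)).adjugate]
      simp only [map_sum, ← map_smul, Matrix.smul_single, smul_eq_mul, mul_one]
    rw [h1]
    exact IsPolyMap.sum fun i _ => IsPolyMap.sum fun j _ => IsPolyMap.smul
      (adjugate_mem_polyFun (toMatrix_mem_polyFun b hS) i j) (IsPolyMap.const _)
  have hadj1 : ∀ w, adj w * S w = LinearMap.det (S w) • 1 := by
    intro w
    apply (LinearMap.toMatrix b b).injective
    rw [LinearMap.toMatrix_mul, LinearMap.toMatrix_toLin, Matrix.adjugate_mul,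
      LinearMap.det_toMatrix, map_smul, LinearMap.toMatrix_one]
  have hadj2 : ∀ w, S w * adj w = LinearMap.det (S w) • 1 := by
    intro w
    apply (LinearMap.toMatrix b b).injective
    rw [LinearMap.toMatrix_mul, LinearMap.toMatrix_toLin, Matrix.mul_adjugate,
      LinearMap.det_toMatrix, map_smul, LinearMap.toMatrix_one]
  have hS0 : LinearMap.det (S w₀) ≠ 0 := by
    intro h
    refine (LinearMap.bot_lt_ker_of_det_eq_zero h).ne' ((Submodule.eq_bot_iff _).2 fun x hx => ?_)
    have h1 : A w₀ x + T x = 0 := hx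
    have h2 : T x = 0 := Submodule.disjoint_def.1 hC.disjoint _
      (by rw [← neg_eq_of_add_eq_zero_right h1]; exact neg_mem ⟨x, rfl⟩) (hTC x)
    rw [h2, add_zero] at h1
    have h3 : e ⟨x, h1⟩ = 0 := Subtype.ext ((hTK ⟨x, h1⟩).symm.trans h2)
    exact congrArg Subtype.val (e.map_eq_zero_iff.1 h3)
  refine ⟨fun w => adj w (T v), hadj.apply (IsPolyMap.const _), fun w => LinearMap.det (S w),
    hS.det_mem, hS0, ?_, fun w hw hrank => ?_⟩
  · have h1 : T v = S w₀ v := by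
      change _ = A w₀ v + T v
      rw [hv, zero_add]
    change adj w₀ (T v) = LinearMap.det (S w₀) • v
    rw [h1, ← Module.End.mul_apply, hadj1]
    rfl
  · have hinj : Function.Injective (S w) := (LinearMap.equivOfDetNeZero _ hw).injective
    -- `T` restricts to an isomorphism from the kernel of `A w` onto `C`
    let τ : LinearMap.ker (A w) →ₗ[ℂ] C :=
      (T.comp (LinearMap.ker (A w)).subtype).codRestrict C fun k => hTC k
    have hτ : ∀ k, (τ k : X) = S w k := fun k => by
      change T k = A w k + T k
      rw [LinearMap.mem_ker.1 k.2, zero_add]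
    have hτinj : Function.Injective τ := fun k l hkl => Subtype.ext (hinj (by
      rw [← hτ, ← hτ, hkl]))
    have hdim : Module.finrank ℂ (LinearMap.ker (A w)) = Module.finrank ℂ C := by
      refine le_antisymm (LinearMap.finrank_le_finrank_of_injective hτinj) ?_
      rw [← hKC]
      have h1 := (A w₀).finrank_range_add_finrank_ker
      have h2 := (A w).finrank_range_add_finrank_ker
      change Module.finrank ℂ (LinearMap.ker (A w₀)) ≤ _
      omega
    obtain ⟨k, hk⟩ := (LinearMap.injective_iff_surjective_of_finrank_eq_finrank hdim).1 hτinj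
      (LinearMap.det (S w) • ⟨T v, hTC v⟩)
    have h1 : S w (adj w (T v)) = S w k := by
      rw [← hτ, hk, ← Module.End.mul_apply, hadj2]
      rfl
    change A w (adj w (T v)) = 0
    rw [hinj h1]
    exact k.2

end

end ClassicalVariety

namespace InducedOrbit

open ClassicalVariety

variable {V : Type*} [AddCommGroup V] [Module ℂ V] {B : LinearMap.BilinForm ℂ V} {ε : ℂ}

/-! ### The isotropic subspace attached to a gap -/

/-- The subspace `ker z ∩ im z ^ (c + 1)`, spanned by the ends of the Jordan chains of length at
least `c + 2`. -/
def kernelRange (z : Module.End ℂ V) (c : ℕ) : Submodule ℂ V :=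
  LinearMap.ker z ⊓ LinearMap.range (z ^ (c + 1))

theorem range_pow_add (z : Module.End ℂ V) (j k : ℕ) :
    LinearMap.range (z ^ (j + k)) = (LinearMap.range (z ^ k)).map (z ^ j) := by
  rw [pow_add, Module.End.mul_eq_comp, LinearMap.range_comp]

theorem range_pow_anti (z : Module.End ℂ V) {j k : ℕ} (h : j ≤ k) :
    LinearMap.range (z ^ k) ≤ LinearMap.range (z ^ j) := by
  obtain ⟨i, rfl⟩ := Nat.exists_eq_add_of_le h
  rintro _ ⟨u, rfl⟩
  exact ⟨(z ^ i) u, by rw [pow_add, Module.End.mul_apply]⟩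

theorem kernelRange_isotropic {z : Module.End ℂ V} (hz : z ∈ classicalLie B) (c : ℕ) :
    kernelRange z c ≤ B.orthogonal (kernelRange z c) := by
  rintro v ⟨hv, -⟩
  rw [mem_orth]
  rintro _ ⟨-, u, rfl⟩
  have h : (z ^ (c + 1)) v = 0 := by
    rw [pow_succ, Module.End.mul_apply, LinearMap.mem_ker.1 hv, map_zero]
  rw [skew_pow hz, h, map_zero, mul_zero]

/-- An endomorphism of the Lie algebra that vanishes on `F` has its range in `F^⊥`. -/
theorem apply_mem_orth {z : Module.End ℂ V} (hz : z ∈ classicalLie B) {F : Submodule ℂ V}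
    (hF : ∀ v ∈ F, z v = 0) (v : V) : z v ∈ B.orthogonal F := by
  rw [mem_orth]
  intro n hn
  rw [← neg_eq_iff_eq_neg.2 (mem_classicalLie.1 hz n v), hF n hn, map_zero, LinearMap.zero_apply,
    neg_zero]

theorem kernelRange_conj (g : (Module.End ℂ V)ˣ) (z : Module.End ℂ V) (c : ℕ) :
    kernelRange (Ad g z) c = (kernelRange z c).map g.1 := by
  have hgi : ∀ v, g.1 (g⁻¹.1 v) = v := fun v => by
    rw [← Module.End.mul_apply, Units.mul_inv, Module.End.one_apply]
  have hig : ∀ v, g⁻¹.1 (g.1 v) = v := fun v => by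
    rw [← Module.End.mul_apply, Units.inv_mul, Module.End.one_apply]
  have hpow : (Ad g z) ^ (c + 1) = g.1 * z ^ (c + 1) * g⁻¹.1 := g.conj_pow z (c + 1)
  ext v
  constructor
  · rintro ⟨h1, u, hu⟩
    rw [hpow] at hu
    refine ⟨g⁻¹.1 v, ⟨?_, g⁻¹.1 u, ?_⟩, hgi v⟩
    · have h1 : g.1 (z (g⁻¹.1 v)) = 0 := h1
      change z (g⁻¹.1 v) = 0
      rw [← hig (z _), h1, map_zero]
    · rw [← hu]
      exact (hig _).symm
  · rintro ⟨w, ⟨h1, u, rfl⟩, rfl⟩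
    refine ⟨?_, g.1 u, ?_⟩
    · change g.1 (z (g⁻¹.1 (g.1 _))) = 0
      rw [hig, LinearMap.mem_ker.1 h1, map_zero]
    · rw [hpow]
      change g.1 ((z ^ (c + 1)) (g⁻¹.1 (g.1 u))) = _
      rw [hig]

section

variable [FiniteDimensional ℂ V]

theorem finrank_map_add (f : Module.End ℂ V) (N : Submodule ℂ V) :
    Module.finrank ℂ (N.map f) + Module.finrank ℂ (LinearMap.ker f ⊓ N : Submodule ℂ V) =
      Module.finrank ℂ N := by
  rw [← LinearMap.finrank_range_add_finrank_ker (f.domRestrict N), LinearMap.range_domRestrict,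
    LinearMap.ker_domRestrict, ← Submodule.finrank_map_subtype_eq N, Submodule.map_comap_subtype,
    inf_comm]

theorem finrank_range_le_map_add (f : Module.End ℂ V) (N : Submodule ℂ V) :
    Module.finrank ℂ (LinearMap.range f) + Module.finrank ℂ N ≤
      Module.finrank ℂ (N.map f) + Module.finrank ℂ V := by
  have h1 := finrank_map_add f N
  have h2 := f.finrank_range_add_finrank_ker
  have h3 : Module.finrank ℂ (LinearMap.ker f ⊓ N : Submodule ℂ V) ≤
    Module.finrank ℂ (LinearMap.ker f) := Submodule.finrank_mono inf_le_left
  omega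

theorem finrank_ker_inf_range_pow (z : Module.End ℂ V) (k : ℕ) :
    Module.finrank ℂ (LinearMap.range (z ^ (k + 1))) +
      Module.finrank ℂ (LinearMap.ker z ⊓ LinearMap.range (z ^ k) : Submodule ℂ V) =
      Module.finrank ℂ (LinearMap.range (z ^ k)) := by
  rw [← finrank_map_add z (LinearMap.range (z ^ k)), add_comm k 1, range_pow_add, pow_one]

theorem finrank_kernelRange {z : Module.End ℂ V} {d : Multiset ℕ} (hz : HasJordanType z d)
    (c : ℕ) : Module.finrank ℂ (kernelRange z c) = numLargeParts d (c + 2) := by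
  have h1 := finrank_ker_inf_range_pow z (c + 1)
  have h2 : _ + numLargeParts d (c + 2) = _ := numLargeParts_add d (c + 1)
  rw [hz.finrank_range_pow, hz.finrank_range_pow] at h1
  change _ + Module.finrank ℂ (kernelRange z c) = _ at h1
  omega

theorem orth_kernelRange (hB : B.Nondegenerate) (hε : HasSign B ε) {z : Module.End ℂ V}
    (hz : z ∈ classicalLie B) (c : ℕ) :
    B.orthogonal (kernelRange z c) = LinearMap.range z ⊔ LinearMap.ker (z ^ (c + 1)) := by
  rw [← orth_orth hB hε (LinearMap.range z ⊔ LinearMap.ker (z ^ (c + 1)))]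
  congr 1
  have h1 : LinearMap.ker z = B.orthogonal (LinearMap.range z) := by
    simpa using ker_pow_eq_orth hB hz 1
  rw [kernelRange, h1, ← orth_ker_pow hB hε hz]
  refine le_antisymm ?_ (le_inf (orth_anti le_sup_left) (orth_anti le_sup_right))
  rintro v ⟨hv, hv'⟩
  rw [mem_orth]
  intro n hn
  obtain ⟨a, ha, b, hb, rfl⟩ := Submodule.mem_sup.1 hn
  rw [map_add, LinearMap.add_apply, mem_orth.1 hv a ha, mem_orth.1 hv' b hb, add_zero]

theorem map_pow_orth_kernelRange_of_ge (hB : B.Nondegenerate) (hε : HasSign B ε)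
    {z : Module.End ℂ V} (hz : z ∈ classicalLie B) {d : Multiset ℕ} (hzd : HasJordanType z d)
    {c k : ℕ} (hd : ∀ a ∈ d, a < c + 2 → a ≤ c) (hk : c ≤ k) :
    (B.orthogonal (kernelRange z c)).map (z ^ k) = LinearMap.range (z ^ (k + 1)) := by
  -- a difference between these spaces would come from blocks of size `c + 1`
  have hgap : LinearMap.ker z ⊓ LinearMap.range (z ^ c) = kernelRange z c := by
    symm
    refine Submodule.eq_of_le_of_finrank_eq (inf_le_inf_left _ (range_pow_anti z c.le_succ)) ?_
    have h1 := finrank_ker_inf_range_pow z c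
    have h2 := finrank_ker_inf_range_pow z (c + 1)
    have h3 := rankPow_gap hd
    rw [hzd.finrank_range_pow, hzd.finrank_range_pow] at h1 h2
    change rankPow d (c + 2) + Module.finrank ℂ (kernelRange z c) = _ at h2
    omega
  rw [orth_kernelRange hB hε hz, Submodule.map_sup, range_pow_add, pow_one, sup_eq_left]
  rintro _ ⟨u, hu, rfl⟩
  have h1 : (z ^ c) u ∈ kernelRange z c := by
    rw [← hgap]
    refine ⟨?_, u, rfl⟩
    change z ((z ^ c) u) = 0
    rw [← Module.End.mul_apply, ← pow_succ']
    exact hu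
  obtain ⟨w, hw⟩ := h1.2
  refine ⟨z w, ⟨w, rfl⟩, ?_⟩
  obtain ⟨i, rfl⟩ := Nat.exists_eq_add_of_le hk
  rw [add_comm c i, pow_add, Module.End.mul_apply, Module.End.mul_apply, ← hw, pow_succ,
    Module.End.mul_apply]

/-- The dimensions that determine the Jordan type of `z` on `F^⊥ / F` for `F = ker z ∩ im z^(c+1)`,
where `c + 2` is the large side of a gap. -/
theorem finrank_map_pow_orth_kernelRange (hB : B.Nondegenerate) (hε : HasSign B ε)
    {z : Module.End ℂ V} (hz : z ∈ classicalLie B) {d : Multiset ℕ} (hzd : HasJordanType z d)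
    {c : ℕ} (hd : ∀ a ∈ d, a < c + 2 → a ≤ c) (k : ℕ) :
    Module.finrank ℂ ((B.orthogonal (kernelRange z c)).map (z ^ k) ⊔ kernelRange z c :
      Submodule ℂ V) = numLargeParts d (c + 2) + rankPow (shrink d (c + 2)) k := by
  have hr := finrank_kernelRange hzd c
  rcases le_total k c with hk | hk
  -- for `k ≤ c`, the orthogonal contains the kernel of `z ^ k`, and its image contains `F`
  · have h1 : kernelRange z c ≤ (B.orthogonal (kernelRange z c)).map (z ^ k) := by
      rintro v ⟨-, u, rfl⟩
      refine ⟨(z ^ (c + 1 - k)) u, ?_, ?_⟩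
      · rw [orth_kernelRange hB hε hz]
        obtain ⟨i, rfl⟩ := Nat.exists_eq_add_of_le hk
        refine Submodule.mem_sup_left ⟨(z ^ i) u, ?_⟩
        rw [← Module.End.mul_apply, ← pow_succ']
        congr 2
        omega
      · rw [← Module.End.mul_apply, ← pow_add]
        congr 2
        omega
    have h2 : LinearMap.ker (z ^ k) ≤ B.orthogonal (kernelRange z c) := by
      rw [orth_kernelRange hB hε hz]
      refine le_trans ?_ le_sup_right
      intro v hv
      obtain ⟨i, hi⟩ := Nat.exists_eq_add_of_le' (hk.trans c.le_succ)
      rw [LinearMap.mem_ker, Nat.succ_eq_add_one] at *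
      rw [hi, pow_add, Module.End.mul_apply, hv, map_zero]
    rw [sup_eq_left.2 h1]
    have h3 := finrank_map_add (z ^ k) (B.orthogonal (kernelRange z c))
    rw [inf_eq_left.2 h2] at h3
    have h4 := finrank_orth hB (kernelRange z c)
    have h5 := (z ^ k).finrank_range_add_finrank_ker
    rw [hzd.finrank_range_pow] at h5
    have h6 := rankPow_shrink_of_le d hk
    omega
  -- for `k ≥ c`, the image of the orthogonal is the range of `z ^ (k + 1)`
  · rw [map_pow_orth_kernelRange_of_ge hB hε hz hzd hd hk, rankPow_shrink_of_ge hd hk]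
    have h1 := Submodule.finrank_sup_add_finrank_inf_eq (LinearMap.range (z ^ (k + 1)))
      (kernelRange z c)
    have h2 : LinearMap.range (z ^ (k + 1)) ⊓ kernelRange z c =
        LinearMap.ker z ⊓ LinearMap.range (z ^ (k + 1)) := by
      rw [kernelRange, inf_left_comm, inf_eq_left.2 (range_pow_anti z (Nat.succ_le_succ hk))]
    have h3 := finrank_ker_inf_range_pow z (k + 1)
    rw [h2] at h1
    rw [hzd.finrank_range_pow] at h1 h3
    rw [hzd.finrank_range_pow] at h3
    change rankPow d (k + 2) + _ = _ at h3
    omega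

/-- A subspace `F` killed by `z` such that `z ^ c` has small rank on `F^⊥ / F` is
`ker z ∩ im z ^ (c + 1)`: the rank condition forces `F` into the image of `z ^ (c + 1)`. -/
theorem eq_kernelRange {z : Module.End ℂ V} (hz : z ∈ classicalLie B) {d : Multiset ℕ}
    (hzd : HasJordanType z d) {c : ℕ} (hd : ∀ a ∈ d, a < c + 2 → a ≤ c) {F : Submodule ℂ V}
    (hFz : ∀ v ∈ F, z v = 0) (hF : Module.finrank ℂ F = numLargeParts d (c + 2))
    (hrank : Module.finrank ℂ ((B.orthogonal F).map (z ^ c) ⊔ F : Submodule ℂ V) ≤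
      numLargeParts d (c + 2) + rankPow (shrink d (c + 2)) c) : F = kernelRange z c := by
  have h1 : LinearMap.range (z ^ (c + 1)) ≤ (B.orthogonal F).map (z ^ c) ⊔ F := by
    refine le_trans ?_ le_sup_left
    rw [range_pow_add, pow_one]
    refine Submodule.map_mono ?_
    rintro _ ⟨u, rfl⟩
    exact apply_mem_orth hz hFz u
  have h2 : LinearMap.range (z ^ (c + 1)) = (B.orthogonal F).map (z ^ c) ⊔ F := by
    refine Submodule.eq_of_le_of_finrank_le h1 ?_
    have h3 : rankPow d (c + 2) + numLargeParts d (c + 2) = _ := numLargeParts_add d (c + 1)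
    rw [rankPow_shrink_of_ge hd le_rfl] at hrank
    rw [hzd.finrank_range_pow]
    omega
  refine Submodule.eq_of_le_of_finrank_eq (le_inf (fun v hv => hFz v hv) ?_) ?_
  · rw [h2]
    exact le_sup_right
  · rw [hF, finrank_kernelRange hzd]

/-! ### The Jordan type of the subquotient -/

theorem finrank_range_pow_subquotient {z : Module.End ℂ V} {F M : Submodule ℂ V} (hFM : F ≤ M)
    {y : Module.End ℂ (M ⧸ F.comap M.subtype)}
    (hy : ∀ v : M, ∃ hv : z v ∈ M, y (Submodule.Quotient.mk v) = Submodule.Quotient.mk ⟨z v, hv⟩)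
    (k : ℕ) : Module.finrank ℂ F + Module.finrank ℂ (LinearMap.range (y ^ k)) =
      Module.finrank ℂ (M.map (z ^ k) ⊔ F : Submodule ℂ V) := by
  let F₁ := F.comap M.subtype
  have hyk : ∀ v : M, ∃ hv : (z ^ k) v ∈ M,
      (y ^ k) (Submodule.Quotient.mk v) = Submodule.Quotient.mk ⟨(z ^ k) v, hv⟩ := by
    induction k with
    | zero => exact fun v => ⟨v.2, rfl⟩
    | succ k ih =>
      intro v
      obtain ⟨h1, h2⟩ := ih v
      obtain ⟨h3, h4⟩ := hy ⟨_, h1⟩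
      refine ⟨?_, ?_⟩
      · rw [pow_succ', Module.End.mul_apply]
        exact h3
      · rw [pow_succ', Module.End.mul_apply, h2, h4]
        refine congrArg _ (Subtype.ext ?_)
        change z ((z ^ k) v) = (z ^ (k + 1)) v
        rw [pow_succ', Module.End.mul_apply]
  have hle : M.map (z ^ k) ⊔ F ≤ M := by
    rw [sup_le_iff]
    refine ⟨?_, hFM⟩
    rintro _ ⟨v, hv, rfl⟩
    exact (hyk ⟨v, hv⟩).1
  set N := (M.map (z ^ k) ⊔ F).comap M.subtype with hN
  have hNF : F₁ ≤ N := Submodule.comap_mono le_sup_right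
  have hNfin : Module.finrank ℂ N = Module.finrank ℂ (M.map (z ^ k) ⊔ F : Submodule ℂ V) := by
    rw [← Submodule.finrank_map_subtype_eq M, hN, Submodule.map_comap_subtype,
      inf_eq_right.2 hle]
  have hFfin : Module.finrank ℂ F₁ = Module.finrank ℂ F := by
    rw [← Submodule.finrank_map_subtype_eq M, Submodule.map_comap_subtype,
      inf_eq_right.2 hFM]
  have hrange : LinearMap.range (y ^ k) = N.map F₁.mkQ := by
    ext w
    constructor
    · rintro ⟨v, rfl⟩
      obtain ⟨v, rfl⟩ := F₁.mkQ_surjective v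
      obtain ⟨h1, h2⟩ := hyk v
      rw [Submodule.mkQ_apply, h2]
      exact ⟨⟨_, h1⟩, Submodule.mem_sup_left ⟨v, v.2, rfl⟩, rfl⟩
    · rintro ⟨v, hv, rfl⟩
      obtain ⟨_, ⟨u, hu, rfl⟩, f, hf, h⟩ := Submodule.mem_sup.1 hv
      obtain ⟨h1, h2⟩ := hyk ⟨u, hu⟩
      refine ⟨Submodule.Quotient.mk ⟨u, hu⟩, ?_⟩
      rw [h2, Submodule.mkQ_apply, Submodule.Quotient.eq]
      change (z ^ k) u - (v : V) ∈ F
      have h : (z ^ k) u + f = (v : V) := h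
      rw [← h, sub_add_cancel_left]
      exact neg_mem hf
  have h1 := LinearMap.finrank_range_add_finrank_ker (F₁.mkQ.domRestrict N)
  rw [LinearMap.range_domRestrict, LinearMap.ker_domRestrict, Submodule.ker_mkQ, ← hrange,
    ← Submodule.finrank_map_subtype_eq N (F₁.comap N.subtype), Submodule.map_comap_subtype,
    inf_eq_right.2 hNF] at h1
  change Module.finrank ℂ (LinearMap.range (y ^ k)) + _ = _ at h1
  omega

/-- The Jordan type of `z` on `F^⊥ / F` in terms of dimensions of subspaces of `V`. -/
theorem hasSubquotientType_iff {z : Module.End ℂ V} (hz : z ∈ classicalLie B)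
    {F : Submodule ℂ V} (hF : F ≤ B.orthogonal F) {d : Multiset ℕ} (hd : ∀ a ∈ d, 0 < a) :
    HasSubquotientType B z F d ↔ (∀ v ∈ F, z v = 0) ∧ ∀ k,
      Module.finrank ℂ ((B.orthogonal F).map (z ^ k) ⊔ F : Submodule ℂ V) =
        Module.finrank ℂ F + rankPow d k := by
  constructor
  · rintro ⟨h0, y, hy, hyd⟩
    refine ⟨h0, fun k => ?_⟩
    rw [← finrank_range_pow_subquotient hF hy, hyd.finrank_range_pow]
  · rintro ⟨h0, h⟩
    have hmem : ∀ v, z v ∈ B.orthogonal F := apply_mem_orth hz h0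
    let z' : Module.End ℂ (B.orthogonal F) := z.restrict fun v _ => hmem v
    let y := (F.comap (B.orthogonal F).subtype).mapQ (F.comap (B.orthogonal F).subtype) z'
      fun v hv => by
        change z v ∈ F
        rw [h0 v hv]
        exact zero_mem _
    have hy : ∀ v : B.orthogonal F, ∃ hv : z v ∈ B.orthogonal F,
      y (Submodule.Quotient.mk v) = Submodule.Quotient.mk ⟨z v, hv⟩ := fun v => ⟨hmem v, rfl⟩
    refine ⟨h0, y, hy, hasJordanType_of_finrank hd fun k => ?_⟩
    have := finrank_range_pow_subquotient hF hy k
    rw [h] at this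
    omega

theorem hasSubquotientType_kernelRange (hB : B.Nondegenerate) (hε : HasSign B ε)
    {z : Module.End ℂ V} (hz : z ∈ classicalLie B) {d : Multiset ℕ} (hzd : HasJordanType z d)
    {c : ℕ} (hd : ∀ a ∈ d, a < c + 2 → a ≤ c) :
    HasSubquotientType B z (kernelRange z c) (shrink d (c + 2)) := by
  rw [hasSubquotientType_iff hz (kernelRange_isotropic hz c) pos_of_mem_shrink]
  refine ⟨fun v hv => hv.1, fun k => ?_⟩
  rw [finrank_map_pow_orth_kernelRange hB hε hz hzd hd, finrank_kernelRange hzd]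

theorem existsUnique_isotropic (hB : B.Nondegenerate) (hε : HasSign B ε)
    {z : Module.End ℂ V} (hz : z ∈ classicalLie B) {d : Multiset ℕ} (hzd : HasJordanType z d)
    {c : ℕ} (hd : ∀ a ∈ d, a < c + 2 → a ≤ c) :
    ∃! F : Submodule ℂ V, Module.finrank ℂ F = numLargeParts d (c + 2) ∧ F ≤ B.orthogonal F ∧
      HasSubquotientType B z F (shrink d (c + 2)) := by
  refine ⟨kernelRange z c, ⟨finrank_kernelRange hzd c, kernelRange_isotropic hz c,
    hasSubquotientType_kernelRange hB hε hz hzd hd⟩, ?_⟩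
  rintro F ⟨h1, h2, h3⟩
  rw [hasSubquotientType_iff hz h2 pos_of_mem_shrink] at h3
  refine eq_kernelRange hz hzd hd h3.1 h1 ?_
  rw [h3.2, h1]

end

end InducedOrbit

namespace InducedOrbit

open ClassicalVariety

variable {V : Type*} [AddCommGroup V] [Module ℂ V] {B : LinearMap.BilinForm ℂ V} {ε : ℂ}

/-! ### Elements of the same Jordan type near a given one -/

theorem mem_adOrbit_of_conj {x y : Module.End ℂ V} {g : (Module.End ℂ V)ˣ}
    (hg : ∀ u v, B (g.1 u) (g.1 v) = B u v) (hdet : LinearMap.det g.1 = 1)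
    (h : g.1 * x = y * g.1) : y ∈ adOrbit (classicalGroup B) x :=
  ⟨g, ⟨hg, hdet⟩, by rw [Ad, h, mul_assoc, Units.mul_inv, mul_one]⟩

/-- The sum of the subspaces `ker z ^ j ∩ im z ^ j`. For an element of the Lie algebra it is
isotropic, and it is Lagrangian if all Jordan blocks have even size. -/
def halfKernel (z : Module.End ℂ V) : Submodule ℂ V :=
  ⨆ j : ℕ, LinearMap.ker (z ^ j) ⊓ LinearMap.range (z ^ j)

theorem mem_halfKernel {z : Module.End ℂ V} {j : ℕ} {u : V} (h : (z ^ (2 * j)) u = 0) :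
    (z ^ j) u ∈ halfKernel z := by
  refine Submodule.mem_iSup_of_mem j ⟨?_, u, rfl⟩
  change (z ^ j) ((z ^ j) u) = 0
  rw [← Module.End.mul_apply, ← pow_add, ← two_mul, h]

theorem pow_apply_eq_zero_of_le {z : Module.End ℂ V} {i j : ℕ} (h : i ≤ j) {u : V}
    (hu : (z ^ i) u = 0) : (z ^ j) u = 0 := by
  rw [← Nat.sub_add_cancel h, pow_add, Module.End.mul_apply, hu, map_zero]

theorem halfKernel_isotropic {z : Module.End ℂ V} (hz : z ∈ classicalLie B) :
    halfKernel z ≤ B.orthogonal (halfKernel z) := by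
  refine iSup_le fun j => ?_
  rintro _ ⟨hv, v, rfl⟩
  have hv : (z ^ j) ((z ^ j) v) = 0 := hv
  rw [mem_orth]
  intro n hn
  induction hn using Submodule.iSup_induction' with
  | mem i n hn =>
    obtain ⟨hn, u, rfl⟩ := hn
    have hn : (z ^ i) ((z ^ i) u) = 0 := hn
    rcases le_total i j with h | h
    · have h1 := skew_pow hz j ((z ^ i) u) v
      rw [pow_apply_eq_zero_of_le h hn, map_zero, LinearMap.zero_apply] at h1
      exact (mul_eq_zero.1 h1.symm).resolve_left (pow_ne_zero _ (by norm_num))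
    · rw [skew_pow hz, pow_apply_eq_zero_of_le h hv, map_zero, mul_zero]
  | zero => simp
  | add u v _ _ hu hv => rw [map_add, LinearMap.add_apply, hu, hv, add_zero]

theorem map_halfKernel_le {g x y : Module.End ℂ V} (h : g * x = y * g) :
    (halfKernel x).map g ≤ halfKernel y := by
  have hpow : ∀ j : ℕ, g * x ^ j = y ^ j * g := fun j => by
    induction j with
    | zero => simp
    | succ j ih => rw [pow_succ, ← mul_assoc, ih, mul_assoc, h, ← mul_assoc, ← pow_succ]
  rw [halfKernel, Submodule.map_iSup]
  refine iSup_le fun j => ?_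
  rintro _ ⟨_, ⟨hu, u, rfl⟩, rfl⟩
  have h1 : g ((x ^ j) u) = (y ^ j) (g u) := LinearMap.congr_fun (hpow j) u
  have h2 : g ((x ^ (2 * j)) u) = (y ^ (2 * j)) (g u) := LinearMap.congr_fun (hpow _) u
  rw [h1]
  refine mem_halfKernel ?_
  have hu : (x ^ j) ((x ^ j) u) = 0 := hu
  rw [← h2, two_mul, pow_add, Module.End.mul_apply, hu, map_zero]

theorem mem_halfKernel_of_le {z : Module.End ℂ V} {h k : ℕ} (hk : h ≤ k) {v : V}
    (hv : (z ^ (2 * h)) v = 0) : (z ^ k) v ∈ halfKernel z :=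
  mem_halfKernel (pow_apply_eq_zero_of_le (by omega) hv)

/-- A Jordan basis with blocks of even sizes gives, by taking half of each chain, a linearly
independent family in `halfKernel z` with as many members as a Lagrangian subspace has
dimensions. -/
theorem halfKernel_data {z : Module.End ℂ V} {d : Multiset ℕ} (hzd : HasJordanType z d)
    (heven : ∀ a ∈ d, Even a) : ∃ (r : ℕ) (h : Fin r → ℕ) (k : Fin r → ℕ) (v : Fin r → V),
      Module.finrank ℂ V = 2 * r ∧ (∀ i, h i ≤ k i) ∧ (∀ i, (z ^ (2 * h i)) (v i) = 0) ∧
      LinearIndependent ℂ fun i => (z ^ k i) (v i) := by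
  obtain ⟨n, a, v, b, rfl, -, hb, hv⟩ := hzd
  have hhalf : ∀ i, ∃ h, a i = h + h := fun i =>
    heven _ (Multiset.mem_map.2 ⟨i, Finset.mem_univ_val i, rfl⟩)
  choose h hh using hhalf
  let e : Fin (Fintype.card (Σ i, Fin (h i))) ≃ Σ i, Fin (h i) := (Fintype.equivFin _).symm
  let φ : (Σ i, Fin (h i)) → Σ i, Fin (a i) := fun p => ⟨p.1, ⟨h p.1 + p.2, by
    rw [hh]
    exact Nat.add_lt_add_left p.2.2 _⟩⟩
  have hφ : Function.Injective φ := by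
    rintro ⟨i, j⟩ ⟨i', j'⟩ h1
    simp only [φ, Sigma.mk.injEq] at h1
    obtain ⟨rfl, h2⟩ := h1
    simp only [heq_eq_eq, Fin.mk.injEq, Nat.add_left_cancel_iff] at h2
    rw [Fin.ext h2]
  refine ⟨_, fun p => h (e p).1, fun p => h (e p).1 + (e p).2, fun p => v (e p).1, ?_,
    fun p => Nat.le_add_right _ _, fun p => ?_, ?_⟩
  · rw [Module.finrank_eq_card_basis b]
    simp only [Fintype.card_sigma, Fintype.card_fin, Finset.mul_sum]
    exact Finset.sum_congr rfl fun i _ => by rw [hh, two_mul]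
  · rw [two_mul, ← hh, hv]
  · have h1 := b.linearIndependent.comp _ (hφ.comp e.injective)
    convert h1 using 1
    funext p
    exact (hb (e p).1 ⟨h (e p).1 + (e p).2, by
      rw [hh]
      exact Nat.add_lt_add_left (e p).2.2 _⟩).symm

variable [FiniteDimensional ℂ V]

theorem exists_isometry_of_hasJordanType (hB : B.Nondegenerate) (hε : HasSign B ε)
    {x y : Module.End ℂ V} (hx : x ∈ classicalLie B) (hy : y ∈ classicalLie B) {d : Multiset ℕ}
    (hxd : HasJordanType x d) (hyd : HasJordanType y d) :
    ∃ g : (Module.End ℂ V)ˣ, (∀ u v, B (g.1 u) (g.1 v) = B u v) ∧ g.1 * x = y * g.1 := by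
  obtain ⟨e, he⟩ := hxd.exists_equiv hyd
  exact exists_isometry_conj hB hε hx hy e he

theorem orth_eq_of_isotropic (hB : B.Nondegenerate) {L : Submodule ℂ V}
    (hL : L ≤ B.orthogonal L) (h : Module.finrank ℂ V ≤ 2 * Module.finrank ℂ L) :
    B.orthogonal L = L := by
  refine (Submodule.eq_of_le_of_finrank_le hL ?_).symm
  have := finrank_orth hB L
  omega

theorem orth_halfKernel (hB : B.Nondegenerate) {z : Module.End ℂ V} (hz : z ∈ classicalLie B)
    {d : Multiset ℕ} (hzd : HasJordanType z d) (heven : ∀ a ∈ d, Even a) :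
    B.orthogonal (halfKernel z) = halfKernel z := by
  refine orth_eq_of_isotropic hB (halfKernel_isotropic hz) ?_
  obtain ⟨r, h, k, v, hm, hk, hv, hli⟩ := halfKernel_data hzd heven
  rw [hm]
  refine Nat.mul_le_mul_left 2 ?_
  have h1 := finrank_span_eq_card hli
  rw [Fintype.card_fin] at h1
  rw [← h1]
  refine Submodule.finrank_mono (Submodule.span_le.2 ?_)
  rintro _ ⟨i, rfl⟩
  exact mem_halfKernel_of_le (hk i) (hv i)

/-- If all Jordan blocks have even size, the Lagrangian subspaces `halfKernel z` of the elements `z`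
near `z₀` of the same Jordan type stay complementary to a given Lagrangian complement of
`halfKernel z₀`. -/
theorem exists_nhds_isCompl_halfKernel (hB : B.Nondegenerate)
    {z₀ : Module.End ℂ V} (hz₀ : z₀ ∈ classicalLie B) {d : Multiset ℕ}
    (hd : HasJordanType z₀ d) (heven : ∀ a ∈ d, Even a) {L' : Submodule ℂ V}
    (hL' : L' ≤ B.orthogonal L') (hc : IsCompl (B.orthogonal (halfKernel z₀)) L') :
    ∃ δ ∈ polyFun (Module.End ℂ V), δ z₀ ≠ 0 ∧ ∀ z ∈ classicalLie B, HasJordanType z d →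
      δ z ≠ 0 → B.orthogonal L' = L' ∧ IsCompl L' (halfKernel z) := by
  classical
  obtain ⟨r, h, k, v, hm, hk, hv, hli⟩ := halfKernel_data hd heven
  have hL := orth_halfKernel hB hz₀ hd heven
  have hspan : Submodule.span ℂ (Set.range fun i => (z₀ ^ k i) (v i)) = halfKernel z₀ := by
    refine Submodule.eq_of_le_of_finrank_le (Submodule.span_le.2 ?_) ?_
    · rintro _ ⟨i, rfl⟩
      exact mem_halfKernel_of_le (hk i) (hv i)
    · rw [finrank_span_eq_card hli, Fintype.card_fin]
      have := finrank_orth hB (halfKernel z₀)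
      rw [hL] at this
      omega
  obtain ⟨f', hf, hf'⟩ := exists_isHyperbolic hB hli hspan hL.ge hL' hc
  have hdimL' : Module.finrank ℂ L' = r := by
    have h1 := Submodule.finrank_add_eq_of_isCompl hc
    have h2 := finrank_orth hB (halfKernel z₀)
    rw [hL] at h1 h2
    omega
  have hLL' : B.orthogonal L' = L' := orth_eq_of_isotropic hB hL' (by omega)
  -- the basis `z₀ ^ k i (v i)` of `halfKernel z₀` extends to vectors of `halfKernel z`, and the
  -- subspace stays complementary to `L'` as long as their pairing matrix with a basis of `L'` is
  -- invertible
  choose s hs δ hδ hδ0 hs0 hker using fun i => exists_kernel_section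
    (A := fun z : Module.End ℂ V => z ^ (2 * h i)) ((IsPolyMap.linear LinearMap.id).pow _) z₀ (hv i)
  let M : Module.End ℂ V → Matrix (Fin r) (Fin r) ℂ := fun z i j =>
    B ((z ^ k i) (s i z)) (f' j)
  have hM : (fun z => (M z).det) ∈ polyFun (Module.End ℂ V) := det_mem_polyFun fun i j =>
    (((IsPolyMap.linear LinearMap.id).pow (k i)).apply (hs i)) (LinearMap.flip B (f' j))
  refine ⟨_, mul_mem_polyFun hM (prod_mem_polyFun (s := Finset.univ) fun i _ => hδ i), ?_,
    fun z hz hzd hδz => ?_⟩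
  · refine mul_ne_zero ?_ (Finset.prod_ne_zero_iff.2 fun i _ => hδ0 i)
    have h1 : M z₀ = Matrix.diagonal fun i => δ i z₀ := by
      ext i j
      simp only [M]
      rw [hs0, map_smul, map_smul, LinearMap.smul_apply, hf.dual, Matrix.diagonal_apply]
      split_ifs <;> simp
    rw [h1, Matrix.det_diagonal]
    exact Finset.prod_ne_zero_iff.2 fun i _ => hδ0 i
  · have hM0 : (M z).det ≠ 0 := left_ne_zero_of_mul hδz
    have hδz : ∀ i, δ i z ≠ 0 := fun i =>
      Finset.prod_ne_zero_iff.1 (right_ne_zero_of_mul hδz) i (Finset.mem_univ i)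
    have hmem : ∀ i, (z ^ k i) (s i z) ∈ halfKernel z := fun i =>
      mem_halfKernel_of_le (hk i) (hker i z (hδz i) (by
        rw [hzd.finrank_range_pow, hd.finrank_range_pow]))
    have hLz := orth_halfKernel hB hz hzd heven
    have hdisj : Disjoint L' (halfKernel z) := by
      rw [Submodule.disjoint_def]
      intro u hu huz
      rw [← hf'] at hu
      obtain ⟨c, rfl⟩ := (Submodule.mem_span_range_iff_exists_fun ℂ).1 hu
      have h1 : Matrix.mulVec (M z) c = 0 := by
        funext i
        have h2 := mem_orth.1 (hLz.ge huz) _ (hmem i)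
        rw [map_sum] at h2
        simp only [map_smul, smul_eq_mul] at h2
        simp only [Matrix.mulVec, dotProduct, M, Pi.zero_apply]
        rw [← h2]
        exact Finset.sum_congr rfl fun j _ => mul_comm _ _
      rw [Matrix.eq_zero_of_mulVec_eq_zero hM0 h1]
      simp
    refine ⟨hLL', (Submodule.isCompl_iff_disjoint _ _ ?_).2 hdisj⟩
    have := finrank_orth hB (halfKernel z)
    rw [hLz] at this
    omega

/-- The elements of the Lie algebra of the same Jordan type as `z₀` in some Zariski neighbourhood
of `z₀` are in the orbit of `z₀`. For the special orthogonal group and a very even Jordan type, the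
two orbits of that type are separated by the families of their Lagrangian subspaces `halfKernel`. -/
theorem exists_nhds_mem_adOrbit (hB : B.Nondegenerate) (hS : B.IsSymm ∨ B.IsAlt)
    {z₀ : Module.End ℂ V} (hz₀ : z₀ ∈ classicalLie B) {d : Multiset ℕ}
    (hd : HasJordanType z₀ d) :
    ∃ δ ∈ polyFun (Module.End ℂ V), δ z₀ ≠ 0 ∧ ∀ z ∈ classicalLie B, HasJordanType z d →
      δ z ≠ 0 → z ∈ adOrbit (classicalGroup B) z₀ := by
  obtain ⟨ε, hε⟩ := exists_hasSign hS
  rcases hS with hS | hA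
  · by_cases heven : ∀ a ∈ d, Even a
    · have hL := orth_halfKernel hB hz₀ hd heven
      obtain ⟨L', hL', hc⟩ := exists_isotropic_compl hB hε hL.ge
      obtain ⟨δ, hδ, hδ0, h⟩ := exists_nhds_isCompl_halfKernel hB hz₀ hd heven hL' hc
      refine ⟨δ, hδ, hδ0, fun z hz hzd hδz => ?_⟩
      obtain ⟨hLL', hc'⟩ := h z hz hzd hδz
      obtain ⟨g, hg, hgz⟩ := exists_isometry_of_hasJordanType hB hε hz₀ hz hd hzd
      have hc₁ : IsCompl (B.orthogonal L') (halfKernel z₀) := by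
        rw [hLL', ← hL]
        exact hc.symm
      -- `u` maps `halfKernel z₀` to `halfKernel z`, so `u⁻¹ g` preserves `halfKernel z₀`
      obtain ⟨u, hu, hmap, -⟩ := exists_unipotent hB hε hLL'.ge hL.ge
        (halfKernel_isotropic hz) hc₁ (by rwa [hLL'])
      refine mem_adOrbit_of_conj hg ?_ hgz
      have hu' := inv_mem hu
      have h1 : ∀ a b, B ((u⁻¹ * g).1 a) ((u⁻¹ * g).1 b) = B a b := fun a b => by
        rw [Units.val_mul, Module.End.mul_apply, Module.End.mul_apply, hu'.1, hg]
      have h2 : LinearMap.det (u⁻¹ * g).1 = 1 := by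
        refine det_eq_one_of_lagrangian hB h1 hL fun l hl => ?_
        have h3 : g.1 l ∈ halfKernel z := map_halfKernel_le hgz ⟨l, hl, rfl⟩
        rw [← hmap] at h3
        obtain ⟨l', hl', h4⟩ := h3
        change u⁻¹.1 (g.1 l) ∈ halfKernel z₀
        rw [← h4, ← Module.End.mul_apply, Units.inv_mul]
        exact hl'
      rwa [Units.val_mul, map_mul, hu'.2, one_mul] at h2
    · push Not at heven
      obtain ⟨a, ha, hodd⟩ := heven
      refine ⟨_, const_mem_polyFun 1, one_ne_zero, fun z hz hzd _ => ?_⟩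
      obtain ⟨g, hg, hgz⟩ := exists_isometry_of_hasJordanType hB hε hz₀ hz hd hzd
      -- with an odd block, the determinant of the conjugating isometry can be corrected
      rcases mul_self_eq_one_iff.1 (det_isometry_mul_self (hB := hB) hg) with h | h
      · exact mem_adOrbit_of_conj hg h hgz
      · obtain ⟨k, hk, hkz, hdet⟩ := exists_det_neg_one hB hS hz₀ hd ha
          (Nat.not_even_iff_odd.1 hodd)
        refine mem_adOrbit_of_conj (g := g * k) (fun u v => ?_) ?_ ?_
        · rw [Units.val_mul, Module.End.mul_apply, Module.End.mul_apply, hg, hk]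
        · rw [Units.val_mul, map_mul, h, hdet]
          norm_num
        · rw [Units.val_mul, mul_assoc, hkz, ← mul_assoc, hgz, mul_assoc]
  · refine ⟨_, const_mem_polyFun 1, one_ne_zero, fun z hz hzd _ => ?_⟩
    obtain ⟨g, hg, hgz⟩ := exists_isometry_of_hasJordanType hB hε hz₀ hz hd hzd
    exact mem_adOrbit_of_conj hg (det_eq_one_of_isAlt hB hA hg) hgz

end InducedOrbit

namespace InducedOrbit

open ClassicalVariety

variable {V : Type*} [AddCommGroup V] [Module ℂ V] {B : LinearMap.BilinForm ℂ V} {ε : ℂ}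

/-! ### The adjoint action -/

theorem Ad_mul (g h : (Module.End ℂ V)ˣ) (x : Module.End ℂ V) : Ad (g * h) x = Ad g (Ad h x) := by
  simp only [Ad, mul_inv_rev, Units.val_mul, mul_assoc]

theorem Ad_one (x : Module.End ℂ V) : Ad 1 x = x := by simp [Ad]

theorem Ad_inv_Ad (g : (Module.End ℂ V)ˣ) (x : Module.End ℂ V) : Ad g⁻¹ (Ad g x) = x := by
  rw [← Ad_mul, inv_mul_cancel, Ad_one]

theorem Ad_Ad_inv (g : (Module.End ℂ V)ˣ) (x : Module.End ℂ V) : Ad g (Ad g⁻¹ x) = x := by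
  rw [← Ad_mul, mul_inv_cancel, Ad_one]

theorem Ad_add (g : (Module.End ℂ V)ˣ) (x y : Module.End ℂ V) :
    Ad g (x + y) = Ad g x + Ad g y := by
  simp only [Ad, mul_add, add_mul]

theorem Ad_apply (g : (Module.End ℂ V)ˣ) (x : Module.End ℂ V) (v : V) :
    Ad g x v = g.1 (x (g⁻¹.1 v)) := rfl

theorem Ad_pow (g : (Module.End ℂ V)ˣ) (x : Module.End ℂ V) (k : ℕ) :
    Ad g x ^ k = Ad g (x ^ k) := g.conj_pow x k

theorem unit_apply_inv (g : (Module.End ℂ V)ˣ) (v : V) : g.1 (g⁻¹.1 v) = v := by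
  rw [← Module.End.mul_apply, Units.mul_inv, Module.End.one_apply]

theorem unit_inv_apply (g : (Module.End ℂ V)ˣ) (v : V) : g⁻¹.1 (g.1 v) = v := by
  rw [← Module.End.mul_apply, Units.inv_mul, Module.End.one_apply]

theorem inv_left (g : (Module.End ℂ V)ˣ) (hg : g ∈ classicalGroup B) (u v : V) :
    B (g⁻¹.1 u) v = B u (g.1 v) := by
  rw [← hg.1, unit_apply_inv]

theorem Ad_mem_classicalLie {g : (Module.End ℂ V)ˣ} (hg : g ∈ classicalGroup B)
    {x : Module.End ℂ V} (hx : x ∈ classicalLie B) : Ad g x ∈ classicalLie B := by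
  rw [mem_classicalLie] at hx ⊢
  intro u v
  have h : ∀ a b, B (g.1 a) b = B a (g⁻¹.1 b) := fun a b => by
    simpa using inv_left g⁻¹ (inv_mem hg) a b
  rw [Ad_apply, Ad_apply, h, hx, ← inv_left g hg]

theorem Ad_mem_adOrbit {H : Subgroup (Module.End ℂ V)ˣ} {g : (Module.End ℂ V)ˣ} (hg : g ∈ H)
    {x z : Module.End ℂ V} (hz : z ∈ adOrbit H x) : Ad g z ∈ adOrbit H x := by
  obtain ⟨h, hh, rfl⟩ := hz
  exact ⟨g * h, mul_mem hg hh, (Ad_mul g h x).symm⟩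

theorem self_mem_adOrbit (H : Subgroup (Module.End ℂ V)ˣ) (x : Module.End ℂ V) :
    x ∈ adOrbit H x := ⟨1, one_mem H, (Ad_one x).symm⟩

theorem adOrbit_eq_of_mem {H : Subgroup (Module.End ℂ V)ˣ} {x z : Module.End ℂ V}
    (hz : z ∈ adOrbit H x) : adOrbit H z = adOrbit H x := by
  obtain ⟨h, hh, rfl⟩ := hz
  ext w
  constructor
  · rintro ⟨k, hk, rfl⟩
    exact ⟨k * h, mul_mem hk hh, (Ad_mul k h x).symm⟩
  · rintro ⟨k, hk, rfl⟩
    exact ⟨k * h⁻¹, mul_mem hk (inv_mem hh), by rw [Ad_mul, Ad_inv_Ad]⟩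

theorem stab_apply_mem {F : Submodule ℂ V} {g : (Module.End ℂ V)ˣ} (hg : g ∈ stab B F) {v : V}
    (hv : v ∈ F) : g.1 v ∈ F := by
  rw [← hg.2]
  exact ⟨v, hv, rfl⟩

theorem stab_apply_mem_orth {F : Submodule ℂ V} {g : (Module.End ℂ V)ˣ} (hg : g ∈ stab B F) {v : V}
    (hv : v ∈ B.orthogonal F) : g.1 v ∈ B.orthogonal F := by
  rw [mem_orth] at hv ⊢
  intro n hn
  rw [← inv_left g hg.1]
  exact hv _ (stab_apply_mem (inv_mem hg) hn)

namespace ParabolicData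

variable {r : ℕ} (P : ParabolicData B r)

/-! ### Levi decompositions -/

/-- The second factor `so(W)` or `sp(W)` of the Levi algebra. -/
def leviSecond : Submodule ℂ (Module.End ℂ V) where
  carrier := {x | x ∈ classicalLie B ∧ (∀ v ∈ P.F, x v = 0) ∧ ∀ v ∈ P.F', x v = 0}
  zero_mem' := ⟨zero_mem _, by simp, by simp⟩
  add_mem' := by
    rintro x y ⟨h1, h2, h3⟩ ⟨h1', h2', h3'⟩
    exact ⟨add_mem h1 h1', fun v hv => by simp [h2 v hv, h2' v hv],
      fun v hv => by simp [h3 v hv, h3' v hv]⟩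
  smul_mem' := by
    rintro c x ⟨h1, h2, h3⟩
    exact ⟨Submodule.smul_mem _ c h1, fun v hv => by simp [h2 v hv], fun v hv => by simp [h3 v hv]⟩

variable {P}

theorem apply_mem_W {x : Module.End ℂ V} (hx : x ∈ P.leviSecond) (v : V) : x v ∈ P.W :=
  ⟨apply_mem_orth hx.1 hx.2.1 v, apply_mem_orth hx.1 hx.2.2 v⟩

theorem pow_apply_mem_W {x : Module.End ℂ V} (hx : x ∈ P.leviSecond) (k : ℕ) {v : V}
    (hv : v ∈ P.W) : (x ^ k) v ∈ P.W := by
  induction k with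
  | zero => exact hv
  | succ k ih =>
    rw [pow_succ', Module.End.mul_apply]
    exact apply_mem_W hx _

variable (P) in
theorem exists_frame [FiniteDimensional ℂ V] (hB : B.Nondegenerate) : ∃ f f' : Fin r → V,
    IsHyperbolic B f f' ∧ Submodule.span ℂ (Set.range f) = P.F ∧
      Submodule.span ℂ (Set.range f') = P.F' := by
  obtain ⟨f, hf, hfF⟩ := exists_basis_of_finrank P.finrank_F
  obtain ⟨f', h, hf'⟩ := exists_isHyperbolic hB hf hfF P.isotropic_F P.isotropic_F' P.isCompl
  exact ⟨f, f', h, hfF, hf'⟩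

variable (P) in
theorem disjoint_F_W (hB : B.Nondegenerate) (hε : HasSign B ε) : Disjoint P.F P.W := by
  rw [Submodule.disjoint_def]
  rintro v hv ⟨-, hv'⟩
  refine eq_zero_of_forall_right hB fun u => ?_
  obtain ⟨a, ha, b, hb, rfl⟩ := Submodule.mem_sup.1
    (P.isCompl.sup_eq_top ▸ Submodule.mem_top : u ∈ B.orthogonal P.F ⊔ P.F')
  rw [map_add, LinearMap.add_apply, mem_orth.1 hv' b hb, add_zero, hε.swap, mem_orth.1 ha v hv,
    mul_zero]

variable (P) in
theorem F_sup_W [FiniteDimensional ℂ V] (hB : B.Nondegenerate) (hε : HasSign B ε) :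
    P.F ⊔ P.W = B.orthogonal P.F := by
  refine le_antisymm (sup_le P.isotropic_F inf_le_left) fun v hv => ?_
  obtain ⟨f, f', h, hf, hf'⟩ := P.exists_frame hB
  have h1 : ∑ i, B v (f' i) • f i ∈ P.F := by
    rw [← hf]
    exact sum_mem fun i _ => Submodule.smul_mem _ _ (Submodule.subset_span ⟨i, rfl⟩)
  refine Submodule.mem_sup.2 ⟨_, h1, v - _, ⟨sub_mem hv (P.isotropic_F h1), ?_⟩,
    add_sub_cancel _ _⟩
  change _ ∈ B.orthogonal P.F'
  rw [← hf', mem_orth_span]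
  intro j
  simp only [map_sub, map_sum, map_smul, smul_eq_mul, h.dual' hε, mul_ite, mul_zero,
    Finset.sum_ite_eq, Finset.mem_univ, if_true]
  rw [hε.swap, mul_comm, sub_self]

theorem finrank_map_pow_W {x : Module.End ℂ V} {y : Module.End ℂ P.W}
    (hy : ∀ w, (y w : V) = x w) (k : ℕ) :
    Module.finrank ℂ (LinearMap.range (y ^ k)) = Module.finrank ℂ (P.W.map (x ^ k)) := by
  have hyk : ∀ w, ((y ^ k) w : V) = (x ^ k) w := by
    intro w
    induction k with
    | zero => rfl
    | succ k ih => rw [pow_succ', pow_succ', Module.End.mul_apply, Module.End.mul_apply, hy, ih]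
  have h : (LinearMap.range (y ^ k)).map P.W.subtype = P.W.map (x ^ k) := by
    ext v
    constructor
    · rintro ⟨_, ⟨w, rfl⟩, rfl⟩
      exact ⟨w, w.2, (hyk w).symm⟩
    · rintro ⟨w, hw, rfl⟩
      exact ⟨(y ^ k) ⟨w, hw⟩, ⟨_, rfl⟩, hyk _⟩
  rw [← h, Submodule.finrank_map_subtype_eq]

/-- The Jordan type of an element of the second factor of the Levi algebra is detected by the ranks
of its powers on `W`. -/
theorem hasTypeInSecondFactor_iff [FiniteDimensional ℂ V] {O' : Set (Module.End ℂ V)}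
    {d : Multiset ℕ} (hd : ∀ a ∈ d, 0 < a) :
    P.HasTypeInSecondFactor O' d ↔ ∀ x ∈ O', x ∈ P.leviSecond ∧
      ∀ k, Module.finrank ℂ (P.W.map (x ^ k)) = rankPow d k := by
  refine forall₂_congr fun x _ => ⟨?_, ?_⟩
  · rintro ⟨h1, h2, h3, y, hy, hyd⟩
    exact ⟨⟨h1.1, h2, h3⟩, fun k => by rw [← finrank_map_pow_W hy, hyd.finrank_range_pow]⟩
  · rintro ⟨⟨h1, h2, h3⟩, h⟩
    have hx : ∀ v, x v ∈ P.W := apply_mem_W ⟨h1, h2, h3⟩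
    refine ⟨⟨h1, fun v hv => by rw [h2 v hv]; exact zero_mem _,
      fun v hv => by rw [h3 v hv]; exact zero_mem _⟩, h2, h3,
      x.restrict (fun v _ => hx v), fun w => rfl, hasJordanType_of_finrank hd fun k => ?_⟩
    rw [← h k, finrank_map_pow_W (x := x)]
    exact fun w => rfl

section

variable {x y : Module.End ℂ V}

theorem add_mem_classicalLie (hy : y ∈ P.nilradical) (hx : x ∈ P.leviSecond) :
    y + x ∈ classicalLie B := add_mem hy.1 hx.1

theorem add_apply_F (hy : y ∈ P.nilradical) (hx : x ∈ P.leviSecond) {v : V} (hv : v ∈ P.F) :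
    (y + x) v = 0 := by
  rw [LinearMap.add_apply, hy.2.2.2 v hv, hx.2.1 v hv, add_zero]

/-- On `F^⊥`, an element of `n + x` agrees with `x` modulo `F`. -/
theorem add_pow_apply_sub_mem (hy : y ∈ P.nilradical) (hx : x ∈ P.leviSecond) (k : ℕ) {v : V}
    (hv : v ∈ B.orthogonal P.F) :
    ((y + x) ^ k) v - (x ^ k) v ∈ P.F ∧ (x ^ k) v ∈ B.orthogonal P.F := by
  induction k with
  | zero => exact ⟨by simp, hv⟩
  | succ k ih =>
    rw [pow_succ', pow_succ', Module.End.mul_apply, Module.End.mul_apply]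
    refine ⟨?_, (apply_mem_W hx _).1⟩
    have h1 := add_apply_F hy hx ih.1
    rw [map_sub, sub_eq_zero] at h1
    rw [h1, LinearMap.add_apply, add_sub_cancel_right]
    exact hy.2.2.1 _ ih.2

theorem pow_apply_mem_F (hx : x ∈ P.leviSecond) (k : ℕ) {v : V} (hv : v ∈ P.F) :
    (x ^ k) v ∈ P.F := by
  induction k with
  | zero => exact hv
  | succ k ih =>
    rw [pow_succ', Module.End.mul_apply, hx.2.1 _ ih]
    exact zero_mem _

variable [FiniteDimensional ℂ V]

theorem map_pow_orth_sup (hB : B.Nondegenerate) (hε : HasSign B ε) (hy : y ∈ P.nilradical)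
    (hx : x ∈ P.leviSecond) (k : ℕ) :
    (B.orthogonal P.F).map ((y + x) ^ k) ⊔ P.F = P.W.map (x ^ k) ⊔ P.F := by
  apply le_antisymm <;> refine sup_le ?_ le_sup_right <;> rintro _ ⟨v, hv, rfl⟩
  · have h1 := (add_pow_apply_sub_mem hy hx k hv).1
    have hv' : v ∈ P.F ⊔ P.W := (P.F_sup_W hB hε).ge hv
    obtain ⟨a, ha, w, hw, rfl⟩ := Submodule.mem_sup.1 hv'
    rw [← sub_add_cancel (((y + x) ^ k) (a + w)) ((x ^ k) (a + w)), map_add (x ^ k)]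
    rw [map_add (x ^ k)] at h1
    exact add_mem (Submodule.mem_sup_right h1) (add_mem
      (Submodule.mem_sup_right (pow_apply_mem_F hx k ha))
      (Submodule.mem_sup_left ⟨w, hw, rfl⟩))
  · have h1 := (add_pow_apply_sub_mem hy hx k hv.1).1
    rw [← sub_sub_cancel (((y + x) ^ k) v) ((x ^ k) v)]
    exact sub_mem (Submodule.mem_sup_left ⟨v, hv.1, rfl⟩) (Submodule.mem_sup_right h1)

theorem finrank_map_pow_orth_sup (hB : B.Nondegenerate) (hε : HasSign B ε) (hy : y ∈ P.nilradical)
    (hx : x ∈ P.leviSecond) (k : ℕ) :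
    Module.finrank ℂ ((B.orthogonal P.F).map ((y + x) ^ k) ⊔ P.F : Submodule ℂ V) =
      Module.finrank ℂ (P.W.map (x ^ k)) + r := by
  have hle : P.W.map (x ^ k) ≤ P.W := by
    rintro _ ⟨w, hw, rfl⟩
    exact pow_apply_mem_W hx k hw
  have h1 := Submodule.finrank_sup_add_finrank_inf_eq (P.W.map (x ^ k)) P.F
  rw [((P.disjoint_F_W hB hε).symm.mono_left hle).eq_bot, finrank_bot, P.finrank_F] at h1
  rw [map_pow_orth_sup hB hε hy hx, ← h1, add_zero]

/-- The elements of `n + x` have powers of rank at most that of the elements of the orbit with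
Jordan type `d`, if `x` has Jordan type `shrink d (c + 2)`: for `z ∈ n + x`, the range of `z ^ k` is
compared with `z ^ k (F^⊥)`, with `z ^ (k - 1) (F^⊥)` or with `z (x ^ (k - 2) W)`, according as
`k ≤ c`, `k = c + 1` or `k ≥ c + 2`. -/
theorem finrank_range_add_pow_le (hB : B.Nondegenerate) (hε : HasSign B ε) {d : Multiset ℕ}
    {c : ℕ} (hr : r = numLargeParts d (c + 2)) (hd : ∀ a ∈ d, a < c + 2 → a ≤ c)
    (hy : y ∈ P.nilradical)
    (hx : x ∈ P.leviSecond)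
    (hxd : ∀ k, Module.finrank ℂ (P.W.map (x ^ k)) ≤ rankPow (shrink d (c + 2)) k) (k : ℕ) :
    Module.finrank ℂ (LinearMap.range ((y + x) ^ k)) ≤ rankPow d k := by
  have hmap : ∀ j, Module.finrank ℂ ((B.orthogonal P.F).map ((y + x) ^ j)) ≤
      rankPow (shrink d (c + 2)) j + r := fun j => by
    have h1 : (B.orthogonal P.F).map ((y + x) ^ j) ≤
      (B.orthogonal P.F).map ((y + x) ^ j) ⊔ P.F := le_sup_left
    have h2 := Submodule.finrank_mono h1
    rw [finrank_map_pow_orth_sup hB hε hy hx] at h2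
    exact h2.trans (Nat.add_le_add_right (hxd j) r)
  have hrange : LinearMap.range (y + x) ≤ B.orthogonal P.F := by
    rintro _ ⟨v, rfl⟩
    exact apply_mem_orth (add_mem_classicalLie hy hx) (fun v hv => add_apply_F hy hx hv) v
  rcases le_or_gt k c with hk | hk
  · have h1 := finrank_range_le_map_add ((y + x) ^ k) (B.orthogonal P.F)
    have h2 := finrank_orth hB P.F
    have h3 := hmap k
    have h4 := rankPow_shrink_of_le d hk
    rw [P.finrank_F] at h2
    omega
  · obtain ⟨j, rfl⟩ := Nat.exists_eq_add_of_lt hk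
    rcases Nat.eq_zero_or_pos j with rfl | hj
    · have h1 : LinearMap.range ((y + x) ^ (c + 0 + 1)) ≤
          (B.orthogonal P.F).map ((y + x) ^ c) := by
        rw [range_pow_add _ (c + 0) 1, pow_one]
        exact Submodule.map_mono hrange
      have h2 := Submodule.finrank_mono h1
      have h3 := hmap c
      have h4 := rankPow_shrink_of_le d (le_refl c)
      have h5 := rankPow_gap hd
      have h6 : rankPow d (c + 2) + numLargeParts d (c + 2) = _ := numLargeParts_add d (c + 1)
      rw [add_zero] at h2 ⊢
      omega
    · obtain ⟨i, rfl⟩ := Nat.exists_eq_add_of_lt hj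
      have h1 : LinearMap.range ((y + x) ^ (c + (0 + i + 1) + 1)) ≤
          (P.W.map (x ^ (c + i))).map (y + x) := by
        have h2 : c + (0 + i + 1) + 1 = 1 + ((c + i) + 1) := by omega
        rw [h2, range_pow_add, range_pow_add, pow_one]
        have h3 : (LinearMap.range (y + x)).map ((y + x) ^ (c + i)) ≤
            P.W.map (x ^ (c + i)) ⊔ P.F := by
          rw [← map_pow_orth_sup hB hε hy hx]
          exact (Submodule.map_mono hrange).trans le_sup_left
        refine (Submodule.map_mono h3).trans ?_
        rw [Submodule.map_sup]
        refine sup_le le_rfl ?_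
        rintro _ ⟨v, hv, rfl⟩
        rw [add_apply_F hy hx hv]
        exact zero_mem _
      have h2 := Submodule.finrank_mono h1
      have h3 := Submodule.finrank_map_le (y + x) (P.W.map (x ^ (c + i)))
      have h4 := hxd (c + i)
      have h5 := rankPow_shrink_of_ge hd (Nat.le_add_right c i)
      have h6 : c + (0 + i + 1) + 1 = c + i + 2 := by omega
      rw [h6] at h2 ⊢
      omega

/-- The isotropic subspace that defines the parabolic subgroup is determined by any element of
`n + x` of Jordan type `d`. -/
theorem F_eq_kernelRange (hB : B.Nondegenerate) (hε : HasSign B ε) {d : Multiset ℕ}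
    {c : ℕ} (hr : r = numLargeParts d (c + 2)) (hd : ∀ a ∈ d, a < c + 2 → a ≤ c)
    (hy : y ∈ P.nilradical) (hx : x ∈ P.leviSecond)
    (hxd : ∀ k, Module.finrank ℂ (P.W.map (x ^ k)) ≤ rankPow (shrink d (c + 2)) k)
    (hz : HasJordanType (y + x) d) : P.F = kernelRange (y + x) c := by
  refine eq_kernelRange (add_mem_classicalLie hy hx) hz hd (fun v hv => add_apply_F hy hx hv)
    (by rw [P.finrank_F, hr]) ?_
  rw [finrank_map_pow_orth_sup hB hε hy hx, ← hr, add_comm]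
  exact Nat.add_le_add_left (hxd c) r

end

variable {O' : Set (Module.End ℂ V)}

theorem mem_nilradicalAdd_closure [FiniteDimensional ℂ V] {d : Multiset ℕ}
    (hO' : ∀ x ∈ O', x ∈ P.leviSecond ∧
      ∀ k, Module.finrank ℂ (P.W.map (x ^ k)) = rankPow d k)
    {z : Module.End ℂ V} (hz : z ∈ P.nilradicalAdd (zariskiClosure O')) :
    ∃ y ∈ P.nilradical, ∃ x ∈ P.leviSecond,
      (∀ k, Module.finrank ℂ (P.W.map (x ^ k)) ≤ rankPow d k) ∧ z = y + x := by
  obtain ⟨y, hy, x, hx, rfl⟩ := hz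
  refine ⟨y, hy, x, mem_submodule_of_mem_zariskiClosure _ (fun s hs => (hO' s hs).1) hx,
    fun k => ?_, rfl⟩
  have hrange : ∀ s : Module.End ℂ V,
      LinearMap.range ((s ^ k).comp P.W.subtype) = P.W.map (s ^ k) := fun s => by
    rw [LinearMap.range_comp, Submodule.range_subtype]
  have hA : IsPolyMap (fun s : Module.End ℂ V => (s ^ k).comp P.W.subtype) :=
    IsPolyMap.comp_linear (LinearMap.lcomp ℂ V P.W.subtype)
      ((IsPolyMap.linear LinearMap.id).pow k)
  rw [← hrange]
  exact finrank_range_le_of_mem_zariskiClosure hA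
    (fun s hs => by rw [hrange, (hO' s hs).2]) hx

theorem nilradicalAdd_mono {A A' : Set (Module.End ℂ V)} (h : A ⊆ A') :
    P.nilradicalAdd A ⊆ P.nilradicalAdd A' := by
  rintro _ ⟨y, hy, x, hx, rfl⟩
  exact ⟨y, hy, x, h hx, rfl⟩

theorem add_mem_nilradical {y y' : Module.End ℂ V} (hy : y ∈ P.nilradical)
    (hy' : y' ∈ P.nilradical) : y + y' ∈ P.nilradical :=
  ⟨add_mem hy.1 hy'.1, fun v => add_mem (hy.2.1 v) (hy'.2.1 v),
    fun v hv => add_mem (hy.2.2.1 v hv) (hy'.2.2.1 v hv),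
    fun v hv => by rw [LinearMap.add_apply, hy.2.2.2 v hv, hy'.2.2.2 v hv, add_zero]⟩

theorem smul_mem_nilradical (c : ℂ) {y : Module.End ℂ V} (hy : y ∈ P.nilradical) :
    c • y ∈ P.nilradical :=
  ⟨Submodule.smul_mem _ c hy.1, fun v => Submodule.smul_mem _ c (hy.2.1 v),
    fun v hv => Submodule.smul_mem _ c (hy.2.2.1 v hv),
    fun v hv => by rw [LinearMap.smul_apply, hy.2.2.2 v hv, smul_zero]⟩

theorem Ad_mem_nilradical {q : (Module.End ℂ V)ˣ} (hq : q ∈ P.Q) {y : Module.End ℂ V}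
    (hy : y ∈ P.nilradical) : Ad q y ∈ P.nilradical := by
  have hq' := inv_mem hq
  refine ⟨Ad_mem_classicalLie hq.1 hy.1, fun v => stab_apply_mem_orth hq (hy.2.1 _),
    fun v hv => stab_apply_mem hq (hy.2.2.1 _ (stab_apply_mem_orth hq' hv)), fun v hv => ?_⟩
  rw [Ad_apply, hy.2.2.2 _ (stab_apply_mem hq' hv), map_zero]

theorem Ad_mem_leviSecond {l : (Module.End ℂ V)ˣ} (hl : l ∈ P.L) {x : Module.End ℂ V}
    (hx : x ∈ P.leviSecond) : Ad l x ∈ P.leviSecond := by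
  have hl' := inv_mem hl
  refine ⟨Ad_mem_classicalLie hl.1.1 hx.1, fun v hv => ?_, fun v hv => ?_⟩
  · rw [Ad_apply, hx.2.1 _ (stab_apply_mem hl'.1 hv), map_zero]
  · rw [Ad_apply, hx.2.2 _ (stab_apply_mem hl'.2 hv), map_zero]

theorem finrank_map_Ad_pow {l : (Module.End ℂ V)ˣ} (hl : l ∈ P.L) (x : Module.End ℂ V) (k : ℕ) :
    Module.finrank ℂ (P.W.map (Ad l x ^ k)) = Module.finrank ℂ (P.W.map (x ^ k)) := by
  have hW : ∀ m ∈ P.L, ∀ v ∈ P.W, m.1 v ∈ P.W := fun m hm v hv =>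
    ⟨stab_apply_mem_orth hm.1 hv.1, stab_apply_mem_orth hm.2 hv.2⟩
  have h1 : P.W.map (Ad l x ^ k) = (P.W.map (x ^ k)).map l.1 := by
    rw [Ad_pow]
    ext v
    constructor
    · rintro ⟨w, hw, rfl⟩
      exact ⟨_, ⟨l⁻¹.1 w, hW _ (inv_mem hl) w hw, rfl⟩, rfl⟩
    · rintro ⟨_, ⟨w, hw, rfl⟩, rfl⟩
      exact ⟨l.1 w, hW l hl w hw, by rw [Ad_apply, unit_inv_apply]⟩
  rw [h1]
  have hinj : Function.Injective l.1 := fun a b hab => by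
    rw [← unit_inv_apply l a, hab, unit_inv_apply]
  exact (LinearEquiv.finrank_eq (Submodule.equivMapOfInjective l.1 hinj _)).symm

end ParabolicData

end InducedOrbit

namespace InducedOrbit

open ClassicalVariety

variable {V : Type*} [AddCommGroup V] [Module ℂ V] {B : LinearMap.BilinForm ℂ V} {ε : ℂ}

/-! ### Orbits are locally closed -/

theorem IsNilpotentOrbit.subset_classicalLie {O : Set (Module.End ℂ V)}
    (hO : IsNilpotentOrbit B O) : O ⊆ classicalLie B := by
  obtain ⟨x, hx, -, rfl⟩ := hO
  rintro _ ⟨g, hg, rfl⟩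
  exact Ad_mem_classicalLie hg hx

theorem IsNilpotentOrbit.eq_adOrbit {O : Set (Module.End ℂ V)}
    (hO : IsNilpotentOrbit B O) {z : Module.End ℂ V} (hz : z ∈ O) :
    O = adOrbit (classicalGroup B) z := by
  obtain ⟨x, -, -, rfl⟩ := hO
  exact (adOrbit_eq_of_mem hz).symm

theorem mem_classicalLie_of_mem_closure {O : Set (Module.End ℂ V)}
    (hO : IsNilpotentOrbit B O) {z : Module.End ℂ V} (hz : z ∈ zariskiClosure O) :
    z ∈ classicalLie B :=
  mem_submodule_of_mem_zariskiClosure _ hO.subset_classicalLie hz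

variable [FiniteDimensional ℂ V]

/-- Elements of the Lie algebra near an element of a nilpotent orbit are in the orbit if the ranks
of their powers are not larger than those for the orbit. -/
theorem exists_nhds_mem_orbit (hB : B.Nondegenerate) (hS : B.IsSymm ∨ B.IsAlt)
    {O : Set (Module.End ℂ V)} (hO : IsNilpotentOrbit B O) {d : Multiset ℕ}
    (hJ : ∀ z ∈ O, HasJordanType z d) {z₀ : Module.End ℂ V} (hz₀ : z₀ ∈ O) :
    ∃ δ ∈ polyFun (Module.End ℂ V), δ z₀ ≠ 0 ∧ ∀ z ∈ classicalLie B,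
      (∀ k, Module.finrank ℂ (LinearMap.range (z ^ k)) ≤ rankPow d k) → δ z ≠ 0 → z ∈ O := by
  have hd₀ := hJ z₀ hz₀
  obtain ⟨δ, hδ, hδ0, h⟩ :=
    exists_nhds_mem_adOrbit hB hS (hO.subset_classicalLie hz₀) hd₀
  choose η hη hη0 hle using fun k : ℕ => exists_rank_le
    ((IsPolyMap.linear (LinearMap.id (R := ℂ) (M := Module.End ℂ V))).pow k) z₀
  refine ⟨_, mul_mem_polyFun hδ (prod_mem_polyFun (s := Finset.range d.sum) fun k _ => hη k),
    mul_ne_zero hδ0 (Finset.prod_ne_zero_iff.2 fun k _ => hη0 k), fun z hz hzk hne => ?_⟩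
  rw [hO.eq_adOrbit hz₀]
  refine h z hz (hasJordanType_of_finrank hd₀.pos fun k => ?_) (left_ne_zero_of_mul hne)
  rcases lt_or_ge k d.sum with hk | hk
  · refine le_antisymm (hzk k) ?_
    rw [← hd₀.finrank_range_pow k]
    exact hle k z (Finset.prod_ne_zero_iff.1 (right_ne_zero_of_mul hne) k (Finset.mem_range.2 hk))
  · have h0 := rankPow_eq_zero (d := d) (k := k) fun a ha => (Multiset.le_sum_of_mem ha).trans hk
    have := hzk k
    omega

theorem finrank_range_pow_le_of_mem_closure {O : Set (Module.End ℂ V)} {d : Multiset ℕ}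
    (hJ : ∀ z ∈ O, HasJordanType z d) {z : Module.End ℂ V} (hz : z ∈ zariskiClosure O) (k : ℕ) :
    Module.finrank ℂ (LinearMap.range (z ^ k)) ≤ rankPow d k :=
  finrank_range_le_of_mem_zariskiClosure
    ((IsPolyMap.linear (LinearMap.id (R := ℂ) (M := Module.End ℂ V))).pow k)
    (fun s hs => ((hJ s hs).finrank_range_pow k).le) hz

theorem exists_nhds_closure_subset_orbit (hB : B.Nondegenerate) (hS : B.IsSymm ∨ B.IsAlt)
    {O : Set (Module.End ℂ V)} (hO : IsNilpotentOrbit B O) {d : Multiset ℕ}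
    (hJ : ∀ z ∈ O, HasJordanType z d) {z₀ : Module.End ℂ V} (hz₀ : z₀ ∈ O) :
    ∃ δ ∈ polyFun (Module.End ℂ V), δ z₀ ≠ 0 ∧ ∀ z ∈ zariskiClosure O, δ z ≠ 0 → z ∈ O := by
  obtain ⟨δ, hδ, h0, h⟩ := exists_nhds_mem_orbit hB hS hO hJ hz₀
  exact ⟨δ, hδ, h0, fun z hz => h z (mem_classicalLie_of_mem_closure hO hz)
    (finrank_range_pow_le_of_mem_closure hJ hz)⟩

namespace ParabolicData

variable {r : ℕ} {P : ParabolicData B r}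

/-! ### The induction theorem -/

/-- An element of the Lie algebra that vanishes on `F` is the sum of an element of the nilradical
and of its compression to `W` along `F ⊕ F'`. -/
theorem exists_sub_mem_nilradical (hB : B.Nondegenerate) (hε : HasSign B ε) {z : Module.End ℂ V}
    (hz : z ∈ classicalLie B) (hzF : ∀ v ∈ P.F, z v = 0) :
    ∃ x ∈ P.leviSecond, z - x ∈ P.nilradical := by
  obtain ⟨f, f', h, hf, hf'⟩ := P.exists_frame hB
  let p : Module.End ℂ V := LinearMap.id - ∑ i, (LinearMap.flip B (f' i)).smulRight (f i) -
    ∑ i, (B (f i)).smulRight (f' i)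
  have hp : ∀ v, p v = v - ∑ i, B v (f' i) • f i - ∑ i, B (f i) v • f' i := fun v => by
    simp [p, LinearMap.sum_apply]
  have hadj : ∀ u v, B (p u) v = B u (p v) := fun u v => by
    simp only [hp, map_sub, map_sum, map_smul, LinearMap.sub_apply, LinearMap.sum_apply,
      LinearMap.smul_apply, smul_eq_mul]
    have h1 : ∀ i, B (f i) u * B (f' i) v = B v (f' i) * B u (f i) := fun i => by
      rw [hε.swap (f i) u, hε.swap (f' i) v]
      linear_combination (B u (f i) * B v (f' i)) * hε.sq
    have h2 : ∀ i, B u (f' i) * B (f i) v = B (f i) v * B u (f' i) := fun i => mul_comm _ _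
    simp only [h1, h2]
    ring
  have hpF : ∀ v ∈ P.F, p v = 0 := fun v hv => by
    have h1 : ∀ i, B (f i) v = 0 := mem_orth_span.1 (by rw [hf]; exact P.isotropic_F hv)
    rw [hp, ← h.eq_sum (by rwa [hf])]
    simp [h1]
  have hpF' : ∀ v ∈ P.F', p v = 0 := fun v hv => by
    have h1 : ∀ i, B v (f' i) = 0 := fun i => by
      rw [hε.swap, mem_orth_span.1 (by rw [hf']; exact P.isotropic_F' hv), mul_zero]
    have h2 := (h.swap hε).eq_sum (v := v) (by rwa [span_smul_of_sign hε, hf'])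
    have h3 : ∑ i, B (f i) v • f' i = v := by
      conv_rhs => rw [h2]
      refine Finset.sum_congr rfl fun i _ => ?_
      rw [smul_smul, hε.swap (f i) v, mul_comm]
    rw [hp, h3]
    simp [h1]
  have hpo : ∀ v ∈ B.orthogonal P.F, p v - v ∈ P.F := fun v hv => by
    have h1 : ∀ i, B (f i) v = 0 := mem_orth_span.1 (by rwa [hf])
    have h2 : p v - v = -∑ i, B v (f' i) • f i := by
      rw [hp]
      simp [h1]
    rw [h2, ← hf]
    exact neg_mem (sum_mem fun i _ => Submodule.smul_mem _ _ (Submodule.subset_span ⟨i, rfl⟩))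
  have hx : p * z * p ∈ P.leviSecond := by
    refine ⟨mem_classicalLie.2 fun u v => ?_, fun v hv => ?_, fun v hv => ?_⟩
    · simp only [Module.End.mul_apply]
      rw [hadj, mem_classicalLie.1 hz, hadj]
    · simp only [Module.End.mul_apply]
      rw [hpF v hv, map_zero, map_zero]
    · simp only [Module.End.mul_apply]
      rw [hpF' v hv, map_zero, map_zero]
  refine ⟨_, hx, sub_mem hz hx.1, fun v => sub_mem (apply_mem_orth hz hzF v) (apply_mem_W hx v).1,
    fun v hv => ?_, fun v hv => ?_⟩
  · have h1 := hpo _ (apply_mem_orth hz hzF v)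
    have h2 : z (p v) = z v := by
      rw [← sub_eq_zero, ← map_sub, hzF _ (hpo v hv)]
    rw [LinearMap.sub_apply, Module.End.mul_apply, Module.End.mul_apply, h2, ← neg_sub]
    exact neg_mem h1
  · rw [LinearMap.sub_apply, hzF v hv, hx.2.1 v hv, sub_zero]

theorem isNilpotent_of_mem_leviSecond {x : Module.End ℂ V} (hx : x ∈ P.leviSecond)
    {d : Multiset ℕ} (hxd : ∀ k, Module.finrank ℂ (P.W.map (x ^ k)) = rankPow d k) :
    IsNilpotent x := by
  refine ⟨d.sum + 1, LinearMap.ext fun v => ?_⟩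
  have h0 := hxd d.sum
  rw [rankPow_eq_zero fun a ha => Multiset.le_sum_of_mem ha, Submodule.finrank_eq_zero] at h0
  rw [pow_succ, Module.End.mul_apply]
  exact (Submodule.mem_bot ℂ).1 (h0 ▸ ⟨x v, apply_mem_W hx v, rfl⟩)

/-- If one element of `O` lies in `n + x`, with `x` of Jordan type `shrink d (c + 2)` on `W`, then
`O` is induced from the orbit of `x`: the ranks of powers are maximal on `O ∩ (n + O')`, which gives
openness, and every element of `n + O'` lies on a line in `n + O'` that meets `O`. -/
theorem isInduced_of_mem (hB : B.Nondegenerate) (hS : B.IsSymm ∨ B.IsAlt)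
    {O : Set (Module.End ℂ V)} (hO : IsNilpotentOrbit B O) {d : Multiset ℕ}
    (hJ : ∀ z ∈ O, HasJordanType z d) {c : ℕ} (hr : r = numLargeParts d (c + 2))
    (hd : ∀ a ∈ d, a < c + 2 → a ≤ c) {y x : Module.End ℂ V} (hy : y ∈ P.nilradical)
    (hx : x ∈ P.leviSecond)
    (hxd : ∀ k, Module.finrank ℂ (P.W.map (x ^ k)) = rankPow (shrink d (c + 2)) k)
    (hz : y + x ∈ O) : P.IsInduced (adOrbit P.L x) O := by
  obtain ⟨ε, hε⟩ := exists_hasSign hS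
  have hrank : ∀ z ∈ P.nilradicalAdd (adOrbit P.L x), z ∈ classicalLie B ∧
      ∀ k, Module.finrank ℂ (LinearMap.range (z ^ k)) ≤ rankPow d k := by
    rintro _ ⟨y₁, hy₁, _, ⟨l, hl, rfl⟩, rfl⟩
    have hx₁ := Ad_mem_leviSecond hl hx
    exact ⟨add_mem_classicalLie hy₁ hx₁, finrank_range_add_pow_le hB hε hr hd hy₁ hx₁
      fun k => by rw [finrank_map_Ad_pow hl, hxd]⟩
  refine ⟨⟨x, ⟨hx.1, fun v hv => ?_, fun v hv => ?_⟩, isNilpotent_of_mem_leviSecond hx hxd, rfl⟩,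
    hO, ⟨{w | ∃ δ ∈ polyFun (Module.End ℂ V), δ w ≠ 0 ∧
      ∀ z ∈ P.nilradicalAdd (adOrbit P.L x), δ z ≠ 0 → z ∈ O}, ?_, ?_⟩, ?_⟩
  · rw [hx.2.1 v hv]
    exact zero_mem _
  · rw [hx.2.2 v hv]
    exact zero_mem _
  · rw [isOpen_zariski_iff]
    rintro w ⟨δ, hδ, h1, h2⟩
    exact ⟨δ, hδ, h1, fun x hx => ⟨δ, hδ, hx, h2⟩⟩
  · ext z
    constructor
    · rintro ⟨h1, h2⟩
      obtain ⟨δ, hδ, h3, h4⟩ := exists_nhds_mem_orbit hB hS hO hJ h1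
      exact ⟨⟨δ, hδ, h3, fun w hw => h4 w (hrank w hw).1 (hrank w hw).2⟩, h2⟩
    · rintro ⟨⟨δ, hδ, h1, h2⟩, h3⟩
      exact ⟨h2 z h3 h1, h3⟩
  · rintro _ ⟨y₁, hy₁, _, ⟨l, hl, rfl⟩, rfl⟩
    rw [mem_zariskiClosure]
    intro f hf hfz
    have hz' : Ad l (y + x) ∈ O := by
      rw [hO.eq_adOrbit hz]
      exact ⟨l, hl.1.1, rfl⟩
    obtain ⟨δ, hδ, h3, h4⟩ := exists_nhds_mem_orbit hB hS hO hJ hz'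
    obtain ⟨t, h5, h6⟩ := exists_ne_zero_on_line hf hδ hfz h3
    have hmem : (y₁ + Ad l x) + t • (Ad l (y + x) - (y₁ + Ad l x)) ∈
        P.nilradicalAdd (adOrbit P.L x) := by
      refine ⟨y₁ + t • (Ad l y + (-1 : ℂ) • y₁), add_mem_nilradical hy₁ (smul_mem_nilradical t
        (add_mem_nilradical (Ad_mem_nilradical hl.1 hy) (smul_mem_nilradical _ hy₁))),
        Ad l x, ⟨l, hl, rfl⟩, ?_⟩
      rw [Ad_add]
      module
    exact ⟨_, ⟨h4 _ (hrank _ hmem).1 (hrank _ hmem).2 h6, hmem⟩, h5⟩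

theorem exists_isInduced (hB : B.Nondegenerate) (hS : B.IsSymm ∨ B.IsAlt)
    {O : Set (Module.End ℂ V)} (hO : IsNilpotentOrbit B O) {d : Multiset ℕ}
    (hJ : ∀ z ∈ O, HasJordanType z d) {c : ℕ} (hd : ∀ a ∈ d, a < c + 2 → a ≤ c) :
    ∃ (P : ParabolicData B (numLargeParts d (c + 2))) (O' : Set (Module.End ℂ V)),
      P.HasTypeInSecondFactor O' (shrink d (c + 2)) ∧ P.IsInduced O' O := by
  obtain ⟨ε, hε⟩ := exists_hasSign hS
  obtain ⟨z, hzO⟩ : ∃ z, z ∈ O := by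
    obtain ⟨z, -, -, rfl⟩ := hO
    exact ⟨z, self_mem_adOrbit _ z⟩
  have hz := hO.subset_classicalLie hzO
  have hzd := hJ z hzO
  obtain ⟨F', hF', hc⟩ := exists_isotropic_compl hB hε (kernelRange_isotropic hz c)
  let P : ParabolicData B (numLargeParts d (c + 2)) :=
    { F := kernelRange z c
      F' := F'
      finrank_F := finrank_kernelRange hzd c
      isotropic_F := kernelRange_isotropic hz c
      isotropic_F' := hF'
      isCompl := hc }
  obtain ⟨x, hx, hy⟩ := exists_sub_mem_nilradical (P := P) hB hε hz fun v hv => hv.1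
  have hxd : ∀ k, Module.finrank ℂ (P.W.map (x ^ k)) = rankPow (shrink d (c + 2)) k := fun k => by
    have h1 := finrank_map_pow_orth_sup hB hε hy hx k
    have h2 := finrank_map_pow_orth_kernelRange hB hε hz hzd hd k
    rw [sub_add_cancel] at h1
    change Module.finrank ℂ ((B.orthogonal P.F).map (z ^ k) ⊔ P.F : Submodule ℂ V) = _ at h2
    omega
  refine ⟨P, adOrbit P.L x, (hasTypeInSecondFactor_iff pos_of_mem_shrink).2 ?_,
    isInduced_of_mem hB hS hO hJ rfl hd hy hx hxd (by rwa [sub_add_cancel])⟩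
  rintro _ ⟨l, hl, rfl⟩
  exact ⟨Ad_mem_leviSecond hl hx, fun k => by rw [finrank_map_Ad_pow hl, hxd]⟩

end ParabolicData

end InducedOrbit

namespace InducedOrbit

open ClassicalVariety

variable {V : Type*} [AddCommGroup V] [Module ℂ V] {B : LinearMap.BilinForm ℂ V} {ε : ℂ}

theorem IsHyperbolic.map {r : ℕ} {f f' : Fin r → V} (h : IsHyperbolic B f f')
    {g : (Module.End ℂ V)ˣ} (hg : g ∈ classicalGroup B) :
    IsHyperbolic B (fun i => g.1 (f i)) (fun i => g.1 (f' i)) where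
  left i j := by rw [hg.1, h.left]
  right i j := by rw [hg.1, h.right]
  dual i j := by rw [hg.1, h.dual]

theorem orth_map {g : (Module.End ℂ V)ˣ} (hg : g ∈ classicalGroup B) (N : Submodule ℂ V) :
    B.orthogonal (N.map g.1) = (B.orthogonal N).map g.1 := by
  ext v
  rw [mem_orth]
  constructor
  · intro h
    refine ⟨g⁻¹.1 v, mem_orth.2 fun n hn => ?_, unit_apply_inv g v⟩
    rw [← hg.1, unit_apply_inv]
    exact h _ ⟨n, hn, rfl⟩
  · rintro ⟨w, hw, rfl⟩ _ ⟨n, hn, rfl⟩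
    rw [hg.1]
    exact mem_orth.1 hw n hn

namespace ParabolicData

variable {r : ℕ} {P : ParabolicData B r}

/-! ### The parabolic subgroup acts on `n + O'` -/

theorem Ad_unipotent_sub_mem {u : (Module.End ℂ V)ˣ} (hu : u ∈ P.Q)
    (h : ∀ v ∈ B.orthogonal P.F, u.1 v - v ∈ P.F) {x : Module.End ℂ V} (hx : x ∈ P.leviSecond) :
    Ad u x - x ∈ P.nilradical := by
  have hu' := inv_mem hu
  have h1 : Ad u x ∈ classicalLie B := Ad_mem_classicalLie hu.1 hx.1
  have h2 : ∀ v ∈ P.F, Ad u x v = 0 := fun v hv => by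
    rw [Ad_apply, hx.2.1 _ (stab_apply_mem hu' hv), map_zero]
  refine ⟨sub_mem h1 hx.1, fun v => sub_mem (apply_mem_orth h1 h2 v) (apply_mem_W hx v).1,
    fun v hv => ?_, fun v hv => ?_⟩
  · have h3 : x (u⁻¹.1 v) = x v := by
      rw [← sub_eq_zero, ← map_sub]
      refine hx.2.1 _ ?_
      have h4 : u⁻¹.1 v - v = -u⁻¹.1 (u.1 v - v) := by
        rw [map_sub, unit_inv_apply, neg_sub]
      rw [h4]
      exact neg_mem (stab_apply_mem hu' (h v hv))
    rw [LinearMap.sub_apply, Ad_apply, h3]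
    exact h _ (apply_mem_W hx v).1
  · rw [LinearMap.sub_apply, h2 v hv, hx.2.1 v hv, sub_zero]

theorem mem_Q_of_map_eq {g g' : (Module.End ℂ V)ˣ}
    (hg : g ∈ classicalGroup B) (hg' : g' ∈ classicalGroup B)
    (h : P.F.map g.1 = P.F.map g'.1) : g⁻¹ * g' ∈ P.Q := by
  refine ⟨mul_mem (inv_mem hg) hg', ?_⟩
  rw [Units.val_mul, Module.End.mul_eq_comp, Submodule.map_comp, ← h, ← Submodule.map_comp,
    ← Module.End.mul_eq_comp, Units.inv_mul, Module.End.one_eq_id, Submodule.map_id]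

section

variable [FiniteDimensional ℂ V]

/-- The parabolic subgroup is the product of its unipotent radical and its Levi subgroup: some
element of the unipotent radical moves `F'` to its image under the given element. -/
theorem exists_unipotent_mul_levi (hB : B.Nondegenerate) (hε : HasSign B ε)
    {k : (Module.End ℂ V)ˣ} (hk : k ∈ P.Q) : ∃ u ∈ P.Q, ∃ l ∈ P.L, k = u * l ∧
      (∀ v ∈ P.F, u.1 v = v) ∧ ∀ v ∈ B.orthogonal P.F, u.1 v - v ∈ P.F := by
  have hiso : P.F'.map k.1 ≤ B.orthogonal (P.F'.map k.1) := by
    rw [orth_map hk.1]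
    exact Submodule.map_mono P.isotropic_F'
  have hcompl : IsCompl (B.orthogonal P.F) (P.F'.map k.1) := by
    have h1 : (B.orthogonal P.F).map k.1 = B.orthogonal P.F := by
      rw [← orth_map hk.1, hk.2]
    have hinj : Function.Injective k.1 := fun a b hab => by
      rw [← unit_inv_apply k a, hab, unit_inv_apply]
    refine ⟨?_, ?_⟩
    · rw [← h1]
      exact (Submodule.disjoint_map hinj P.isCompl.disjoint)
    · rw [← h1, codisjoint_iff, ← Submodule.map_sup, P.isCompl.sup_eq_top, Submodule.map_top,
        LinearMap.range_eq_top]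
      exact fun v => ⟨_, unit_apply_inv k v⟩
  obtain ⟨u, hu, hmap, h1, -, h2⟩ :=
    exists_unipotent hB hε P.isotropic_F P.isotropic_F' hiso P.isCompl hcompl
  have huQ : u ∈ P.Q := by
    refine ⟨hu, Submodule.ext fun v => ⟨?_, fun hv => ⟨v, hv, h1 v hv⟩⟩⟩
    rintro ⟨w, hw, rfl⟩
    rw [h1 w hw]
    exact hw
  refine ⟨u, huQ, u⁻¹ * k, ⟨P.Q.mul_mem (P.Q.inv_mem huQ) hk, mul_mem (inv_mem hu) hk.1, ?_⟩,
    by simp, h1, h2⟩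
  rw [Units.val_mul, Module.End.mul_eq_comp, Submodule.map_comp, ← hmap, ← Submodule.map_comp,
    ← Module.End.mul_eq_comp, Units.inv_mul, Module.End.one_eq_id, Submodule.map_id]

theorem Ad_mem_nilradicalAdd (hB : B.Nondegenerate) (hε : HasSign B ε) {x : Module.End ℂ V}
    (hx : x ∈ P.leviSecond) {k : (Module.End ℂ V)ˣ} (hk : k ∈ P.Q) {z : Module.End ℂ V}
    (hz : z ∈ P.nilradicalAdd (adOrbit P.L x)) : Ad k z ∈ P.nilradicalAdd (adOrbit P.L x) := by
  obtain ⟨u, hu, l, hl, rfl, -, h⟩ := exists_unipotent_mul_levi hB hε hk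
  obtain ⟨y, hy, x', hx', rfl⟩ := hz
  have hlx : Ad l x' ∈ P.leviSecond := by
    obtain ⟨m, hm, rfl⟩ := hx'
    exact Ad_mem_leviSecond hl (Ad_mem_leviSecond hm hx)
  refine ⟨_, add_mem_nilradical (Ad_mem_nilradical hk hy) (Ad_unipotent_sub_mem hu h hlx),
    _, Ad_mem_adOrbit hl hx', ?_⟩
  rw [Ad_add, Ad_mul u l x']
  abel

end

/-! ### The fibres of the generalized Springer map over the orbit -/

/-- The orbit `O` of Jordan type `d` is induced from the Levi orbit `O'` whose Jordan type on `W`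
is obtained from `d` by shrinking at a gap between `c` and `c + 2`. -/
structure IsGapInduced (P : ParabolicData B r) (O' O : Set (Module.End ℂ V)) (d : Multiset ℕ)
    (c : ℕ) : Prop where
  nondegenerate : B.Nondegenerate
  form : B.IsSymm ∨ B.IsAlt
  hasType : ∀ z ∈ O, HasJordanType z d
  rank_eq : r = numLargeParts d (c + 2)
  gap : ∀ a ∈ d, a < c + 2 → a ≤ c
  levi : ∀ x ∈ O', x ∈ P.leviSecond ∧
    ∀ k, Module.finrank ℂ (P.W.map (x ^ k)) = rankPow (shrink d (c + 2)) k
  isInduced : P.IsInduced O' O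

namespace IsGapInduced

variable {O' O : Set (Module.End ℂ V)} {d : Multiset ℕ} {c : ℕ}

theorem orbit (h : P.IsGapInduced O' O d c) : IsNilpotentOrbit B O := h.isInduced.2.1

theorem Ad_mem (h : P.IsGapInduced O' O d c) {g : (Module.End ℂ V)ˣ} (hg : g ∈ classicalGroup B)
    {z : Module.End ℂ V} (hz : z ∈ O) : Ad g z ∈ O := by
  obtain ⟨x, -, -, rfl⟩ := h.orbit
  exact Ad_mem_adOrbit hg hz

theorem mem_of_Ad_mem (h : P.IsGapInduced O' O d c) {g : (Module.End ℂ V)ˣ}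
    (hg : g ∈ classicalGroup B) {z : Module.End ℂ V} (hz : Ad g z ∈ O) : z ∈ O := by
  rw [← Ad_inv_Ad g z]
  exact h.Ad_mem (inv_mem hg) hz

theorem exists_mem (h : P.IsGapInduced O' O d c) : ∃ z ∈ O, z ∈ P.nilradicalAdd O' := by
  obtain ⟨x, -, -, hO'⟩ := h.isInduced.1
  have hx : 0 + x ∈ P.nilradicalAdd O' := by
    refine ⟨0, ⟨zero_mem _, by simp, by simp, by simp⟩, x, ?_, rfl⟩
    rw [hO']
    exact self_mem_adOrbit _ x
  obtain ⟨z, hz, -⟩ := mem_zariskiClosure.1 (h.isInduced.2.2.2 hx) _ (const_mem_polyFun 1)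
    one_ne_zero
  exact ⟨z, hz.1, hz.2⟩

theorem exists_springerMap_eq (h : P.IsGapInduced O' O d c) {z : Module.End ℂ V} (hz : z ∈ O) :
    ∃ a : P.Total O', Ad a.1.1 a.2.1 = z := by
  obtain ⟨z₁, hz₁, hz₁'⟩ := h.exists_mem
  rw [h.orbit.eq_adOrbit hz₁] at hz
  obtain ⟨g, hg, rfl⟩ := hz
  exact ⟨(⟨g, hg⟩, ⟨z₁, nilradicalAdd_mono (subset_zariskiClosure O') hz₁'⟩), rfl⟩

variable [FiniteDimensional ℂ V]

theorem kernelRange_eq (h : P.IsGapInduced O' O d c) {z : Module.End ℂ V} (hzO : z ∈ O)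
    (hz : z ∈ P.nilradicalAdd (zariskiClosure O')) : kernelRange z c = P.F := by
  obtain ⟨ε, hε⟩ := exists_hasSign h.form
  obtain ⟨y, hy, x, hx, hxd, rfl⟩ := mem_nilradicalAdd_closure h.levi hz
  exact (F_eq_kernelRange h.nondegenerate hε h.rank_eq h.gap hy hx hxd (h.hasType _ hzO)).symm

theorem kernelRange_Ad_eq (h : P.IsGapInduced O' O d c) (a : P.Total O')
    (ha : Ad a.1.1 a.2.1 ∈ O) : kernelRange (Ad a.1.1 a.2.1) c = P.F.map a.1.1.1 := by
  rw [kernelRange_conj, h.kernelRange_eq (h.mem_of_Ad_mem a.1.2 ha) a.2.2]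

theorem hasSubquotientType (h : P.IsGapInduced O' O d c) (a : P.Total O')
    (ha : Ad a.1.1 a.2.1 ∈ O) :
    HasSubquotientType B (Ad a.1.1 a.2.1) (P.F.map a.1.1.1) (shrink d (c + 2)) := by
  obtain ⟨ε, hε⟩ := exists_hasSign h.form
  rw [← h.kernelRange_Ad_eq a ha]
  exact hasSubquotientType_kernelRange h.nondegenerate hε (h.orbit.subset_classicalLie ha)
    (h.hasType _ ha) h.gap

theorem springerMap_injOn (h : P.IsGapInduced O' O d c) {a b : P.Total O'}
    (ha : Ad a.1.1 a.2.1 ∈ O) (hab : Ad a.1.1 a.2.1 = Ad b.1.1 b.2.1) :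
    (Quotient.mk (P.setoid O') a) = Quotient.mk (P.setoid O') b := by
  have h1 := h.kernelRange_Ad_eq a ha
  have h2 := h.kernelRange_Ad_eq b (hab ▸ ha)
  rw [← hab, h1] at h2
  refine Quotient.sound ⟨a.1.1⁻¹ * b.1.1, mem_Q_of_map_eq a.1.2 b.1.2 h2, by simp, ?_⟩
  rw [mul_inv_rev, inv_inv, Ad_mul, hab, Ad_inv_Ad]

theorem existsUnique_springerMap_eq (h : P.IsGapInduced O' O d c) (z : zariskiClosure O)
    (hz : z.1 ∈ O) : ∃! y, P.springerMap h.isInduced y = z := by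
  obtain ⟨a, ha⟩ := h.exists_springerMap_eq hz
  refine ⟨Quotient.mk _ a, Subtype.ext ha, fun y hy => ?_⟩
  induction y using Quotient.inductionOn with
  | h b =>
    have hb : Ad b.1.1 b.2.1 = z.1 := congrArg Subtype.val hy
    exact h.springerMap_injOn (by rwa [hb]) (by rw [hb, ha])

/-! ### Local sections of the generalized Springer map -/

/-- Near a point of `O` there is a rational section of `G × (n + closure O') → closure O`. The
isotropic subspace `kernelRange z c` has a basis that depends rationally on `z`; normalizing it to
be dual to a fixed isotropic family gives a unipotent element of the group that moves
a fixed isotropic subspace to `kernelRange z c`. -/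
theorem exists_section (h : P.IsGapInduced O' O d c) {z₀ : Module.End ℂ V} (hz₀ : z₀ ∈ O) :
    ∃ D ∈ polyFun (Module.End ℂ V), D z₀ ≠ 0 ∧
      ∃ H : Module.End ℂ V → Module.End ℂ V × Module.End ℂ V, IsPolyMap H ∧
        ∀ z ∈ O, D z ≠ 0 → ∃ a : P.Total O', (a.1.1.1, a.2.1) = (D z)⁻¹ • H z ∧
          Ad a.1.1 a.2.1 = z := by
  classical
  have hB := h.nondegenerate
  obtain ⟨ε, hε⟩ := exists_hasSign h.form
  obtain ⟨x, -, -, hO'⟩ := h.isInduced.1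
  have hx : x ∈ P.leviSecond := (h.levi x (hO' ▸ self_mem_adOrbit _ x)).1
  obtain ⟨z₁, hz₁, hz₁'⟩ := h.exists_mem
  have hz₁c := nilradicalAdd_mono (subset_zariskiClosure O') hz₁'
  have hF : kernelRange z₁ c = P.F := h.kernelRange_eq hz₁ hz₁c
  have horb := h.orbit.eq_adOrbit hz₁
  obtain ⟨g₀, hg₀, hzg₀⟩ : z₀ ∈ adOrbit (classicalGroup B) z₁ := horb ▸ hz₀
  obtain ⟨e, e', he, heF, heF'⟩ := P.exists_frame hB
  have hf := he.map hg₀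
  set f : Fin r → V := fun i => g₀.1 (e i) with hfdef
  set f' : Fin r → V := fun i => g₀.1 (e' i) with hf'def
  have hfspan : Submodule.span ℂ (Set.range f) = P.F.map g₀.1 := by
    rw [← heF, Submodule.map_span, ← Set.range_comp]
    rfl
  have hfmem : ∀ i, f i ∈ kernelRange z₀ c := fun i => by
    rw [hzg₀, kernelRange_conj, hF, ← hfspan]
    exact Submodule.subset_span ⟨i, rfl⟩
  choose w hw using fun i => (hfmem i).2
  have hw0 : ∀ i, (z₀ ^ (c + 2)) (w i) = 0 := fun i => by
    rw [pow_succ', Module.End.mul_apply, hw]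
    exact (hfmem i).1
  -- a family of vectors of `kernelRange z c`
  choose s hs δ hδ hδ0 hs0 hker using fun i => exists_kernel_section
    (A := fun z : Module.End ℂ V => z ^ (c + 2)) ((IsPolyMap.linear LinearMap.id).pow _) z₀ (hw0 i)
  let m : Fin r → Module.End ℂ V → V := fun i z => (z ^ (c + 1)) (s i z)
  have hm : ∀ i, IsPolyMap (m i) := fun i =>
    ((IsPolyMap.linear LinearMap.id).pow (c + 1)).apply (hs i)
  have hmmem : ∀ z ∈ O, ∀ i, δ i z ≠ 0 → m i z ∈ kernelRange z c := fun z hz i hne => by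
    refine ⟨?_, s i z, rfl⟩
    have h1 := hker i z hne (by
      rw [(h.hasType z hz).finrank_range_pow, (h.hasType z₀ hz₀).finrank_range_pow])
    rwa [pow_succ', Module.End.mul_apply] at h1
  -- its normalization, up to the factor `Δ z`
  let M : Module.End ℂ V → Matrix (Fin r) (Fin r) ℂ := fun z i j => B (m i z) (f' j)
  have hM : ∀ i j, (fun z => M z i j) ∈ polyFun (Module.End ℂ V) := fun i j =>
    hm i (LinearMap.flip B (f' j))
  let Δ : Module.End ℂ V → ℂ := fun z => (M z).det
  have hΔ : Δ ∈ polyFun (Module.End ℂ V) := det_mem_polyFun hM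
  have hΔ0 : Δ z₀ ≠ 0 := by
    have h1 : M z₀ = Matrix.diagonal fun i => δ i z₀ := by
      ext i j
      simp only [M, m]
      rw [hs0, map_smul, map_smul, LinearMap.smul_apply, hw, hf.dual, Matrix.diagonal_apply]
      split_ifs <;> simp
    simp only [Δ]
    rw [h1, Matrix.det_diagonal]
    exact Finset.prod_ne_zero_iff.2 fun i _ => hδ0 i
  let n : Module.End ℂ V → Fin r → V := fun z i => ∑ j, (M z).adjugate i j • m j z
  have hn : IsPolyMap n := IsPolyMap.pi fun i => IsPolyMap.sum fun j _ =>
    IsPolyMap.smul (adjugate_mem_polyFun hM i j) (hm j)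
  have hndual : ∀ z i k, B (n z i) (f' k) = if i = k then Δ z else 0 := fun z i k => by
    have h1 := congrFun (congrFun (Matrix.adjugate_mul (M z)) i) k
    rw [Matrix.mul_apply, Matrix.smul_apply, Matrix.one_apply] at h1
    simp only [n, map_sum, map_smul, LinearMap.sum_apply, LinearMap.smul_apply, smul_eq_mul]
    refine h1.trans ?_
    split_ifs <;> simp [Δ]
  let G : Module.End ℂ V → Module.End ℂ V := fun z =>
    (Δ z • 1 + unipotentMap B f f' (n z + Δ z • (-f))) * g₀.1
  have hG : IsPolyMap G := IsPolyMap.mul (IsPolyMap.add (IsPolyMap.smul hΔ (IsPolyMap.const 1))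
    (IsPolyMap.comp_linear _ (IsPolyMap.add hn (IsPolyMap.smul hΔ (IsPolyMap.const _)))))
    (IsPolyMap.const _)
  let π : Module.End ℂ V → ℂ := fun z => ∏ i, δ i z
  have hπ : π ∈ polyFun (Module.End ℂ V) := prod_mem_polyFun fun i _ => hδ i
  refine ⟨fun z => Δ z * Δ z * π z, mul_mem_polyFun (mul_mem_polyFun hΔ hΔ) hπ,
    mul_ne_zero (mul_ne_zero hΔ0 hΔ0) (Finset.prod_ne_zero_iff.2 fun i _ => hδ0 i),
    fun z => π z • (Δ z • G z, adjointMap B hB (G z) * z * G z),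
    IsPolyMap.smul hπ (IsPolyMap.prodMk (IsPolyMap.smul hΔ hG)
      (((IsPolyMap.comp_linear _ hG).mul (IsPolyMap.linear LinearMap.id)).mul hG)),
    fun z hz hne => ?_⟩
  have hπz : π z ≠ 0 := right_ne_zero_of_mul hne
  have hΔz : Δ z ≠ 0 := left_ne_zero_of_mul (left_ne_zero_of_mul hne)
  have hzL := h.orbit.subset_classicalLie hz
  have hmem : ∀ i, n z i ∈ kernelRange z c := fun i => sum_mem fun j _ =>
    Submodule.smul_mem _ _ (hmmem z hz j (Finset.prod_ne_zero_iff.1 hπz j (Finset.mem_univ j)))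
  let f₂ : Fin r → V := fun i => (Δ z)⁻¹ • n z i
  have hf₂mem : ∀ i, f₂ i ∈ kernelRange z c := fun i => Submodule.smul_mem _ _ (hmem i)
  have hf₂ : IsHyperbolic B f₂ f' :=
    { left := fun i j => mem_orth.1 (kernelRange_isotropic hzL c (hf₂mem j)) _ (hf₂mem i)
      right := hf.right
      dual := fun i j => by
        simp only [f₂, map_smul, LinearMap.smul_apply, hndual, smul_eq_mul]
        split_ifs <;> simp [hΔz] }
  have hspan₂ : Submodule.span ℂ (Set.range f₂) = kernelRange z c := by
    refine Submodule.eq_of_le_of_finrank_eq (Submodule.span_le.2 ?_) ?_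
    · rintro _ ⟨i, rfl⟩
      exact hf₂mem i
    · rw [hf₂.finrank_span, finrank_kernelRange (h.hasType z hz), h.rank_eq]
  obtain ⟨u, hu, huval⟩ := exists_unipotent_of_frames hB hε hf hf₂
  have hg : u * g₀ ∈ classicalGroup B := mul_mem hu hg₀
  have hgF : P.F.map (u * g₀).1 = kernelRange z c := by
    rw [Units.val_mul, Module.End.mul_eq_comp, Submodule.map_comp, ← hfspan, huval,
      one_add_unipotentMap_map hf, hspan₂]
  have hGz : (u * g₀).1 = (Δ z)⁻¹ • G z := by
    rw [Units.val_mul, huval]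
    simp only [G]
    rw [← smul_mul_assoc, smul_add, smul_smul, inv_mul_cancel₀ hΔz, one_smul, ← map_smul]
    congr 3
    funext i
    simp only [f₂, Pi.sub_apply, Pi.smul_apply, Pi.add_apply, smul_add, smul_smul,
      inv_mul_cancel₀ hΔz, one_smul, Pi.neg_apply, sub_eq_add_neg]
  obtain ⟨k, hk, hzk⟩ : z ∈ adOrbit (classicalGroup B) z₁ := horb ▸ hz
  have hkF : P.F.map (u * g₀).1 = P.F.map k.1 := by
    rw [hgF, hzk, kernelRange_conj, hF]
  have hz' : Ad (u * g₀)⁻¹ z ∈ P.nilradicalAdd O' := by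
    rw [hzk, ← Ad_mul, hO']
    exact Ad_mem_nilradicalAdd hB hε hx (mem_Q_of_map_eq hg hk hkF) (hO' ▸ hz₁')
  refine ⟨(⟨u * g₀, hg⟩, ⟨_, nilradicalAdd_mono (subset_zariskiClosure O') hz'⟩), ?_,
    Ad_Ad_inv _ _⟩
  have hinv : ((u * g₀)⁻¹).1 = (Δ z)⁻¹ • adjointMap B hB (G z) := by
    rw [inv_eq_adjointMap hB hg.1, hGz, map_smul]
  have hscal : (Δ z * Δ z * π z)⁻¹ * π z = (Δ z)⁻¹ * (Δ z)⁻¹ := by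
    field_simp
  rw [smul_smul, hscal, Prod.smul_mk, smul_smul]
  refine Prod.ext ?_ ?_
  · change (u * g₀).1 = _
    rw [hGz, mul_assoc, inv_mul_cancel₀ hΔz, mul_one]
  · change ((u * g₀)⁻¹).1 * z * (((u * g₀)⁻¹)⁻¹).1 = _
    rw [inv_inv, hinv, hGz, smul_mul_assoc, smul_mul_assoc, mul_smul_comm, smul_smul]

end IsGapInduced

end ParabolicData

end InducedOrbit

namespace InducedOrbit

open ClassicalVariety

open scoped Topology

variable {V : Type*} [AddCommGroup V] [Module ℂ V] {B : LinearMap.BilinForm ℂ V}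

namespace ParabolicData

variable {r : ℕ} {P : ParabolicData B r} {O' O : Set (Module.End ℂ V)} {d : Multiset ℕ} {c : ℕ}

/-! ### The generalized Springer map is birational -/

/-- The part of `closure O` lying in `O`. -/
def openOrbit (O : Set (Module.End ℂ V)) : Set (zariskiClosure O) := {z | z.1 ∈ O}

theorem dense_openOrbit :
    @Dense _ (embedded (Subtype.val : zariskiClosure O → _)).top (openOrbit O) := by
  rw [@dense_iff_inter_open]
  rintro _ ⟨T, hT, rfl⟩ ⟨z, hz⟩
  obtain ⟨f, hf, h1, h2⟩ := isOpen_zariski_iff.1 hT _ hz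
  obtain ⟨s, hs, hs'⟩ := mem_zariskiClosure.1 z.2 f hf h1
  exact ⟨⟨s, subset_zariskiClosure O hs⟩, h2 s hs', hs⟩

/-- Every element of `n + closure O'` is a limit of elements of `O ∩ (n + O')`. -/
theorem exists_mem_of_ne_zero (h : P.IsInduced O' O) {z : Module.End ℂ V}
    (hz : z ∈ P.nilradicalAdd (zariskiClosure O')) {f : Module.End ℂ V → ℂ}
    (hf : f ∈ polyFun (Module.End ℂ V)) (hfz : f z ≠ 0) :
    ∃ s ∈ O, s ∈ P.nilradicalAdd O' ∧ f s ≠ 0 := by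
  obtain ⟨y, hy, x, hx, rfl⟩ := hz
  have hpoly : IsPolyMap fun w : Module.End ℂ V => y + w :=
    IsPolyMap.add (IsPolyMap.const y) (IsPolyMap.linear LinearMap.id)
  obtain ⟨x', hx', h1⟩ := mem_zariskiClosure.1 hx _ (hpoly.comp_mem hf) hfz
  obtain ⟨s, hs, h2⟩ := mem_zariskiClosure.1 (h.2.2.2 ⟨y, hy, x', hx', rfl⟩) f hf h1
  exact ⟨s, hs.1, hs.2, h2⟩

namespace IsGapInduced

theorem dense_preimage_openOrbit (h : P.IsGapInduced O' O d c) :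
    @Dense _ (P.bundleVariety O').top (P.springerMap h.isInduced ⁻¹' openOrbit O) := by
  rw [@dense_iff_inter_open]
  rintro U ⟨T, hT, hTU⟩ ⟨y, hy⟩
  induction y using Quotient.inductionOn with
  | h a =>
    have ha : a ∈ (fun a : P.Total O' => (a.1.1.1, a.2.1)) ⁻¹' T := hTU ▸ hy
    obtain ⟨f, hf, h1, h2⟩ := isOpen_zariski_iff.1 hT _ ha
    have hpoly : IsPolyMap fun w : Module.End ℂ V => (a.1.1.1, w) :=
      IsPolyMap.prodMk (IsPolyMap.const _) (IsPolyMap.linear LinearMap.id)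
    obtain ⟨s, hs, hs', h3⟩ := exists_mem_of_ne_zero h.isInduced a.2.2 (hpoly.comp_mem hf) h1
    let b : P.Total O' := (a.1, ⟨s, nilradicalAdd_mono (subset_zariskiClosure O') hs'⟩)
    have hb : b ∈ (fun a : P.Total O' => (a.1.1.1, a.2.1)) ⁻¹' T := h2 _ h3
    rw [hTU] at hb
    exact ⟨Quotient.mk _ b, hb, h.Ad_mem a.1.2 hs⟩

end IsGapInduced

variable [FiniteDimensional ℂ V]

/-- The generalized Springer map is a morphism, because the inverse of an isometry is its adjoint
and so depends polynomially on it. -/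
theorem isMorphism_springerMap (hB : B.Nondegenerate) (h : P.IsInduced O' O) :
    IsMorphism (P.bundleVariety O') (embedded (Subtype.val : zariskiClosure O → _))
      (P.springerMap h) := by
  let Φ : Module.End ℂ V × Module.End ℂ V → Module.End ℂ V :=
    fun w => w.1 * w.2 * adjointMap B hB w.1
  have hfst : IsPolyMap fun w : Module.End ℂ V × Module.End ℂ V => w.1 :=
    IsPolyMap.linear (LinearMap.fst ℂ (Module.End ℂ V) (Module.End ℂ V))
  have hsnd : IsPolyMap fun w : Module.End ℂ V × Module.End ℂ V => w.2 :=
    IsPolyMap.linear (LinearMap.snd ℂ (Module.End ℂ V) (Module.End ℂ V))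
  have hΦ : IsPolyMap Φ := (hfst.mul hsnd).mul (IsPolyMap.comp_linear _ hfst)
  have hval : ∀ a : P.Total O', (P.springerMap h (Quotient.mk _ a)).1 = Φ (a.1.1.1, a.2.1) :=
    fun a => by
      change a.1.1.1 * a.2.1 * (a.1.1⁻¹).1 = _
      rw [inv_eq_adjointMap hB a.1.2.1]
  constructor
  · rintro _ ⟨T, hT, rfl⟩
    refine ⟨_, hΦ.isOpen_preimage hT, ?_⟩
    ext a
    change Φ (a.1.1.1, a.2.1) ∈ T ↔ (P.springerMap h (Quotient.mk _ a)).1 ∈ T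
    rw [hval]
  · intro T _ φ hφ a ha
    obtain ⟨p, hp, q, hq, h0, h1⟩ := hφ (P.springerMap h (Quotient.mk _ a)) ha
    rw [hval] at h0
    refine ⟨_, hΦ.comp_mem hp, _, hΦ.comp_mem hq, h0, fun b hb hb' => ?_⟩
    have h2 := h1 (P.springerMap h (Quotient.mk _ b)) hb (by rwa [hval])
    rwa [hval] at h2

namespace IsGapInduced

theorem isOpen_openOrbit (h : P.IsGapInduced O' O d c) :
    IsOpen[(embedded (Subtype.val : zariskiClosure O → _)).top] (openOrbit O) := by
  refine ⟨{w | ∃ δ ∈ polyFun (Module.End ℂ V), δ w ≠ 0 ∧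
    ∀ z ∈ zariskiClosure O, δ z ≠ 0 → z ∈ O}, ?_, ?_⟩
  · rw [isOpen_zariski_iff]
    rintro w ⟨δ, hδ, h1, h2⟩
    exact ⟨δ, hδ, h1, fun x hx => ⟨δ, hδ, hx, h2⟩⟩
  · ext z
    constructor
    · rintro ⟨δ, hδ, h1, h2⟩
      exact h2 z z.2 h1
    · intro hz
      exact exists_nhds_closure_subset_orbit h.nondegenerate h.form h.orbit h.hasType hz

theorem bijOn_springerMap (h : P.IsGapInduced O' O d c) :
    Set.BijOn (P.springerMap h.isInduced) (P.springerMap h.isInduced ⁻¹' openOrbit O)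
      (openOrbit O) := by
  refine ⟨fun y hy => hy, fun y hy y' _ hyy' => ?_, fun z hz => ?_⟩
  · exact (h.existsUnique_springerMap_eq _ hy).unique rfl hyy'.symm
  · obtain ⟨y, rfl, -⟩ := h.existsUnique_springerMap_eq z hz
    exact ⟨y, hz, rfl⟩

/-- Composition with a rational local section carries open sets and regular functions on the bundle
back to `O`. -/
theorem restrictsToIso_springerMap (h : P.IsGapInduced O' O d c) :
    RestrictsToIso (P.bundleVariety O') (embedded (Subtype.val : zariskiClosure O → _))
      (P.springerMap h.isInduced) (P.springerMap h.isInduced ⁻¹' openOrbit O) (openOrbit O) := by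
  have hmor := isMorphism_springerMap h.nondegenerate h.isInduced
  have hinter : ∀ T ⊆ openOrbit O, P.springerMap h.isInduced ⁻¹' openOrbit O ∩
      P.springerMap h.isInduced ⁻¹' T = P.springerMap h.isInduced ⁻¹' T := fun T hT =>
    Set.inter_eq_right.2 (Set.preimage_mono hT)
  refine ⟨h.bijOn_springerMap, fun T hT => ?_, fun T hT hTo φ => ?_⟩ <;> rw [hinter T hT]
  · refine ⟨hmor.1 T, ?_⟩
    rintro ⟨Ω, hΩ, hΩT⟩
    have hmem : ∀ a : P.Total O', (a.1.1.1, a.2.1) ∈ Ω ↔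
        P.springerMap h.isInduced (Quotient.mk _ a) ∈ T := fun a => Set.ext_iff.1 hΩT a
    refine ⟨{w | ∃ δ ∈ polyFun (Module.End ℂ V), δ w ≠ 0 ∧
      ∀ z : zariskiClosure O, δ z ≠ 0 → z ∈ T}, ?_, ?_⟩
    · rw [isOpen_zariski_iff]
      rintro w ⟨δ, hδ, h1, h2⟩
      exact ⟨δ, hδ, h1, fun x hx => ⟨δ, hδ, hx, h2⟩⟩
    · ext z
      refine ⟨fun ⟨δ, _, h1, h2⟩ => h2 z h1, fun hz => ?_⟩
      obtain ⟨η, hη, hη0, hηO⟩ := exists_nhds_closure_subset_orbit h.nondegenerate h.form h.orbit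
        h.hasType (hT hz)
      obtain ⟨D, hD, hD0, H, hH, hsec⟩ := h.exists_section (hT hz)
      obtain ⟨a, ha, haz⟩ := hsec z (hT hz) hD0
      have haΩ : (a.1.1.1, a.2.1) ∈ Ω := (hmem a).2 (by
        convert hz
        exact Subtype.ext haz)
      obtain ⟨p, hp, hp0, hpΩ⟩ := isOpen_zariski_iff.1 hΩ _ haΩ
      obtain ⟨Q, hQ, N, hQN⟩ := exists_pullback_div hp hH hD
      refine ⟨_, mul_mem_polyFun (mul_mem_polyFun hη hD) hQ,
        mul_ne_zero (mul_ne_zero hη0 hD0) ?_, fun z' hz' => ?_⟩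
      · rw [ha, hQN _ hD0] at hp0
        exact (div_ne_zero_iff.1 hp0).1
      · have hD' : D z'.1 ≠ 0 := right_ne_zero_of_mul (left_ne_zero_of_mul hz')
        have hO : z'.1 ∈ O := hηO _ z'.2 (left_ne_zero_of_mul (left_ne_zero_of_mul hz'))
        obtain ⟨b, hb, hbz⟩ := hsec z' hO hD'
        have h3 : P.springerMap h.isInduced (Quotient.mk _ b) = z' := Subtype.ext hbz
        rw [← h3, ← hmem]
        refine hpΩ _ ?_
        rw [hb, hQN _ hD']
        exact div_ne_zero (right_ne_zero_of_mul hz') (pow_ne_zero _ hD')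
  · refine ⟨hmor.2 T hTo φ, fun hφ z hz => ?_⟩
    obtain ⟨D, hD, hD0, H, hH, hsec⟩ := h.exists_section (hT hz)
    obtain ⟨a, ha, haz⟩ := hsec z (hT hz) hD0
    have haz' : P.springerMap h.isInduced (Quotient.mk _ a) = z := Subtype.ext haz
    have haT : a ∈ Quotient.mk (P.setoid O') ⁻¹' (P.springerMap h.isInduced ⁻¹' T) := by
      change P.springerMap h.isInduced (Quotient.mk _ a) ∈ T
      rwa [haz']
    obtain ⟨p, hp, q, hq, hq0, hpq⟩ := hφ a haT
    obtain ⟨p', hp', N, hpN⟩ := exists_pullback_div hp hH hD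
    obtain ⟨q', hq', M, hqM⟩ := exists_pullback_div hq hH hD
    refine ⟨_, mul_mem_polyFun hp' (mul_mem_polyFun (pow_mem_polyFun hD M) hD), _,
      mul_mem_polyFun hq' (mul_mem_polyFun (pow_mem_polyFun hD N) hD), ?_, fun z' hz' hne => ?_⟩
    · refine mul_ne_zero ?_ (mul_ne_zero (pow_ne_zero _ hD0) hD0)
      simp only at hq0
      rw [ha, hqM _ hD0] at hq0
      exact (div_ne_zero_iff.1 hq0).1
    · have hD' : D z'.1 ≠ 0 := right_ne_zero_of_mul (right_ne_zero_of_mul hne)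
      have hq'0 : q' z'.1 ≠ 0 := left_ne_zero_of_mul hne
      obtain ⟨b, hb, hbz⟩ := hsec z' (hT hz') hD'
      have hbz' : P.springerMap h.isInduced (Quotient.mk _ b) = z' := Subtype.ext hbz
      have hbT : b ∈ Quotient.mk (P.setoid O') ⁻¹' (P.springerMap h.isInduced ⁻¹' T) := by
        change P.springerMap h.isInduced (Quotient.mk _ b) ∈ T
        rwa [hbz']
      have h1 := hpq b hbT
      simp only [Function.comp_apply] at h1
      rw [hbz', hb, hpN _ hD', hqM _ hD'] at h1
      rw [h1 (div_ne_zero hq'0 (pow_ne_zero _ hD'))]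
      field_simp

theorem isBirational_springerMap (h : P.IsGapInduced O' O d c) :
    IsBirational (P.bundleVariety O') (embedded (Subtype.val : zariskiClosure O → _))
      (P.springerMap h.isInduced) :=
  ⟨isMorphism_springerMap h.nondegenerate h.isInduced, _, _,
    (isMorphism_springerMap h.nondegenerate h.isInduced).1 _ h.isOpen_openOrbit,
    h.dense_preimage_openOrbit, h.isOpen_openOrbit, dense_openOrbit, h.restrictsToIso_springerMap⟩

end IsGapInduced

end ParabolicData

end InducedOrbit

theorem mainTheorem7 {V : Type*} [AddCommGroup V] [Module ℂ V] [FiniteDimensional ℂ V]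
    (B : LinearMap.BilinForm ℂ V) (hB : B.Nondegenerate) (hε : B.IsSymm ∨ B.IsAlt)
    (m : ℕ) (hm : Module.finrank ℂ V = m) (d : m.Partition)
    (hd : ¬ InducedOrbit.HasFullMembers d.parts)
    (O : Set (Module.End ℂ V)) (hO : InducedOrbit.IsNilpotentOrbit B O)
    (hJ : ∀ z ∈ O, InducedOrbit.HasJordanType z d.parts) :
    (∃ e, InducedOrbit.IsGap d.parts e) ∧
    ∀ e, InducedOrbit.IsGap d.parts e →
      (∃ (P : InducedOrbit.ParabolicData B (InducedOrbit.numLargeParts d.parts e))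
        (O' : Set (Module.End ℂ V)),
        P.HasTypeInSecondFactor O' (InducedOrbit.shrink d.parts e) ∧ P.IsInduced O' O) ∧
      (∀ (P : InducedOrbit.ParabolicData B (InducedOrbit.numLargeParts d.parts e))
        (O' : Set (Module.End ℂ V)),
        P.HasTypeInSecondFactor O' (InducedOrbit.shrink d.parts e) →
        ∀ h : P.IsInduced O' O,
          ClassicalVariety.IsBirational (P.bundleVariety O')
            (ClassicalVariety.embedded (Subtype.val : ClassicalVariety.zariskiClosure O → _))
            (P.springerMap h) ∧
          (∀ z : ClassicalVariety.zariskiClosure O, z.1 ∈ O → ∃! y, P.springerMap h y = z) ∧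
          ∀ a : P.Total O', InducedOrbit.Ad a.1.1 a.2.1 ∈ O →
            InducedOrbit.HasSubquotientType B (InducedOrbit.Ad a.1.1 a.2.1) (P.F.map a.1.1.1)
              (InducedOrbit.shrink d.parts e)) ∧
      ∀ z ∈ O, ∃! F : Submodule ℂ V,
        Module.finrank ℂ F = InducedOrbit.numLargeParts d.parts e ∧ F ≤ B.orthogonal F ∧
        InducedOrbit.HasSubquotientType B z F (InducedOrbit.shrink d.parts e) := by
  obtain ⟨ε, hsign⟩ := InducedOrbit.exists_hasSign hε
  refine ⟨InducedOrbit.exists_isGap hd, fun e he => ?_⟩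
  obtain ⟨c, rfl, hgap⟩ := he.exists_eq
  refine ⟨InducedOrbit.ParabolicData.exists_isInduced hB hε hO hJ hgap, fun P O' hO' h => ?_,
    fun z hz => InducedOrbit.existsUnique_isotropic hB hsign (hO.subset_classicalLie hz) (hJ z hz)
      hgap⟩
  have key : P.IsGapInduced O' O d.parts c :=
    { nondegenerate := hB
      form := hε
      hasType := hJ
      rank_eq := rfl
      gap := hgap
      levi := (InducedOrbit.ParabolicData.hasTypeInSecondFactor_iff
        InducedOrbit.pos_of_mem_shrink).1 hO'
      isInduced := h }
  exact ⟨key.isBirational_springerMap, key.existsUnique_springerMap_eq, key.hasSubquotientType⟩
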